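/- Every elliptic curve $E$ over $\mathbb{Q}$ is isomorphic to $E_{A,B}: y^2=x^3+Ax+B$ for a unique pair $(A,B)\in\mathbb{Z}^2$ with $4A^3+27B^2\neq 0$ and such that $q^6\nmid B$ for every prime $q$ with $q^4\mid A$; its (naive) height is $H(E)=H(E_{A,B})=\max\{4|A^3|,27B^2\}$. Let $N(E)$ denote the conductor of $E$, and write $\ell\,\|\,N(E)$ if $\ell\mid N(E)$ and $\ell^2\nmid N(E)$. Let $p$ be any prime. Then, when ordered by height, a density of $100\%$ of elliptic curves $E$ over $\mathbb{Q}$ possess both of the following properties: (i) $E[p]$ is an irreducible $\mathrm{Gal}(\overline{\mathbb{Q}}/\mathbb{Q})$-module; (ii) there exist at least two primes $\ell\,\|\,N(E)$, $\ell\neq p$, such that $E[p]$ is ramified at $\ell$ (i.e. an inertia group at $\ell$ acts non-trivially on $E[p]$). That is, $$\lim_{X\to\infty}\frac{\#\{E/\mathbb{Q}\ :\ H(E)<X,\ E\text{ satisfies (i) and (ii)}\}}{\#\{E/\mathbb{Q}\ :\ H(E)<X\}}=1,$$ where $E$ runs over the isomorphism classes of elliptic curves over $\mathbb{Q}$. 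-/

import Mathlib

open WeierstrassCurve

noncomputable section

namespace EllipticCurveDensity

/-! ### Torsion points and their Galois action -/

open scoped Classical in
/-- The group `E(K)[n]` of `K`-rational `n`-torsion points of a Weierstrass curve `E` over `ℚ`. -/
abbrev Torsion (E : WeierstrassCurve ℚ) (K : Type) [Field K] [Algebra ℚ K] (n : ℕ) : Type :=
  AddSubgroup.torsionBy (E⁄K).toAffine.Point (n : ℤ)

open scoped Classical in
instance torsionModule (E : WeierstrassCurve ℚ) (K : Type) [Field K] [Algebra ℚ K] (n : ℕ) :
    Module (ZMod n) (Torsion E K n) :=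
  AddSubgroup.torsionBy.zmodModule

open scoped Classical in
/-- The endomorphism of `E(K)[n]` given by applying a field automorphism `σ` of `K` to the
coordinates of points. -/
def torsionMap (E : WeierstrassCurve ℚ) (K : Type) [Field K] [Algebra ℚ K] (n : ℕ)
    (σ : K ≃ₐ[ℚ] K) : Torsion E K n →+ Torsion E K n :=
  ((Affine.Point.map (W' := E.toAffine) σ.toAlgHom).comp
    (AddSubgroup.torsionBy (E⁄K).toAffine.Point (n : ℤ)).subtype).codRestrict _ (by
      intro P
      refine AddSubgroup.torsionBy.nsmul_iff.mpr ?_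
      rw [← map_nsmul]
      simp)

/-- The `ZMod n`-linear representation of `Aut(K/ℚ)` on `E(K)[n]`. -/
def torsionRep (E : WeierstrassCurve ℚ) (K : Type) [Field K] [Algebra ℚ K] (n : ℕ) :
    Representation (ZMod n) (K ≃ₐ[ℚ] K) (Torsion E K n) where
  toFun σ := (torsionMap E K n σ).toZModLinearMap n
  map_one' := by
    ext P
    obtain ⟨P, hP⟩ := P
    cases P <;> rfl
  map_mul' σ τ := by
    ext P
    obtain ⟨P, hP⟩ := P
    cases P <;> rfl

/-- `E[p]` is an irreducible `Gal(ℚ̄/ℚ)`-module. -/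
def IsTorsionIrreducible (E : WeierstrassCurve ℚ) (p : ℕ) [Fact p.Prime] : Prop :=
  (torsionRep E (AlgebraicClosure ℚ) p).IsIrreducible

/-- `E[p]` is ramified at `ℓ`: for some prime `𝔏` of the ring of all algebraic integers above `ℓ`,
the inertia group of `𝔏` in `Gal(ℚ̄/ℚ)` acts non-trivially on `E[p]`. The primes above `ℓ` are all
conjugate, so that 'for some `𝔏`' and 'for every `𝔏`' amount to the same. -/
def IsTorsionRamifiedAt (E : WeierstrassCurve ℚ) (p ℓ : ℕ) : Prop :=
  ∃ 𝔏 : Ideal (integralClosure ℤ (AlgebraicClosure ℚ)), 𝔏.IsPrime ∧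
    𝔏.LiesOver (Ideal.span {(ℓ : ℤ)}) ∧
    ∃ σ ∈ 𝔏.inertia (AlgebraicClosure ℚ ≃ₐ[ℚ] AlgebraicClosure ℚ),
      torsionRep E (AlgebraicClosure ℚ) p σ ≠ 1

/-! ### The conductor -/

/-- `E` has good reduction at `ℓ`: some minimal Weierstrass model over `ℤ_ℓ` has. -/
def HasGoodReductionAt (E : WeierstrassCurve ℚ) (ℓ : ℕ) [Fact ℓ.Prime] : Prop :=
  ∃ C : VariableChange ℚ_[ℓ], (C • (E⁄ℚ_[ℓ])).HasGoodReduction ℤ_[ℓ]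

/-- `E` has multiplicative reduction at `ℓ`: some minimal Weierstrass model over `ℤ_ℓ` has. -/
def HasMultiplicativeReductionAt (E : WeierstrassCurve ℚ) (ℓ : ℕ) [Fact ℓ.Prime] : Prop :=
  ∃ C : VariableChange ℚ_[ℓ], (C • (E⁄ℚ_[ℓ])).HasMultiplicativeReduction ℤ_[ℓ]

open scoped Classical in
/-- The field `ℚ(E[m])`, generated by the coordinates of the `m`-torsion points. -/
def divisionField (E : WeierstrassCurve ℚ) (m : ℕ) : IntermediateField ℚ (AlgebraicClosure ℚ) :=
  IntermediateField.adjoin ℚ {z | ∃ (x y : AlgebraicClosure ℚ)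
    (h : (E⁄(AlgebraicClosure ℚ)).toAffine.Nonsingular x y),
    m • (Affine.Point.some x y h : (E⁄(AlgebraicClosure ℚ)).toAffine.Point) = 0 ∧ (z = x ∨ z = y)}

/-- A chosen prime of the ring of integers of `ℚ(E[m])` above `ℓ`; they are all conjugate. -/
def divisionFieldPrime (E : WeierstrassCurve ℚ) (m ℓ : ℕ) [Fact ℓ.Prime] :
    Ideal (integralClosure ℤ (divisionField E m)) :=
  haveI : (Ideal.span {(ℓ : ℤ)}).IsPrime :=
    (Ideal.span_singleton_prime (Int.natCast_ne_zero.mpr (Fact.out : ℓ.Prime).ne_zero)).mpr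
      (Nat.prime_iff_prime_int.mp Fact.out)
  (Classical.arbitrary (Ideal.primesOver (Ideal.span {(ℓ : ℤ)})
    (integralClosure ℤ (divisionField E m)))).1

/-- The `i`-th ramification group `G_i` (lower numbering) at `ℓ` of `ℚ(E[m])` over `ℚ`: the
automorphisms that act trivially on the ring of integers modulo the `(i + 1)`-st power of the chosen
prime above `ℓ`. -/
def ramificationGroup (E : WeierstrassCurve ℚ) (m ℓ : ℕ) [Fact ℓ.Prime] (i : ℕ) :
    Subgroup (divisionField E m ≃ₐ[ℚ] divisionField E m) :=
  (divisionFieldPrime E m ℓ ^ (i + 1)).inertia (divisionField E m ≃ₐ[ℚ] divisionField E m)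

/-- The wild part `∑_{i ≥ 1} (#G_i / #G_0) · dim (E[m] / E[m] ^ G_i)` of the exponent of the
conductor at `ℓ`, computed with the auxiliary prime `m ≠ ℓ`. -/
def wildSum (E : WeierstrassCurve ℚ) (m ℓ : ℕ) [Fact ℓ.Prime] : ℚ :=
  ∑ᶠ i : ℕ, (Nat.card (ramificationGroup E m ℓ (i + 1)) : ℚ) /
      (Nat.card (ramificationGroup E m ℓ 0) : ℚ) *
    (Module.finrank (ZMod m) (Torsion E (divisionField E m) m ⧸
      Representation.invariants ((torsionRep E (divisionField E m) m).comp
        (ramificationGroup E m ℓ (i + 1)).subtype)) : ℚ)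

/-- The wild part of the exponent of the conductor of `E` at `ℓ`. It is a non-negative integer and
does not depend on the auxiliary prime, for which we take `3` if `ℓ = 2`, and `2` otherwise. -/
def wildExponent (E : WeierstrassCurve ℚ) (ℓ : ℕ) [Fact ℓ.Prime] : ℕ :=
  ⌊wildSum E (if ℓ = 2 then 3 else 2) ℓ⌋₊

open scoped Classical in
/-- The exponent of the conductor of `E` at `ℓ`: `0` for good reduction, `1` for multiplicative
reduction, and `2` plus the wild part for additive reduction. -/
def conductorExponent (E : WeierstrassCurve ℚ) (ℓ : ℕ) [Fact ℓ.Prime] : ℕ :=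
  if HasGoodReductionAt E ℓ then 0
  else if HasMultiplicativeReductionAt E ℓ then 1
  else 2 + wildExponent E ℓ

/-- The conductor `N(E) = ∏_ℓ ℓ ^ f_ℓ`. -/
def conductor (E : WeierstrassCurve ℚ) : ℕ :=
  ∏ᶠ ℓ : Nat.Primes, haveI : Fact (ℓ : ℕ).Prime := ⟨ℓ.2⟩; (ℓ : ℕ) ^ conductorExponent E ℓ

/-! ### Elliptic curves over `ℚ` ordered by height -/

/-- The curve `E_{A,B} : y² = x³ + A x + B`. -/
def shortCurve (A B : ℤ) : WeierstrassCurve ℚ where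
  a₁ := 0
  a₂ := 0
  a₃ := 0
  a₄ := A
  a₆ := B

/-- The pairs `(A, B)` for which `E_{A,B}` is an elliptic curve and no prime `q` satisfies
`q⁴ ∣ A` and `q⁶ ∣ B`. Every elliptic curve over `ℚ` is isomorphic to `E_{A,B}` for exactly one
such pair. -/
def curves : Set (ℤ × ℤ) :=
  {c | (shortCurve c.1 c.2).IsElliptic ∧
    ∀ q : ℕ, q.Prime → (q : ℤ) ^ 4 ∣ c.1 → ¬ (q : ℤ) ^ 6 ∣ c.2}

/-- The naive height `max(4|A³|, 27B²)`. -/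
def height (c : ℤ × ℤ) : ℤ := max (4 * |c.1 ^ 3|) (27 * c.2 ^ 2)

/-- When ordered by height, a density of `100%` of the elliptic curves over `ℚ` have property `P`:
the proportion of those of height less than `X` which satisfy `P` tends to `1` as `X → ∞`. -/
def HoldsForDensityOne (P : WeierstrassCurve ℚ → Prop) : Prop :=
  Filter.Tendsto
    (fun X : ℝ => (({c ∈ curves | (height c : ℝ) < X ∧ P (shortCurve c.1 c.2)}.ncard : ℕ) : ℝ) /
      (({c ∈ curves | (height c : ℝ) < X}.ncard : ℕ) : ℝ))
    Filter.atTop (nhds 1)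

end EllipticCurveDensity

end

noncomputable section

namespace EllipticCurveDensity

set_option linter.unusedSectionVars false

open Polynomial

/-- The point `P` is the affine point with coordinates `(x, y)`. -/
def HasCoords {F : Type*} [CommRing F] {W : WeierstrassCurve F} (P : W.toAffine.Point) (x y : F) :
    Prop :=
  ∃ h, P = Affine.Point.some x y h

section Coordinates

variable {F : Type*} [Field F] {W : WeierstrassCurve F}

lemma HasCoords.ne_zero {P : W.toAffine.Point} {x y : F} (h : HasCoords P x y) : P ≠ 0 := by
  obtain ⟨_, rfl⟩ := h
  exact Affine.Point.some_ne_zero _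

lemma exists_hasCoords {P : W.toAffine.Point} (h : P ≠ 0) : ∃ x y, HasCoords P x y := by
  cases P with
  | zero => exact (h rfl).elim
  | some x y h' => exact ⟨x, y, h', rfl⟩

lemma HasCoords.unique {P : W.toAffine.Point} {x y x' y' : F} (h : HasCoords P x y)
    (h' : HasCoords P x' y') : x = x' ∧ y = y' := by
  obtain ⟨h, rfl⟩ := h
  obtain ⟨h', e⟩ := h'
  simpa using e

variable [W.IsShortNF]

lemma HasCoords.equation {P : W.toAffine.Point} {x y : F} (h : HasCoords P x y) :
    y ^ 2 = x ^ 3 + W.a₄ * x + W.a₆ := by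
  obtain ⟨h, rfl⟩ := h
  have := (Affine.equation_iff x y).mp h.1
  simpa using this

lemma HasCoords.neg {P : W.toAffine.Point} {x y : F} (h : HasCoords P x y) :
    HasCoords (-P) x (-y) := by
  obtain ⟨h, rfl⟩ := h
  have e : W.toAffine.negY x y = -y := by simp [Affine.negY]
  refine ⟨e ▸ (Affine.nonsingular_neg x y).mpr h, ?_⟩
  rw [Affine.Point.neg_some]
  congr 1

variable [DecidableEq F]

lemma HasCoords.eq_or_eq_neg {P Q : W.toAffine.Point} {x y y' : F} (hP : HasCoords P x y)
    (hQ : HasCoords Q x y') : P = Q ∨ P = -Q := by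
  obtain ⟨h, rfl⟩ := hP
  obtain ⟨h', rfl⟩ := hQ
  exact Affine.Point.X_eq_iff.mp rfl

lemma HasCoords.add {P Q : W.toAffine.Point} {x₁ y₁ x₂ y₂ : F} (h₁ : HasCoords P x₁ y₁)
    (h₂ : HasCoords Q x₂ y₂) (hx : x₁ ≠ x₂) :
    ∃ y, HasCoords (P + Q) (((y₁ - y₂) / (x₁ - x₂)) ^ 2 - x₁ - x₂) y := by
  obtain ⟨h₁, rfl⟩ := h₁
  obtain ⟨h₂, rfl⟩ := h₂
  have e : W.toAffine.addX x₁ x₂ (W.toAffine.slope x₁ x₂ y₁ y₂) =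
      ((y₁ - y₂) / (x₁ - x₂)) ^ 2 - x₁ - x₂ := by
    rw [Affine.slope_of_X_ne hx, Affine.addX]
    simp
  rw [Affine.Point.add_of_X_ne hx, ← e]
  exact ⟨_, _, rfl⟩

lemma HasCoords.sub {P Q : W.toAffine.Point} {x₁ y₁ x₂ y₂ : F} (h₁ : HasCoords P x₁ y₁)
    (h₂ : HasCoords Q x₂ y₂) (hx : x₁ ≠ x₂) :
    ∃ y, HasCoords (P - Q) (((y₁ + y₂) / (x₁ - x₂)) ^ 2 - x₁ - x₂) y := by
  have := h₁.add h₂.neg hx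
  rwa [sub_neg_eq_add, ← sub_eq_add_neg] at this

lemma HasCoords.two_smul {P : W.toAffine.Point} {x y : F} (h : HasCoords P x y) (hy : 2 * y ≠ 0) :
    HasCoords (2 • P) (((3 * x ^ 2 + W.a₄) / (2 * y)) ^ 2 - 2 * x)
      (-((3 * x ^ 2 + W.a₄) / (2 * y) * (((3 * x ^ 2 + W.a₄) / (2 * y)) ^ 2 - 3 * x) + y)) := by
  obtain ⟨h, rfl⟩ := h
  have hn : W.toAffine.negY x y = -y := by simp [Affine.negY]
  have hy' : y ≠ W.toAffine.negY x y := by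
    rw [hn]
    intro e
    exact hy (by linear_combination e)
  have es : W.toAffine.slope x x y y = (3 * x ^ 2 + W.a₄) / (2 * y) := by
    rw [Affine.slope_of_Y_ne rfl hy', hn]
    simp [two_mul]
  have e : W.toAffine.addX x x (W.toAffine.slope x x y y) =
      ((3 * x ^ 2 + W.a₄) / (2 * y)) ^ 2 - 2 * x := by
    rw [es, Affine.addX, a₁_of_isShortNF, a₂_of_isShortNF]
    ring
  have e' : W.toAffine.addY x x y (W.toAffine.slope x x y y) =
      -((3 * x ^ 2 + W.a₄) / (2 * y) * (((3 * x ^ 2 + W.a₄) / (2 * y)) ^ 2 - 3 * x) + y) := by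
    rw [Affine.addY, Affine.negAddY, e, es, Affine.negY, a₁_of_isShortNF, a₃_of_isShortNF]
    ring
  rw [two_nsmul, Affine.Point.add_self_of_Y_ne hy', ← e, ← e']
  exact ⟨_, rfl⟩

lemma HasCoords.two_smul_eq_zero {P : W.toAffine.Point} {x : F} (h : HasCoords P x 0) :
    2 • P = 0 := by
  obtain ⟨h, rfl⟩ := h
  rw [two_nsmul]
  exact Affine.Point.add_self_of_Y_eq (by simp [Affine.negY])

end Coordinates

section Sequence

variable {F : Type*} [Field F] [DecidableEq F] (W : WeierstrassCurve F) [W.IsShortNF]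

/-- The values of the division polynomials of a curve in short normal form at `(x, y)`. -/
def divSeq {F : Type*} [CommRing F] (W : WeierstrassCurve F) (x y : F) (n : ℤ) : F :=
  normEDS (2 * y) (W.Ψ₃.eval x) (W.preΨ₄.eval x) n

lemma eval_Ψ₃ {F : Type*} [CommRing F] (W : WeierstrassCurve F) [W.IsShortNF] (x : F) : W.Ψ₃.eval x =
    3 * x ^ 4 + 6 * W.a₄ * x ^ 2 + 12 * W.a₆ * x - W.a₄ ^ 2 := by
  simp [Ψ₃, b₂, b₄, b₆, b₈]
  ring

lemma eval_preΨ₄ {F : Type*} [CommRing F] (W : WeierstrassCurve F) [W.IsShortNF] (x : F) : W.preΨ₄.eval x =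
    2 * x ^ 6 + 10 * W.a₄ * x ^ 4 + 40 * W.a₆ * x ^ 3 - 10 * W.a₄ ^ 2 * x ^ 2
      - 8 * W.a₄ * W.a₆ * x - 2 * W.a₄ ^ 3 - 16 * W.a₆ ^ 2 := by
  simp [preΨ₄, b₂, b₄, b₆, b₈]
  ring

/-- The `x`-coordinate `t` of `n • P` agrees with the one predicted by the division polynomials. -/
def XFormula (P : W.toAffine.Point) (x y : F) (n : ℕ) : Prop :=
  ∃ s t, HasCoords (n • P) s t ∧
    (x - s) * divSeq W x y n ^ 2 = divSeq W x y (n + 1) * divSeq W x y (n - 1)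

variable {W} {P : W.toAffine.Point} {x y : F}

omit [DecidableEq F] in
lemma yFormula_aux {a b c d e x xm u v y ym w : F}
    (hu : (x - u) * d ^ 2 = e * c) (hv : (x - v) * b ^ 2 = c * a)
    (hm : (x - xm) * c ^ 2 = d * b) (hy : 2 * y ≠ 0)
    (hw : w * (2 * y) = b ^ 2 * c * e - a * c * d ^ 2)
    (huv : (v - u) * (xm - x) ^ 2 = 4 * ym * y) : 2 * ym * c ^ 4 = w := by
  have key : (2 * y) * (2 * ym * c ^ 4) = (2 * y) * w := by
    linear_combination (-c ^ 4) * huv + ((v - u) * ((x - xm) * c ^ 2 + d * b)) * hm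
      + (b ^ 2) * hu + (-d ^ 2) * hv - hw
  exact mul_left_cancel₀ hy key

lemma yFormula (hP : HasCoords P x y) (h2y : 2 * y ≠ 0) {m : ℕ} (hm : 1 ≤ m)
    (hw₀ : divSeq W x y m ≠ 0) (hw₁ : divSeq W x y (m + 1) ≠ 0) (hw₂ : divSeq W x y (m - 1) ≠ 0)
    (h₀ : XFormula W P x y m) (h₁ : XFormula W P x y (m + 1)) (h₂ : XFormula W P x y (m - 1))
    {s t : F} (hst : HasCoords (m • P) s t) :
    2 * t * divSeq W x y m ^ 4 = divSeq W x y (2 * m) := by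
  obtain ⟨s₀, t₀, c₀, e₀⟩ := h₀
  obtain ⟨s₁, t₁, c₁, e₁⟩ := h₁
  obtain ⟨s₂, t₂, c₂, e₂⟩ := h₂
  obtain ⟨rfl, rfl⟩ := hst.unique c₀
  have hne : s ≠ x := by
    rintro rfl
    rw [sub_self, zero_mul] at e₀
    exact mul_ne_zero hw₁ hw₂ e₀.symm
  obtain ⟨r₁, k₁⟩ := c₀.add hP hne
  obtain ⟨r₂, k₂⟩ := c₀.sub hP hne
  have q₁ : (m + 1) • P = m • P + P := by rw [add_smul, one_smul]
  have q₂ : (m - 1) • P = m • P - P := by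
    rw [eq_sub_iff_add_eq, ← succ_nsmul, Nat.sub_add_cancel hm]
  rw [q₁] at c₁
  rw [q₂] at c₂
  obtain ⟨u₁, -⟩ := c₁.unique k₁
  obtain ⟨u₂, -⟩ := c₂.unique k₂
  push_cast [Nat.cast_sub hm] at e₁ e₂
  rw [add_sub_cancel_right, show (m : ℤ) + 1 + 1 = m + 2 by ring] at e₁
  rw [sub_add_cancel, show (m : ℤ) - 1 - 1 = m - 2 by ring] at e₂
  refine yFormula_aux (u := s₁) (v := s₂) (x := x) e₁ e₂ e₀ h2y
    (normEDS_even _ _ _ _) ?_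
  rw [u₁, u₂]
  field_simp [sub_ne_zero.mpr hne]
  ring

lemma yFormula_two (hP : HasCoords P x y) (h2y : 2 * y ≠ 0)
    {s t : F} (hst : HasCoords (2 • P) s t) :
    2 * t * divSeq W x y 2 ^ 4 = divSeq W x y 4 ∧
    (x - s) * divSeq W x y 2 ^ 2 = divSeq W x y 3  := by
  obtain ⟨rfl, rfl⟩ := hst.unique (hP.two_smul h2y)
  have := hP.equation
  have h6 : W.a₆ = y ^ 2 - x ^ 3 - W.a₄ * x := by linear_combination - this
  simp only [divSeq, normEDS_two, normEDS_four, normEDS_three, eval_Ψ₃, eval_preΨ₄]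
  have h2 : (2 : F) ≠ 0 := left_ne_zero_of_mul h2y
  have hy : y ≠ 0 := right_ne_zero_of_mul h2y
  constructor
  · field_simp
    rw [h6]
    ring
  · field_simp
    rw [h6]
    ring

omit [DecidableEq F] in
lemma xFormula_even_aux {a b c d e x xm u v y ym w w₁ w₂ A B s : F}
    (hw₁ : w₁ = e * c ^ 3 - b * d ^ 3) (hw₂ : w₂ = d * b ^ 3 - a * c ^ 3)
    (hu : (x - u) * d ^ 2 = e * c) (hv : (x - v) * b ^ 2 = c * a)
    (hm : (x - xm) * c ^ 2 = d * b) (hw : 2 * ym * c ^ 4 = w)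
    (hs : s = ((3 * xm ^ 2 + A) / (2 * ym)) ^ 2 - 2 * xm) (hym : 2 * ym ≠ 0) (hx : xm - x ≠ 0)
    (hu' : u = ((ym - y) / (xm - x)) ^ 2 - xm - x)
    (hv' : v = ((ym + y) / (xm - x)) ^ 2 - xm - x)
    (h1 : y ^ 2 = x ^ 3 + A * x + B) (h2 : ym ^ 2 = xm ^ 3 + A * xm + B) :
    (x - s) * w ^ 2 = w₁ * w₂ := by
  have k1 : w₁ * w₂ = - (x - xm) ^ 2 * (xm - u) * (xm - v) * c ^ 8 := by
    have e1 : w₁ = d ^ 2 * c ^ 2 * (xm - u) := by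
      rw [hw₁]; linear_combination (- c ^ 2) * hu + d ^ 2 * hm
    have e2 : w₂ = - b ^ 2 * c ^ 2 * (xm - v) := by
      rw [hw₂]; linear_combination (c ^ 2) * hv - b ^ 2 * hm
    rw [e1, e2]
    linear_combination (- c ^ 4 * (xm - u) * (xm - v) * (d * b + (x - xm) * c ^ 2)) * (- hm)
  have k2 : (x - s) * w ^ 2 = ((3 * xm ^ 4 + 6 * A * xm ^ 2 + 12 * B * xm - A ^ 2)
      + 4 * ym ^ 2 * (x - xm)) * c ^ 8 := by
    rw [← hw, hs]
    have hym' : ym ≠ 0 := by rintro rfl; simp at hym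
    have h2' : (2 : F) ≠ 0 := by intro h; simp [h] at hym
    field_simp
    have hB : B = ym ^ 2 - xm ^ 3 - A * xm := by linear_combination - h2
    rw [hB]
    ring
  rw [k1, k2]
  congr 1
  rw [hu', hv']
  have hx' : x - xm ≠ 0 := fun h => hx (by linear_combination - h)
  have hA : A = (y ^ 2 - ym ^ 2) / (x - xm) - (x ^ 2 + x * xm + xm ^ 2) := by
    field_simp
    linear_combination h2 - h1
  have hB : B = ym ^ 2 - xm ^ 3 - A * xm := by linear_combination - h2
  rw [hB, hA, show xm - x = - (x - xm) by ring]
  field_simp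
  ring

end Sequence

section Generic

variable {F : Type*} [Field F] [DecidableEq F] {W : WeierstrassCurve F} [W.IsShortNF]
  {P : W.toAffine.Point} {x y : F}

lemma xFormula_even (hP : HasCoords P x y) {m : ℕ} (hm : 2 ≤ m)
    (hw : ∀ n : ℕ, 1 ≤ n → divSeq W x y n ≠ 0)
    (h : ∀ n : ℕ, 1 ≤ n → n < 2 * m → XFormula W P x y n)
    (hY : ∀ s t, HasCoords (m • P) s t → 2 * t * divSeq W x y m ^ 4 = divSeq W x y (2 * m)) :
    XFormula W P x y (2 * m) := by
  obtain ⟨s₀, t₀, c₀, e₀⟩ := h m (by omega) (by omega)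
  obtain ⟨s₁, t₁, c₁, e₁⟩ := h (m + 1) (by omega) (by omega)
  obtain ⟨s₂, t₂, c₂, e₂⟩ := h (m - 1) (by omega) (by omega)
  have hw₀ := hw m (by omega)
  have hw₁ := hw (m + 1) (by omega)
  have hw₂ := hw (m - 1) (by omega)
  have hww := hw (2 * m) (by omega)
  have hY := hY _ _ c₀
  push_cast [Nat.cast_sub (show 1 ≤ m by omega)] at e₁ e₂ hw₁ hw₂ hww
  have hne : s₀ ≠ x := by
    rintro rfl
    rw [sub_self, zero_mul] at e₀
    exact mul_ne_zero hw₁ hw₂ e₀.symm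
  have ht : 2 * t₀ ≠ 0 := by
    intro h
    rw [h, zero_mul] at hY
    exact hww hY.symm
  obtain ⟨r₁, k₁⟩ := c₀.add hP hne
  obtain ⟨r₂, k₂⟩ := c₀.sub hP hne
  have q₁ : (m + 1) • P = m • P + P := by rw [add_smul, one_smul]
  have q₂ : (m - 1) • P = m • P - P := by
    rw [eq_sub_iff_add_eq, ← succ_nsmul, Nat.sub_add_cancel (by omega)]
  rw [q₁] at c₁
  rw [q₂] at c₂
  obtain ⟨u₁, -⟩ := c₁.unique k₁
  obtain ⟨u₂, -⟩ := c₂.unique k₂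
  rw [add_sub_cancel_right, show (m : ℤ) + 1 + 1 = m + 2 by ring] at e₁
  rw [sub_add_cancel, show (m : ℤ) - 1 - 1 = m - 2 by ring] at e₂
  refine ⟨_, _, by rw [mul_smul]; exact c₀.two_smul ht, ?_⟩
  push_cast
  refine xFormula_even_aux (y := y) (A := W.a₄) (B := W.a₆) (normEDS_odd _ _ _ m) ?_
    e₁ e₂ e₀ hY rfl ht (sub_ne_zero.mpr hne) u₁ u₂
    hP.equation c₀.equation
  have := normEDS_odd (2 * y) (W.Ψ₃.eval x) (W.preΨ₄.eval x) (m - 1)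
  rw [show 2 * ((m : ℤ) - 1) + 1 = 2 * m - 1 by ring, show (m : ℤ) - 1 + 2 = m + 1 by ring,
    show (m : ℤ) - 1 - 1 = m - 2 by ring, sub_add_cancel] at this
  exact this

lemma xFormula_odd_aux {b c d e x s s₁ t t₁ r w w₁ w₂ : F}
    (hw : w = e * c ^ 3 - b * d ^ 3) (h₀ : (x - s) * c ^ 2 = d * b) (h₁ : (x - s₁) * d ^ 2 = e * c)
    (ht : 2 * t * c ^ 4 = w₂) (ht₁ : 2 * t₁ * d ^ 4 = w₁)
    (hr : (x - r) * (s₁ - s) ^ 2 = 4 * t₁ * t) :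
    (s₁ - s) * c ^ 2 * d ^ 2 = - w ∧ (x - r) * w ^ 2 = w₁ * w₂ := by
  have h : (s₁ - s) * c ^ 2 * d ^ 2 = - w := by
    rw [hw]
    linear_combination d ^ 2 * h₀ - c ^ 2 * h₁
  refine ⟨h, ?_⟩
  rw [← ht, ← ht₁, show w ^ 2 = ((s₁ - s) * c ^ 2 * d ^ 2) ^ 2 by rw [h]; ring]
  linear_combination c ^ 4 * d ^ 4 * hr

/-- If none of the values of the division polynomials vanishes, then they compute the multiples. -/
theorem xFormula_of_ne_zero (hP : HasCoords P x y)
    (hw : ∀ n : ℕ, 1 ≤ n → divSeq W x y n ≠ 0) (n : ℕ) (hn : 1 ≤ n) : XFormula W P x y n := by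
  induction n using Nat.strong_induction_on with
  | _ n ih =>
  have h2y : 2 * y ≠ 0 := by simpa [divSeq] using hw 2 (by omega)
  have h1 : XFormula W P x y 1 := ⟨x, y, by rwa [one_smul], by simp [divSeq]⟩
  have h2 : XFormula W P x y 2 := by
    have := hP.two_smul h2y
    exact ⟨_, _, this, by
      simpa [divSeq] using (yFormula_two hP h2y this).2⟩
  have hY : ∀ m : ℕ, 1 ≤ m → (m + 1 < n ∨ m ≤ 2) → ∀ s t, HasCoords (m • P) s t →
      2 * t * divSeq W x y m ^ 4 = divSeq W x y (2 * m) := by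
    intro m hm hmn s t hst
    rcases (show m = 1 ∨ m = 2 ∨ 3 ≤ m by omega) with rfl | rfl | hm3
    · rw [one_smul] at hst
      obtain ⟨rfl, rfl⟩ := hst.unique hP
      simp [divSeq]
    · exact (yFormula_two hP h2y hst).1
    · have k₁ := hw (m + 1) (by omega)
      have k₂ := hw (m - 1) (by omega)
      push_cast [Nat.cast_sub hm] at k₁ k₂
      exact yFormula hP h2y hm (hw m hm) k₁ k₂ (ih m (by omega) hm) (ih (m + 1) (by omega) (by omega))
        (ih (m - 1) (by omega) (by omega)) hst
  rcases (show n = 1 ∨ n = 2 ∨ 3 ≤ n by omega) with rfl | rfl | hn3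
  · exact h1
  · exact h2
  obtain ⟨m, rfl | rfl⟩ := n.even_or_odd'
  · exact xFormula_even hP (by omega) hw (fun k hk hk' => ih k hk' hk)
      (hY m (by omega) (by omega))
  · obtain ⟨s₀, t₀, c₀, e₀⟩ := ih m (by omega) (by omega)
    obtain ⟨s₁, t₁, c₁, e₁⟩ : XFormula W P x y (m + 1) := by
      rcases (show m = 1 ∨ 2 ≤ m by omega) with rfl | hm
      · exact h2
      · exact ih _ (by omega) (by omega)
    have hw₀ := hw m (by omega)
    have hw₁ := hw (m + 1) (by omega)
    have hww := hw (2 * m + 1) (by omega)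
    have y₀ := hY m (by omega) (by omega) _ _ c₀
    have y₁ := hY (m + 1) (by omega) (by omega) _ _ c₁
    push_cast at e₀ e₁ hw₀ hw₁ hww y₀ y₁
    rw [add_sub_cancel_right, show (m : ℤ) + 1 + 1 = m + 2 by ring] at e₁
    rw [show 2 * ((m : ℤ) + 1) = 2 * m + 2 by ring] at y₁
    have hne : s₁ ≠ s₀ := by
      rintro rfl
      have : divSeq W x y (2 * m + 1) = 0 := by
        rw [divSeq, normEDS_odd]
        simp only [divSeq] at e₀ e₁ ⊢
        linear_combination - (normEDS (2 * y) (W.Ψ₃.eval x) (W.preΨ₄.eval x) m) ^ 2 * e₁ +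
         (normEDS (2 * y) (W.Ψ₃.eval x) (W.preΨ₄.eval x) (m + 1)) ^ 2 * e₀
      exact hww this
    obtain ⟨r₁, k₁⟩ := c₁.add c₀ hne
    obtain ⟨r₂, k₂⟩ := c₁.sub c₀ hne
    rw [← add_smul, show m + 1 + m = 2 * m + 1 by ring] at k₁
    rw [add_smul, add_sub_cancel_left, one_smul] at k₂
    obtain ⟨u, -⟩ := hP.unique k₂
    refine ⟨_, _, k₁, ?_⟩
    push_cast
    rw [show (2 * m + 1 + 1 : ℤ) = 2 * m + 2 by ring, add_sub_cancel_right]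
    refine (xFormula_odd_aux (normEDS_odd _ _ _ m) e₀ e₁ y₀ y₁ ?_).2
    have : s₁ - s₀ ≠ 0 := sub_ne_zero.mpr hne
    rw [show x - (((t₁ - t₀) / (s₁ - s₀)) ^ 2 - s₁ - s₀) =
      (((t₁ + t₀) / (s₁ - s₀)) ^ 2 - s₁ - s₀) - (((t₁ - t₀) / (s₁ - s₀)) ^ 2 - s₁ - s₀) by
        rw [← u]]
    field_simp
    ring

lemma somos_aux {a b c d e x xm u v y ym A B : F} (hc : c ≠ 0) (hb : b ≠ 0)
    (hu : (x - u) * d ^ 2 = e * c) (hv : (x - v) * b ^ 2 = c * a)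
    (hm : (x - xm) * c ^ 2 = d * b) (hx : xm - x ≠ 0)
    (hu' : u = ((ym - y) / (xm - x)) ^ 2 - xm - x)
    (hv' : v = ((ym + y) / (xm - x)) ^ 2 - xm - x)
    (h1 : y ^ 2 = x ^ 3 + A * x + B) (h2 : ym ^ 2 = xm ^ 3 + A * xm + B) :
    e * a = (2 * y) ^ 2 * d * b - (3 * x ^ 4 + 6 * A * x ^ 2 + 12 * B * x - A ^ 2) * c ^ 2 ∧
    e * b ^ 2 + a * d ^ 2 = - (2 * y) ^ 2 * c ^ 3 + 2 * (3 * x ^ 2 + A) * b * c * d := by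
  have hx' : x - xm ≠ 0 := fun h => hx (by linear_combination - h)
  have hA : A = (y ^ 2 - ym ^ 2) / (x - xm) - (x ^ 2 + x * xm + xm ^ 2) := by
    field_simp
    linear_combination h2 - h1
  have hB : B = ym ^ 2 - xm ^ 3 - A * xm := by linear_combination - h2
  have hd' : d = (x - xm) * c ^ 2 / b := by field_simp; linear_combination - hm
  have he : e = (x - u) * d ^ 2 / c := by field_simp; linear_combination - hu
  have ha : a = (x - v) * b ^ 2 / c := by field_simp; linear_combination - hv
  rw [he, ha, hd', hB, hA, hu', hv', show xm - x = - (x - xm) by ring]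
  constructor
  · field_simp
    ring
  · field_simp
    ring

/-- The values of the division polynomials satisfy two recurrences of length five, provided
that they do not vanish. -/
theorem somos_of_ne_zero (hP : HasCoords P x y)
    (hw : ∀ n : ℕ, 1 ≤ n → divSeq W x y n ≠ 0) (n : ℕ) (hn : 1 ≤ n) :
    divSeq W x y (n + 2) * divSeq W x y (n - 2) =
      (2 * y) ^ 2 * divSeq W x y (n + 1) * divSeq W x y (n - 1) -
        W.Ψ₃.eval x * divSeq W x y n ^ 2 ∧
    divSeq W x y (n + 2) * divSeq W x y (n - 1) ^ 2 +
      divSeq W x y (n - 2) * divSeq W x y (n + 1) ^ 2 =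
      - (2 * y) ^ 2 * divSeq W x y n ^ 3 + 2 * (3 * x ^ 2 + W.a₄) * divSeq W x y (n - 1) *
        divSeq W x y n * divSeq W x y (n + 1) := by
  rcases hn.eq_or_lt with rfl | hn
  · simp [divSeq]
  have h := xFormula_of_ne_zero hP hw
  obtain ⟨s₀, t₀, c₀, e₀⟩ := h n (by omega)
  obtain ⟨s₁, t₁, c₁, e₁⟩ := h (n + 1) (by omega)
  obtain ⟨s₂, t₂, c₂, e₂⟩ := h (n - 1) (by omega)
  have hw₀ := hw n (by omega)
  have hw₁ := hw (n + 1) (by omega)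
  have hw₂ := hw (n - 1) (by omega)
  push_cast [Nat.cast_sub (show 1 ≤ n by omega)] at e₁ e₂ hw₁ hw₂
  have hne : s₀ ≠ x := by
    rintro rfl
    rw [sub_self, zero_mul] at e₀
    exact mul_ne_zero hw₁ hw₂ e₀.symm
  obtain ⟨r₁, k₁⟩ := c₀.add hP hne
  obtain ⟨r₂, k₂⟩ := c₀.sub hP hne
  have q₁ : (n + 1) • P = n • P + P := by rw [add_smul, one_smul]
  have q₂ : (n - 1) • P = n • P - P := by
    rw [eq_sub_iff_add_eq, ← succ_nsmul, Nat.sub_add_cancel (by omega)]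
  rw [q₁] at c₁
  rw [q₂] at c₂
  obtain ⟨u₁, -⟩ := c₁.unique k₁
  obtain ⟨u₂, -⟩ := c₂.unique k₂
  rw [add_sub_cancel_right, show (n : ℤ) + 1 + 1 = n + 2 by ring] at e₁
  rw [sub_add_cancel, show (n : ℤ) - 1 - 1 = n - 2 by ring] at e₂
  rw [eval_Ψ₃]
  exact somos_aux hw₀ hw₂ e₁ e₂ e₀ (sub_ne_zero.mpr hne) u₁ u₂ hP.equation c₀.equation

end Generic

section Specialize

lemma map_divSeq {R S : Type*} [CommRing R] [CommRing S] (f : R →+* S) (W : WeierstrassCurve R)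
    (x y : R) (n : ℤ) : divSeq (W.map f) (f x) (f y) n = f (divSeq W x y n) := by
  simp only [divSeq, map_normEDS, map_Ψ₃, map_preΨ₄, eval_map, eval₂_at_apply, map_mul, map_ofNat]

variable {K : Type*} [Field K] [CharZero K] (W : WeierstrassCurve K) [W.IsShortNF] [W.IsElliptic]

instance {R S : Type*} [CommRing R] [CommRing S] (f : R →+* S) (W : WeierstrassCurve R)
    [W.IsShortNF] : (W.map f).IsShortNF where
  a₁ := by simp
  a₂ := by simp
  a₃ := by simp

lemma eval_map_coordinateRing (f : K[X]) :
    (f.map (algebraMap K W.toAffine.CoordinateRing)).eval (Affine.CoordinateRing.mk W (C X)) =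
      Affine.CoordinateRing.mk W (C f) := by
  have := aeval_algebraMap_apply W.toAffine.CoordinateRing (X : K[X]) f
  rw [aeval_X_left_apply] at this
  rw [eval_map]
  exact this

lemma divSeq_coordinateRing (n : ℤ) :
    divSeq (W.map (algebraMap K W.toAffine.CoordinateRing))
      (Affine.CoordinateRing.mk W (C X)) (Affine.CoordinateRing.mk W X) n =
    Affine.CoordinateRing.mk W (W.ψ n) := by
  rw [WeierstrassCurve.ψ, map_normEDS, divSeq, map_Ψ₃, map_preΨ₄, eval_map_coordinateRing,
    eval_map_coordinateRing]
  congr 1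
  rw [ψ₂, Affine.polynomialY]
  simp only [a₁_of_isShortNF, a₃_of_isShortNF, C_0, zero_mul, add_zero, map_mul]
  rfl

lemma divSeq_coordinateRing_ne_zero (n : ℤ) (hn : n ≠ 0) :
    divSeq (W.map (algebraMap K W.toAffine.CoordinateRing))
      (Affine.CoordinateRing.mk W (C X)) (Affine.CoordinateRing.mk W X) n ≠ 0 := by
  rw [divSeq_coordinateRing]
  intro h
  have h₁ := Affine.CoordinateRing.mk_Ψ_sq W n
  rw [← Affine.CoordinateRing.mk_ψ, h, zero_pow two_ne_zero] at h₁
  have h₂ : algebraMap K[X] W.toAffine.CoordinateRing (W.ΨSq n) = 0 := h₁.symm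
  rw [FaithfulSMul.algebraMap_eq_zero_iff] at h₂
  exact W.ΨSq_ne_zero (Int.cast_ne_zero.mpr hn) h₂

open scoped Classical in
lemma somos_coordinateRing (n : ℕ) (hn : 1 ≤ n) :
    letI R := W.toAffine.CoordinateRing
    letI x : R := Affine.CoordinateRing.mk W (C X)
    letI y : R := Affine.CoordinateRing.mk W X
    letI V : WeierstrassCurve R := W.map (algebraMap K R)
    divSeq V x y (n + 2) * divSeq V x y (n - 2) =
      (2 * y) ^ 2 * divSeq V x y (n + 1) * divSeq V x y (n - 1) -
        V.Ψ₃.eval x * divSeq V x y n ^ 2 ∧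
    divSeq V x y (n + 2) * divSeq V x y (n - 1) ^ 2 +
      divSeq V x y (n - 2) * divSeq V x y (n + 1) ^ 2 =
      - (2 * y) ^ 2 * divSeq V x y n ^ 3 + 2 * (3 * x ^ 2 + V.a₄) * divSeq V x y (n - 1) *
        divSeq V x y n * divSeq V x y (n + 1) := by
  set R := W.toAffine.CoordinateRing
  set x : R := Affine.CoordinateRing.mk W (C X)
  set y : R := Affine.CoordinateRing.mk W X
  set V : WeierstrassCurve R := W.map (algebraMap K R)
  let g : R →+* W.toAffine.FunctionField := algebraMap R W.toAffine.FunctionField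
  have hg : Function.Injective g := IsFractionRing.injective R W.toAffine.FunctionField
  have heq : (V.map g).toAffine.Equation (g x) (g y) := by
    refine Affine.Equation.map g ?_
    have e : W.toAffine.polynomial = X ^ 2 - C (X ^ 3 + C W.a₄ * X + C W.a₆) := by
      rw [Affine.polynomial]
      simp
    have h : Affine.CoordinateRing.mk W (X ^ 2 - C (X ^ 3 + C W.a₄ * X + C W.a₆)) = 0 := by
      rw [← e]
      exact AdjoinRoot.mk_self
    rw [Affine.equation_iff']
    simp only [a₁_of_isShortNF, a₂_of_isShortNF, a₃_of_isShortNF, zero_mul, add_zero,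
      map_sub, map_add, map_mul, map_pow] at h ⊢
    exact h
  have hP : HasCoords (Affine.Point.some _ _
    ((Affine.equation_iff_nonsingular (W := (V.map g).toAffine)).mp heq)) (g x) (g y) := ⟨_, rfl⟩
  have hne : ∀ n : ℕ, 1 ≤ n → divSeq (V.map g) (g x) (g y) n ≠ 0 := by
    intro n hn
    rw [map_divSeq]
    exact (map_ne_zero_iff g hg).mpr (divSeq_coordinateRing_ne_zero W n (by omega))
  obtain ⟨h₁, h₂⟩ := somos_of_ne_zero hP hne n hn
  constructor
  · apply hg
    rw [map_Ψ₃, eval_map, eval₂_at_apply] at h₁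
    simpa only [map_mul, map_sub, map_add, map_pow, map_ofNat, map_divSeq] using h₁
  · apply hg
    simpa only [map_mul, map_sub, map_add, map_pow, map_ofNat, map_divSeq, map_neg,
      map_a₄] using h₂

/-- The values of the division polynomials satisfy two recurrences of length five. -/
theorem somos {x y : K} (h : W.toAffine.Equation x y) (n : ℕ) (hn : 1 ≤ n) :
    divSeq W x y (n + 2) * divSeq W x y (n - 2) =
      (2 * y) ^ 2 * divSeq W x y (n + 1) * divSeq W x y (n - 1) -
        W.Ψ₃.eval x * divSeq W x y n ^ 2 ∧
    divSeq W x y (n + 2) * divSeq W x y (n - 1) ^ 2 +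
      divSeq W x y (n - 2) * divSeq W x y (n + 1) ^ 2 =
      - (2 * y) ^ 2 * divSeq W x y n ^ 3 + 2 * (3 * x ^ 2 + W.a₄) * divSeq W x y (n - 1) *
        divSeq W x y n * divSeq W x y (n + 1) := by
  let φ : W.toAffine.CoordinateRing →+* K := AdjoinRoot.lift (evalRingHom x) y (by
    rw [eval₂_evalRingHom]; exact h)
  have hx : φ (Affine.CoordinateRing.mk W (C X)) = x := by
    simp [φ, Affine.CoordinateRing.mk]
  have hy : φ (Affine.CoordinateRing.mk W X) = y := by
    simp [φ, Affine.CoordinateRing.mk]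
  have hV : (W.map (algebraMap K W.toAffine.CoordinateRing)).map φ = W := by
    rw [WeierstrassCurve.map_map]
    convert W.map_id
    ext a
    change φ (Affine.CoordinateRing.mk W (C (C a))) = a
    simp [φ, Affine.CoordinateRing.mk]
  obtain ⟨h₁, h₂⟩ := somos_coordinateRing W n hn
  have h₁ := congrArg φ h₁
  have h₂ := congrArg φ h₂
  simp only [map_mul, map_sub, map_add, map_pow, ← map_divSeq, hx, hy, hV, map_ofNat, map_neg,
    ← eval₂_at_apply, ← eval_map, ← map_Ψ₃, ← map_a₄] at h₁ h₂
  exact ⟨h₁, h₂⟩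

end Specialize

section Multiples

variable {K : Type*} [Field K] [CharZero K] [DecidableEq K] {W : WeierstrassCurve K} [W.IsShortNF]
  [W.IsElliptic] {P : W.toAffine.Point} {x y : K}

lemma add_sub_sum_aux {s u v A B y t : K} (hx : s ≠ x)
    (hu : u = ((t - y) / (s - x)) ^ 2 - s - x) (hv : v = ((t + y) / (s - x)) ^ 2 - s - x)
    (h1 : y ^ 2 = x ^ 3 + A * x + B) (h2 : t ^ 2 = s ^ 3 + A * s + B) :
    (x - s) ^ 2 * ((x - u) + (x - v)) = - (2 * y) ^ 2 + 2 * (x - s) * (3 * x ^ 2 + A) := by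
  have : s - x ≠ 0 := sub_ne_zero.mpr hx
  rw [hu, hv]
  field_simp
  linear_combination (2 * (x - s) ^ 2) * h1 - (2 * (x - s) ^ 2) * h2

lemma xFormula_succ_aux {a b c d e s u v A y : K} (hb : b ≠ 0) (he : (x - s) * c ^ 2 = d * b)
    (hv : (x - v) * b ^ 2 = c * a)
    (hr : e * b ^ 2 + a * d ^ 2 = - (2 * y) ^ 2 * c ^ 3 + 2 * (3 * x ^ 2 + A) * b * c * d)
    (h : (x - s) ^ 2 * ((x - u) + (x - v)) = - (2 * y) ^ 2 + 2 * (x - s) * (3 * x ^ 2 + A)) :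
    (x - u) * d ^ 2 = e * c := by
  apply mul_left_cancel₀ (pow_ne_zero 2 hb)
  linear_combination (-c) * hr - d ^ 2 * hv + c ^ 4 * h -
    (((x - u) + (x - v)) * ((x - s) * c ^ 2 + d * b) - 2 * c ^ 2 * (3 * x ^ 2 + A)) * he

/-- The values of the division polynomials at a point which is not `2`-torsion compute its
multiples. -/
theorem smul_of_divSeq (hP : HasCoords P x y) (hy : 2 * y ≠ 0) (n : ℕ) :
    (divSeq W x y n ≠ 0 → XFormula W P x y n) ∧ (divSeq W x y n = 0 → n • P = 0) := by
  have hE : W.toAffine.Equation x y := hP.choose.1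
  have hPP : P ≠ 0 := hP.ne_zero
  suffices h : ∀ n : ℕ, ((divSeq W x y n ≠ 0 → XFormula W P x y n) ∧
      (divSeq W x y n = 0 → n • P = 0)) ∧
      ((divSeq W x y (n + 1) ≠ 0 → XFormula W P x y (n + 1)) ∧
      (divSeq W x y (n + 1) = 0 → (n + 1) • P = 0)) from (h n).1
  intro n
  induction n with
  | zero =>
    refine ⟨⟨fun h => ?_, fun _ => zero_smul _ _⟩, ⟨fun _ => ⟨x, y, by simpa using hP, ?_⟩, ?_⟩⟩
    · simp [divSeq] at h
    · simp [divSeq]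
    · simp [divSeq]
  | succ n ih =>
    obtain ⟨⟨p₁, p₂⟩, ⟨q₁, q₂⟩⟩ := ih
    refine ⟨by push_cast; exact ⟨q₁, q₂⟩, ?_⟩
    push_cast
    rw [show (n : ℤ) + 1 + 1 = n + 2 by ring]
    obtain ⟨r₁, r₂⟩ := somos W hE (n + 1) (by omega)
    push_cast at r₁ r₂
    rw [show (n : ℤ) + 1 + 2 = n + 3 by ring, show (n : ℤ) + 1 - 2 = n - 1 by ring,
      show (n : ℤ) + 1 + 1 = n + 2 by ring, show (n : ℤ) + 1 - 1 = n by ring] at r₁ r₂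
    have key : (n + 1 + 1) • P = (n + 1) • P + P := by rw [add_smul _ 1, one_smul]
    have key' : n • P = (n + 1) • P - P := by rw [add_smul, one_smul, add_sub_cancel_right]
    by_cases hw : divSeq W x y (n + 1) = 0
    · have h1 : (n + 1) • P = 0 := q₂ hw
      have h2 : divSeq W x y n ≠ 0 := by
        intro h
        have := p₂ h
        rw [key', h1, zero_sub, neg_eq_zero] at this
        exact hPP this
      have h3 : n ≠ 0 := by
        rintro rfl
        simp [divSeq] at h2
      obtain ⟨-, r₃⟩ := somos W hE n (by omega)
      rw [hw] at r₃
      have h4 : divSeq W x y (n + 2) ≠ 0 := by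
        intro h
        rw [h] at r₃
        simp only [zero_mul, ne_eq, OfNat.ofNat_ne_zero, not_false_eq_true, zero_pow, mul_zero,
          add_zero] at r₃
        have := pow_ne_zero 3 h2
        have := mul_ne_zero (neg_ne_zero.mpr (pow_ne_zero 2 hy)) this
        exact this r₃.symm
      refine ⟨fun _ => ⟨x, y, ?_, ?_⟩, fun h => (h4 h).elim⟩
      · rw [key, h1, zero_add]; exact hP
      · push_cast
        rw [show (n : ℤ) + 1 + 1 - 1 = n + 1 by ring, hw]
        ring
    obtain ⟨s, t, c, e⟩ := q₁ hw
    push_cast at e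
    rw [add_sub_cancel_right, show (n : ℤ) + 1 + 1 = n + 2 by ring] at e
    by_cases hv : divSeq W x y n = 0
    · have h1 : (n + 1) • P = P := by
        rw [add_smul, p₂ hv, zero_add, one_smul]
      have k2 := hP.two_smul hy
      have k3 := (yFormula_two hP hy k2).2
      rw [hv] at r₁ r₂
      simp only [mul_zero, zero_mul, zero_sub, zero_pow two_ne_zero, zero_add, add_zero] at r₁ r₂
      have h4 : divSeq W x y (n + 2) ≠ 0 := by
        intro h
        rw [h] at r₂
        simp only [ne_eq, OfNat.ofNat_ne_zero, not_false_eq_true, zero_pow, mul_zero] at r₂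
        have := mul_ne_zero (neg_ne_zero.mpr (pow_ne_zero 2 hy)) (pow_ne_zero 3 hw)
        exact this r₂.symm
      refine ⟨fun _ => ⟨_, _, by rw [key, h1, ← two_nsmul]; exact k2, ?_⟩, fun h => (h4 h).elim⟩
      push_cast
      rw [show (n : ℤ) + 1 + 1 - 1 = n + 1 by ring, show (n : ℤ) + 1 + 1 + 1 = n + 3 by ring,
        show (n : ℤ) + 1 + 1 = n + 2 by ring]
      have k5 : divSeq W x y (n - 1) ≠ 0 := by
        intro h
        rw [h] at r₂
        have := mul_ne_zero (neg_ne_zero.mpr (pow_ne_zero 2 hy)) (pow_ne_zero 3 hw)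
        exact this (by rw [← r₂, zero_mul])
      apply mul_left_cancel₀ (mul_ne_zero (pow_ne_zero 2 hy) k5)
      rw [show divSeq W x y 2 = 2 * y by simp [divSeq],
        show divSeq W x y 3 = W.Ψ₃.eval x by simp [divSeq]] at k3
      generalize x - (((3 * x ^ 2 + W.a₄) / (2 * y)) ^ 2 - 2 * x) = d at k3 ⊢
      linear_combination (divSeq W x y (n - 1) * divSeq W x y (n + 2) ^ 2) * k3
        - ((2 * y) ^ 2 * divSeq W x y (n + 1)) * r₁ + eval x W.Ψ₃ * r₂
    · have hne : (divSeq W x y (n + 2) ≠ 0) → s ≠ x := by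
        rintro h rfl
        rw [sub_self, zero_mul] at e
        exact mul_ne_zero h hv e.symm
      constructor
      · intro h
        obtain ⟨s₂, t₂, c₂, e₂⟩ := p₁ hv
        obtain ⟨_, k₁⟩ := c.add hP (hne h)
        obtain ⟨_, k₂⟩ := c.sub hP (hne h)
        rw [← key] at k₁
        rw [← key'] at k₂
        obtain ⟨u₂, -⟩ := c₂.unique k₂
        refine ⟨_, _, k₁, ?_⟩
        push_cast
        rw [show (n : ℤ) + 1 + 1 - 1 = n + 1 by ring, show (n : ℤ) + 1 + 1 + 1 = n + 3 by ring,
          show (n : ℤ) + 1 + 1 = n + 2 by ring]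
        exact xFormula_succ_aux hv e e₂ r₂ (add_sub_sum_aux (hne h) rfl u₂ hP.equation c.equation)
      · intro h
        rw [h, zero_mul] at e
        have := (mul_eq_zero.mp e).resolve_right (pow_ne_zero 2 hw)
        obtain rfl : x = s := sub_eq_zero.mp this
        rcases c.eq_or_eq_neg hP with h' | h'
        · have h1 : n • P = 0 := by rw [key', h', sub_self]
          obtain ⟨s₂, t₂, c₂, e₂⟩ := p₁ hv
          exact (c₂.ne_zero h1).elim
        · rw [key, h', neg_add_cancel]

lemma divSeq_odd {K : Type*} [CommRing K] {W : WeierstrassCurve K} [W.IsShortNF] {x y : K}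
    {n : ℕ} (hn : Odd n) (h : W.toAffine.Equation x y) :
    divSeq W x y n = (W.preΨ' n).eval x := by
  have h1 : y ^ 2 = x ^ 3 + W.a₄ * x + W.a₆ := by
    have := (Affine.equation_iff x y).mp h
    simpa using this
  have h2 : (2 * y) ^ 4 = (W.Ψ₂Sq ^ 2).eval x := by
    simp only [Ψ₂Sq, b₂, b₄, b₆, eval_pow, eval_add, eval_mul, eval_C, eval_X, a₁_of_isShortNF,
      a₂_of_isShortNF, a₃_of_isShortNF]
    rw [show (2 * y) ^ 4 = 16 * (y ^ 2) ^ 2 by ring, h1]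
    ring
  rw [divSeq, normEDS, preNormEDS_ofNat, if_neg (by exact_mod_cast Nat.not_even_iff_odd.mpr hn),
    mul_one, h2, preΨ', ← coe_evalRingHom,
    map_preNormEDS']

omit [CharZero K] [DecidableEq K] [W.IsShortNF] in
/-- The division polynomials of odd index do not vanish at `2`-torsion points. -/
lemma preΨ'_odd_ne_zero (h₂ : W.Ψ₂Sq.eval x = 0) (h₃ : W.Ψ₃.eval x ≠ 0) {n : ℕ} (hn : Odd n) :
    (W.preΨ' n).eval x ≠ 0 := by
  induction n using Nat.strong_induction_on with
  | _ n ih =>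
  obtain ⟨k, rfl⟩ := hn
  rcases (show k = 0 ∨ k = 1 ∨ 2 ≤ k by omega) with rfl | rfl | hk
  · simp
  · simpa using h₃
  obtain ⟨m, rfl⟩ := Nat.exists_eq_add_of_le' hk
  rw [preΨ'_odd]
  by_cases hm : Even m
  · have hm' : Odd (m + 1) := hm.add_one
    have h1 := ih (m + 1) (by omega) hm'
    have h2 := ih (m + 3) (by omega) (by rw [show m + 3 = m + 1 + 2 by ring]; exact hm'.add_even even_two)
    simp [hm, h₂, h1, h2]
  · have hm' : Odd m := Nat.not_even_iff_odd.mp hm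
    have h1 := ih (m + 4) (by omega) (hm'.add_even (by decide))
    have h2 := ih (m + 2) (by omega) (hm'.add_even even_two)
    simp [hm, h₂, h1, h2]

variable (W) in
/-- The polynomial whose roots are the `x`-coordinates of the `p`-torsion points, `p` a prime. -/
def torsionPoly {R : Type*} [CommRing R] (W : WeierstrassCurve R) (p : ℕ) : R[X] :=
  if p = 2 then W.Ψ₂Sq else W.preΨ' p

lemma eval_Ψ₂Sq (h : W.toAffine.Equation x y) : W.Ψ₂Sq.eval x = (2 * y) ^ 2 := by
  have h1 : y ^ 2 = x ^ 3 + W.a₄ * x + W.a₆ := by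
    have := (Affine.equation_iff x y).mp h
    simpa using this
  simp only [Ψ₂Sq, b₂, b₄, b₆, eval_add, eval_mul, eval_C, eval_X, a₁_of_isShortNF,
      a₂_of_isShortNF, a₃_of_isShortNF, eval_pow]
  rw [show (2 * y) ^ 2 = 4 * (y ^ 2) by ring, h1]
  ring

/-- A point is `p`-torsion if and only if its `x`-coordinate is a root of `torsionPoly`. -/
theorem smul_prime_eq_zero_iff {p : ℕ} (hp : p.Prime) (hP : HasCoords P x y) :
    p • P = 0 ↔ (torsionPoly W p).eval x = 0 := by
  have hE : W.toAffine.Equation x y := hP.choose.1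
  by_cases hy : y = 0
  · subst hy
    have h2 := hP.two_smul_eq_zero
    have h2' : W.Ψ₂Sq.eval x = 0 := by rw [eval_Ψ₂Sq hE]; ring
    rw [torsionPoly]
    split_ifs with h
    · subst h
      simp [h2, h2']
    · have hodd := hp.odd_of_ne_two h
      obtain ⟨k, rfl⟩ := hodd
      have h3 : (2 * k + 1) • P = P := by
        rw [add_smul, mul_comm, mul_smul, h2, smul_zero, zero_add, one_smul]
      rw [h3]
      refine iff_of_false hP.ne_zero (preΨ'_odd_ne_zero h2' ?_ ⟨k, rfl⟩)
      intro h3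
      have hns := hP.choose
      rw [Affine.nonsingular_iff] at hns
      have h4 := hns.2
      have h5 := hP.equation
      rw [eval_Ψ₃] at h3
      simp at h4
      apply h4
      have : (3 * x ^ 2 + W.a₄) ^ 2 = 0 := by linear_combination -12 * x * h5 - h3
      have := pow_eq_zero_iff two_ne_zero |>.mp this
      linear_combination - this
  · have h2y : 2 * y ≠ 0 := mul_ne_zero two_ne_zero hy
    rw [torsionPoly]
    split_ifs with h
    · subst h
      rw [eval_Ψ₂Sq hE]
      exact iff_of_false (hP.two_smul h2y).ne_zero (pow_ne_zero 2 h2y)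
    · have hodd := hp.odd_of_ne_two h
      rw [← divSeq_odd hodd hE]
      obtain ⟨h1, h2⟩ := smul_of_divSeq hP h2y p
      refine ⟨fun h => ?_, h2⟩
      by_contra h3
      obtain ⟨s, t, c, -⟩ := h1 h3
      exact c.ne_zero h

end Multiples

/-- The Weierstrass curve `y² = x³ + A x + B` over a commutative ring. -/
def short {R : Type*} [CommRing R] (A B : R) : WeierstrassCurve R := ⟨0, 0, 0, A, B⟩

section Short

variable {R : Type*} [CommRing R] (A B : R)

instance : (short A B).IsShortNF := ⟨rfl, rfl, rfl⟩

@[simp] lemma short_a₄ : (short A B).a₄ = A := rfl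

@[simp] lemma short_a₆ : (short A B).a₆ = B := rfl

lemma map_short {S : Type*} [CommRing S] (f : R →+* S) : (short A B).map f = short (f A) (f B) := by
  ext <;> simp [short]

lemma short_Δ : (short A B).Δ = -16 * (4 * A ^ 3 + 27 * B ^ 2) := by
  rw [Δ_of_isShortNF]
  simp

lemma short_c₄ : (short A B).c₄ = -48 * A := by
  rw [c₄_of_isShortNF]
  simp

lemma map_torsionPoly {R S : Type*} [CommRing R] [CommRing S] (f : R →+* S)
    (W : WeierstrassCurve R) (p : ℕ) : torsionPoly (W.map f) p = (torsionPoly W p).map f := by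
  rw [torsionPoly, torsionPoly]
  split_ifs
  · exact map_Ψ₂Sq ..
  · exact map_preΨ' ..

end Short

section Degree

/-- The degree of `torsionPoly`. -/
def torsionDegree (p : ℕ) : ℕ := if p = 2 then 3 else (p ^ 2 - 1) / 2

/-- The leading coefficient of `torsionPoly`. -/
def torsionLead (p : ℕ) : ℕ := if p = 2 then 4 else p

variable {R : Type*} [CommRing R] (W : WeierstrassCurve R) {p : ℕ}

lemma natDegree_torsionPoly_le (hp : p.Prime) : (torsionPoly W p).natDegree ≤ torsionDegree p := by
  rw [torsionPoly, torsionDegree]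
  split_ifs with h
  · exact W.natDegree_Ψ₂Sq_le
  · have := W.natDegree_preΨ'_le p
    rwa [if_neg (Nat.not_even_iff_odd.mpr (hp.odd_of_ne_two h))] at this

lemma coeff_torsionPoly (hp : p.Prime) :
    (torsionPoly W p).coeff (torsionDegree p) = torsionLead p := by
  rw [torsionPoly, torsionDegree, torsionLead]
  split_ifs with h
  · simp [W.coeff_Ψ₂Sq]
  · have := W.coeff_preΨ' p
    rwa [if_neg (Nat.not_even_iff_odd.mpr (hp.odd_of_ne_two h)),
      if_neg (Nat.not_even_iff_odd.mpr (hp.odd_of_ne_two h))] at this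

lemma torsionLead_dvd (p : ℕ) : torsionLead p ∣ p ^ 2 := by
  rw [torsionLead]
  split_ifs with h
  · simp [h]
  · exact dvd_pow_self p two_ne_zero

lemma torsionDegree_pos (hp : p.Prime) : 0 < torsionDegree p := by
  rw [torsionDegree]
  split_ifs with h
  · norm_num
  · have := hp.two_le
    have h3 : 3 ≤ p := by omega
    have : 9 ≤ p ^ 2 := by nlinarith
    omega

end Degree

section Weight

/-- A polynomial `f` over `ℤ[A, B]` which is homogeneous of degree `d` for the weights `1`, `2`, `3` of
the variable, of `A` and of `B`. -/
def IsWeighted (f : (MvPolynomial (Fin 2) ℤ)[X]) (d : ℕ) : Prop :=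
  f.natDegree ≤ d ∧
    ∀ i j, i + j = d → (f.coeff i).IsWeightedHomogeneous (![2, 3] : Fin 2 → ℕ) j

lemma IsWeighted.sub {f g : (MvPolynomial (Fin 2) ℤ)[X]} {d : ℕ} (hf : IsWeighted f d)
    (hg : IsWeighted g d) : IsWeighted (f - g) d := by
  refine ⟨(natDegree_sub_le_of_le hf.1 hg.1).trans (max_self d).le, fun i j h => ?_⟩
  rw [coeff_sub, sub_eq_add_neg, neg_eq_neg_one_mul, ← map_one MvPolynomial.C, ← map_neg]
  have := (MvPolynomial.isWeightedHomogeneous_C (![2, 3] : Fin 2 → ℕ) (-1 : ℤ)).mul (hg.2 i j h)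
  rw [zero_add] at this
  exact (hf.2 i j h).add this

lemma IsWeighted.mul {f g : (MvPolynomial (Fin 2) ℤ)[X]} {d e : ℕ} (hf : IsWeighted f d)
    (hg : IsWeighted g e) : IsWeighted (f * g) (d + e) := by
  refine ⟨natDegree_mul_le_of_le hf.1 hg.1, fun i j h => ?_⟩
  rw [coeff_mul]
  refine (MvPolynomial.weightedHomogeneousSubmodule ℤ _ j).sum_mem fun ⟨k, l⟩ hkl => ?_
  replace hkl : k + l = i := by simpa using hkl
  by_cases hk : k ≤ d
  · by_cases hl : l ≤ e
    · have := (hf.2 k (d - k) (by omega)).mul (hg.2 l (e - l) (by omega))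
      rwa [show d - k + (e - l) = j by omega] at this
    · rw [coeff_eq_zero_of_natDegree_lt (hg.1.trans_lt (not_le.mp hl)), mul_zero]
      exact Submodule.zero_mem _
  · rw [coeff_eq_zero_of_natDegree_lt (hf.1.trans_lt (not_le.mp hk)), zero_mul]
    exact Submodule.zero_mem _

lemma isWeighted_one : IsWeighted 1 0 := by
  refine ⟨by simp, fun i j h => ?_⟩
  obtain ⟨rfl, rfl⟩ : i = 0 ∧ j = 0 := by omega
  simpa using MvPolynomial.isWeightedHomogeneous_one _ _

lemma isWeighted_zero (d : ℕ) : IsWeighted 0 d :=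
  ⟨by simp, fun i j _ => by simpa using MvPolynomial.isWeightedHomogeneous_zero _ _ _⟩

lemma IsWeighted.pow {f : (MvPolynomial (Fin 2) ℤ)[X]} {d : ℕ} (hf : IsWeighted f d) (n : ℕ) :
    IsWeighted (f ^ n) (d * n) := by
  induction n with
  | zero => simpa using isWeighted_one
  | succ n ih => rw [pow_succ, mul_add, mul_one]; exact ih.mul hf

lemma isWeighted_C_mul_X_pow {c : MvPolynomial (Fin 2) ℤ} {j : ℕ}
    (hc : c.IsWeightedHomogeneous (![2, 3] : Fin 2 → ℕ) j) (k : ℕ) :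
    IsWeighted (C c * X ^ k) (k + j) := by
  refine ⟨(natDegree_C_mul_X_pow_le c k).trans (by omega), fun i l h => ?_⟩
  rw [coeff_C_mul_X_pow]
  split_ifs with hi
  · obtain rfl : l = j := by omega
    exact hc
  · exact MvPolynomial.isWeightedHomogeneous_zero _ _ _

lemma IsWeighted.add {f g : (MvPolynomial (Fin 2) ℤ)[X]} {d : ℕ} (hf : IsWeighted f d)
    (hg : IsWeighted g d) : IsWeighted (f + g) d := by
  have := hf.sub ((isWeighted_zero d).sub hg)
  rwa [zero_sub, sub_neg_eq_add] at this

/-- The universal curve in short normal form. -/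
abbrev universalCurve : WeierstrassCurve (MvPolynomial (Fin 2) ℤ) :=
  short (MvPolynomial.X 0) (MvPolynomial.X 1)

lemma isWeightedHomogeneous_A :
    (MvPolynomial.X 0 : MvPolynomial (Fin 2) ℤ).IsWeightedHomogeneous (![2, 3] : Fin 2 → ℕ) 2 :=
  MvPolynomial.isWeightedHomogeneous_X ℤ (![2, 3] : Fin 2 → ℕ) 0

lemma isWeightedHomogeneous_B :
    (MvPolynomial.X 1 : MvPolynomial (Fin 2) ℤ).IsWeightedHomogeneous (![2, 3] : Fin 2 → ℕ) 3 :=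
  MvPolynomial.isWeightedHomogeneous_X ℤ (![2, 3] : Fin 2 → ℕ) 1

lemma isWeightedHomogeneous_C_mul (z : ℤ) {f : MvPolynomial (Fin 2) ℤ} {j : ℕ}
    (hf : f.IsWeightedHomogeneous (![2, 3] : Fin 2 → ℕ) j) :
    (MvPolynomial.C z * f).IsWeightedHomogeneous (![2, 3] : Fin 2 → ℕ) j := by
  have := (MvPolynomial.isWeightedHomogeneous_C (![2, 3] : Fin 2 → ℕ) z).mul hf
  rwa [zero_add] at this

lemma isWeighted_Ψ₂Sq : IsWeighted universalCurve.Ψ₂Sq 3 := by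
  have : universalCurve.Ψ₂Sq = C (MvPolynomial.C 4) * X ^ 3 +
      C (MvPolynomial.C 4 * MvPolynomial.X 0) * X ^ 1 +
      C (MvPolynomial.C 4 * MvPolynomial.X 1) * X ^ 0 := by
    simp [Ψ₂Sq, b₂, b₄, b₆]
    simp only [map_ofNat]
    ring
  rw [this]
  exact ((isWeighted_C_mul_X_pow (MvPolynomial.isWeightedHomogeneous_C _ _) 3).add
    (isWeighted_C_mul_X_pow (isWeightedHomogeneous_C_mul _ isWeightedHomogeneous_A) 1)).add
    (isWeighted_C_mul_X_pow (isWeightedHomogeneous_C_mul _ isWeightedHomogeneous_B) 0)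

lemma isWeighted_Ψ₃ : IsWeighted universalCurve.Ψ₃ 4 := by
  have : universalCurve.Ψ₃ = C (MvPolynomial.C 3) * X ^ 4 +
      C (MvPolynomial.C 6 * MvPolynomial.X 0) * X ^ 2 +
      C (MvPolynomial.C 12 * MvPolynomial.X 1) * X ^ 1 +
      C (MvPolynomial.C (-1) * MvPolynomial.X 0 ^ 2) * X ^ 0 := by
    simp [Ψ₃, b₂, b₄, b₆, b₈]
    simp only [map_ofNat]
    ring
  rw [this]
  have hA := isWeightedHomogeneous_A
  have hB := isWeightedHomogeneous_B
  exact (((isWeighted_C_mul_X_pow (MvPolynomial.isWeightedHomogeneous_C _ _) 4).add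
    (isWeighted_C_mul_X_pow (isWeightedHomogeneous_C_mul _ hA) 2)).add
    (isWeighted_C_mul_X_pow (isWeightedHomogeneous_C_mul _ hB) 1)).add
    (isWeighted_C_mul_X_pow (isWeightedHomogeneous_C_mul _ (hA.pow 2)) 0)

lemma isWeighted_preΨ₄ : IsWeighted universalCurve.preΨ₄ 6 := by
  have : universalCurve.preΨ₄ = C (MvPolynomial.C 2) * X ^ 6 +
      C (MvPolynomial.C 10 * MvPolynomial.X 0) * X ^ 4 +
      C (MvPolynomial.C 40 * MvPolynomial.X 1) * X ^ 3 +
      C (MvPolynomial.C (-10) * MvPolynomial.X 0 ^ 2) * X ^ 2 +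
      C (MvPolynomial.C (-8) * (MvPolynomial.X 0 * MvPolynomial.X 1)) * X ^ 1 +
      C (MvPolynomial.C (-2) * MvPolynomial.X 0 ^ 3) * X ^ 0 +
      C (MvPolynomial.C (-16) * MvPolynomial.X 1 ^ 2) * X ^ 0 := by
    simp [preΨ₄, b₂, b₄, b₆, b₈]
    simp only [map_ofNat]
    ring
  rw [this]
  have hA := isWeightedHomogeneous_A
  have hB := isWeightedHomogeneous_B
  exact ((((((isWeighted_C_mul_X_pow (MvPolynomial.isWeightedHomogeneous_C _ _) 6).add
    (isWeighted_C_mul_X_pow (isWeightedHomogeneous_C_mul _ hA) 4)).add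
    (isWeighted_C_mul_X_pow (isWeightedHomogeneous_C_mul _ hB) 3)).add
    (isWeighted_C_mul_X_pow (isWeightedHomogeneous_C_mul _ (hA.pow 2)) 2)).add
    (isWeighted_C_mul_X_pow (isWeightedHomogeneous_C_mul _ (hA.mul hB)) 1)).add
    (isWeighted_C_mul_X_pow (isWeightedHomogeneous_C_mul _ (hA.pow 3)) 0)).add
    (isWeighted_C_mul_X_pow (isWeightedHomogeneous_C_mul _ (hB.pow 2)) 0)

lemma isWeighted_preΨ' (n : ℕ) (d : ℕ) (hd : 2 * d + (if Even n then 4 else 1) = n ^ 2) :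
    IsWeighted (universalCurve.preΨ' n) d := by
  induction n using Nat.strong_induction_on generalizing d with
  | _ n ih =>
  rcases (show n = 0 ∨ n = 1 ∨ n = 2 ∨ n = 3 ∨ n = 4 ∨ 5 ≤ n by omega) with
    rfl | rfl | rfl | rfl | rfl | hn
  · simp at hd
  · obtain rfl : d = 0 := by simpa using hd
    simpa using isWeighted_one
  · obtain rfl : d = 0 := by simpa using hd
    simpa using isWeighted_one
  · obtain rfl : d = 4 := by simp [show ¬ Even 3 by decide] at hd; omega
    simpa using isWeighted_Ψ₃
  · obtain rfl : d = 6 := by simp [show Even 4 by decide] at hd; omega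
    simpa using isWeighted_preΨ₄
  have ev : ∀ r, 2 * (r + 1) < n → IsWeighted (universalCurve.preΨ' (2 * (r + 1)))
      (2 * r ^ 2 + 4 * r) := fun r hr => ih _ hr _ (by rw [if_pos (even_two_mul _)]; ring)
  have od : ∀ r, 2 * r + 1 < n → IsWeighted (universalCurve.preΨ' (2 * r + 1))
      (2 * r ^ 2 + 2 * r) := fun r hr => ih _ hr _ (by rw [if_neg (by simp)]; ring)
  have key : ∀ {f g : (MvPolynomial (Fin 2) ℤ)[X]} {k l : ℕ}, IsWeighted f k → IsWeighted g l →
      k = d → l = d → IsWeighted (f - g) d := by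
    rintro f g k l hf hg rfl rfl
    exact hf.sub hg
  obtain ⟨k, rfl | rfl⟩ := n.even_or_odd'
  · obtain ⟨m, rfl⟩ := Nat.exists_eq_add_of_le' (show 3 ≤ k by omega)
    rw [if_pos (even_two_mul _)] at hd
    rw [preΨ'_even]
    obtain ⟨r, rfl | rfl⟩ := m.even_or_odd'
    · have e : d = 8 * r ^ 2 + 24 * r + 16 := by
        have : (2 * (2 * r + 3)) ^ 2 = 2 * (8 * r ^ 2 + 24 * r + 16) + 4 := by ring
        omega
      have h1 := od r (by omega)
      have h2 := ev r (by omega)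
      have h3 := od (r + 1) (by omega)
      have h4 := ev (r + 1) (by omega)
      have h5 := od (r + 2) (by omega)
      exact key (((h2.pow 2).mul h3).mul h5) ((h1.mul h3).mul (h4.pow 2)) (by rw [e]; ring)
        (by rw [e]; ring)
    · have e : d = 8 * r ^ 2 + 32 * r + 30 := by
        have : (2 * (2 * r + 1 + 3)) ^ 2 = 2 * (8 * r ^ 2 + 32 * r + 30) + 4 := by ring
        omega
      have h1 := ev r (by omega)
      have h2 := od (r + 1) (by omega)
      have h3 := ev (r + 1) (by omega)
      have h4 := od (r + 2) (by omega)
      have h5 := ev (r + 2) (by omega)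
      exact key (((h2.pow 2).mul h3).mul h5) ((h1.mul h3).mul (h4.pow 2)) (by rw [e]; ring)
        (by rw [e]; ring)
  · obtain ⟨m, rfl⟩ := Nat.exists_eq_add_of_le' (show 2 ≤ k by omega)
    rw [if_neg (by simp)] at hd
    rw [preΨ'_odd]
    obtain ⟨r, rfl | rfl⟩ := m.even_or_odd'
    · have e : d = 8 * r ^ 2 + 20 * r + 12 := by
        have : (2 * (2 * r + 2) + 1) ^ 2 = 2 * (8 * r ^ 2 + 20 * r + 12) + 1 := by ring
        omega
      have h1 := od r (by omega)
      have h2 := ev r (by omega)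
      have h3 := od (r + 1) (by omega)
      have h4 := ev (r + 1) (by omega)
      simp only [even_two_mul, if_true, mul_one]
      exact key ((h4.mul (h2.pow 3)).mul (isWeighted_Ψ₂Sq.pow 2)) (h1.mul (h3.pow 3))
        (by rw [e]; ring) (by rw [e]; ring)
    · have e : d = 8 * r ^ 2 + 28 * r + 24 := by
        have : (2 * (2 * r + 1 + 2) + 1) ^ 2 = 2 * (8 * r ^ 2 + 28 * r + 24) + 1 := by ring
        omega
      have h1 := ev r (by omega)
      have h2 := od (r + 1) (by omega)
      have h3 := ev (r + 1) (by omega)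
      have h4 := od (r + 2) (by omega)
      have ho : ¬ Even (2 * r + 1) := by simp
      simp only [ho, if_false, mul_one]
      exact key (h4.mul (h2.pow 3)) ((h1.mul (h3.pow 3)).mul (isWeighted_Ψ₂Sq.pow 2))
        (by rw [e]; ring) (by rw [e]; ring)

/-- The division polynomials are homogeneous for the weights of the coordinates and coefficients. -/
theorem isWeighted_torsionPoly {p : ℕ} (hp : p.Prime) :
    IsWeighted (torsionPoly universalCurve p) (torsionDegree p) := by
  rw [torsionPoly, torsionDegree]
  split_ifs with h
  · exact isWeighted_Ψ₂Sq
  · apply isWeighted_preΨ'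
    have hodd := hp.odd_of_ne_two h
    rw [if_neg (Nat.not_even_iff_odd.mpr hodd)]
    obtain ⟨k, rfl⟩ := hodd
    have : (2 * k + 1) ^ 2 = 2 * (2 * k ^ 2 + 2 * k) + 1 := by ring
    omega

end Weight

section Nodal

lemma map_divSeq_short {R S : Type*} [CommRing R] [CommRing S] (f : R →+* S) (A B x y : R) (n : ℤ) :
    divSeq (short (f A) (f B)) (f x) (f y) n = f (divSeq (short A B) x y n) := by
  rw [← map_short, map_divSeq]

variable {R : Type*} [CommRing R] [IsDomain R]

/-- The division polynomials of the nodal curve `y² = (x - 3c²)²(x + 6c²)` in terms of the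
parametrization `x = t² - 6c²`, `y = (t² - 9c²)t`. -/
lemma divSeq_nodal {c t : R} (hc : 6 * c ≠ 0) (ht : 2 * ((t + 3 * c) * (t - 3 * c) * t) ≠ 0)
    (n : ℕ) :
    6 * c * divSeq (short (-27 * c ^ 4) (54 * c ^ 6)) (t ^ 2 - 6 * c ^ 2)
        ((t + 3 * c) * (t - 3 * c) * t) n =
      ((t + 3 * c) * (t - 3 * c)) ^ n.choose 2 * ((t + 3 * c) ^ n - (t - 3 * c) ^ n) := by
  set W : WeierstrassCurve R := short (-27 * c ^ 4) (54 * c ^ 6)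
  have h2 : ∀ k : ℕ, (k + 1).choose 2 = k.choose 2 + k := fun k => by
    rw [Nat.choose_succ_succ' k 1, Nat.choose_one_right, add_comm]
  induction n using normEDSRec with
  | zero => simp [divSeq]
  | one => simp [divSeq]; ring
  | two => simp [divSeq]; ring
  | three =>
    simp only [divSeq, Nat.cast_ofNat, normEDS_three, eval_Ψ₃, W, short_a₄, short_a₆]
    simp only [show Nat.choose 3 2 = 3 by rfl]
    ring
  | four =>
    simp only [divSeq, Nat.cast_ofNat, normEDS_four, eval_preΨ₄, W, short_a₄, short_a₆]
    simp only [show Nat.choose 4 2 = 6 by rfl]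
    ring
  | even m h1 h2' h3 h4 h5 =>
    have key := normEDS_even (2 * ((t + 3 * c) * (t - 3 * c) * t)) (W.Ψ₃.eval (t ^ 2 - 6 * c ^ 2))
      (W.preΨ₄.eval (t ^ 2 - 6 * c ^ 2)) (m + 3 : ℤ)
    change divSeq W _ _ _ * _ = divSeq W _ _ _ ^ 2 * divSeq W _ _ _ * divSeq W _ _ _ -
      divSeq W _ _ _ * divSeq W _ _ _ * divSeq W _ _ _ ^ 2 at key
    have e : (2 * (m + 3)).choose 2 = 4 * (m + 1).choose 2 + 9 * m + 15 := by
      have := Nat.choose_two_right (2 * (m + 3))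
      have := Nat.triangle_succ m
      have h0 : (m + 1).choose 2 * 2 = m * (m + 1) := by
        rw [Nat.choose_two_right, Nat.div_mul_cancel (by simpa [mul_comm] using (Nat.even_mul_succ_self m).two_dvd)]
        simp [mul_comm]
      have h1 : (2 * (m + 3)).choose 2 * 2 = 2 * (m + 3) * (2 * m + 5) := by
        rw [Nat.choose_two_right, Nat.div_mul_cancel]
        · rfl
        · rw [mul_assoc]; exact dvd_mul_right _ _
      nlinarith
    simp only [h2 (m + 1), h2 (m + 2), h2 (m + 3), h2 (m + 4)] at h2' h3 h4 h5
    rw [e]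
    generalize (m + 1).choose 2 = r at *
    have i1 : ((m : ℤ) + 3 - 1) = (m + 2 : ℕ) := by push_cast; ring
    have i2 : ((m : ℤ) + 3) = (m + 3 : ℕ) := by push_cast; ring
    have i3 : ((m : ℤ) + 3 + 2) = (m + 5 : ℕ) := by push_cast; ring
    have i4 : ((m : ℤ) + 3 - 2) = (m + 1 : ℕ) := by push_cast; ring
    have i5 : ((m : ℤ) + 3 + 1) = (m + 4 : ℕ) := by push_cast; ring
    have i6 : (2 * ((m : ℤ) + 3)) = (2 * (m + 3) : ℕ) := by push_cast; ring
    rw [i1, i3, i4, i5, i6, i2] at key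
    generalize divSeq W _ _ (m + 1 : ℕ) = w1 at *
    generalize divSeq W _ _ (m + 2 : ℕ) = w2 at *
    generalize divSeq W _ _ (m + 3 : ℕ) = w3 at *
    generalize divSeq W _ _ (m + 4 : ℕ) = w4 at *
    generalize divSeq W _ _ (m + 5 : ℕ) = w5 at *
    generalize divSeq W _ _ (2 * (m + 3) : ℕ) = w at *
    have hc3 : (6 * c) ^ 3 ≠ 0 := pow_ne_zero _ hc
    apply mul_left_cancel₀ (mul_ne_zero hc3 ht)
    have : (6 * c) ^ 4 * (w * (2 * ((t + 3 * c) * (t - 3 * c) * t))) =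
      (6 * c * w2) ^ 2 * (6 * c * w3) * (6 * c * w5) -
        (6 * c * w1) * (6 * c * w3) * (6 * c * w4) ^ 2 := by rw [key]; ring
    rw [h1, h2', h3, h4, h5] at this
    have h6c : 6 * c = (t + 3 * c) - (t - 3 * c) := by ring
    have ht2 : 2 * ((t + 3 * c) * (t - 3 * c) * t) =
      ((t + 3 * c) * (t - 3 * c)) * ((t + 3 * c) + (t - 3 * c)) := by ring
    rw [ht2] at this ⊢
    rw [h6c] at this ⊢
    generalize t + 3 * c = α at *
    generalize t - 3 * c = β at *
    refine Eq.trans ?_ (this.trans ?_) <;> ring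
  | odd m h1 h2' h3 h4 =>
    have key := normEDS_odd (2 * ((t + 3 * c) * (t - 3 * c) * t)) (W.Ψ₃.eval (t ^ 2 - 6 * c ^ 2))
      (W.preΨ₄.eval (t ^ 2 - 6 * c ^ 2)) (m + 2 : ℤ)
    change divSeq W _ _ _ = divSeq W _ _ _ * divSeq W _ _ _ ^ 3 -
      divSeq W _ _ _ * divSeq W _ _ _ ^ 3 at key
    have e : (2 * (m + 2) + 1).choose 2 = 4 * (m + 1).choose 2 + 7 * m + 10 := by
      have h0 : (m + 1).choose 2 * 2 = m * (m + 1) := by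
        rw [Nat.choose_two_right, Nat.div_mul_cancel (by simpa [mul_comm] using (Nat.even_mul_succ_self m).two_dvd)]
        simp [mul_comm]
      have h1 : (2 * (m + 2) + 1).choose 2 * 2 = (2 * (m + 2) + 1) * (2 * (m + 2)) := by
        rw [Nat.choose_two_right, Nat.div_mul_cancel]
        · rfl
        · exact Dvd.dvd.mul_left (by simp) _
      nlinarith
    simp only [h2 (m + 1), h2 (m + 2), h2 (m + 3)] at h2' h3 h4
    rw [e]
    generalize (m + 1).choose 2 = r at *
    have i1 : ((m : ℤ) + 2 - 1) = (m + 1 : ℕ) := by push_cast; ring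
    have i2 : ((m : ℤ) + 2) = (m + 2 : ℕ) := by push_cast; ring
    have i3 : ((m : ℤ) + 2 + 2) = (m + 4 : ℕ) := by push_cast; ring
    have i5 : ((m : ℤ) + 2 + 1) = (m + 3 : ℕ) := by push_cast; ring
    have i6 : (2 * ((m : ℤ) + 2) + 1) = (2 * (m + 2) + 1 : ℕ) := by push_cast; ring
    rw [i1, i3, i5, i6, i2] at key
    generalize divSeq W _ _ (m + 1 : ℕ) = w1 at *
    generalize divSeq W _ _ (m + 2 : ℕ) = w2 at *
    generalize divSeq W _ _ (m + 3 : ℕ) = w3 at *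
    generalize divSeq W _ _ (m + 4 : ℕ) = w4 at *
    generalize divSeq W _ _ (2 * (m + 2) + 1 : ℕ) = w at *
    have hc3 : (6 * c) ^ 3 ≠ 0 := pow_ne_zero _ hc
    apply mul_left_cancel₀ hc3
    have : (6 * c) ^ 4 * w = (6 * c * w4) * (6 * c * w2) ^ 3 -
        (6 * c * w1) * (6 * c * w3) ^ 3 := by rw [key]; ring
    rw [h1, h2', h3, h4] at this
    have h6c : 6 * c = (t + 3 * c) - (t - 3 * c) := by ring
    rw [h6c] at this ⊢
    generalize t + 3 * c = α at *
    generalize t - 3 * c = β at *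
    refine Eq.trans ?_ (this.trans ?_) <;> ring

end Nodal

section NodalField

variable {κ : Type*} [Field κ] [IsAlgClosed κ] {a : κ}

lemma exists_sqrt_node (h6 : (6 : κ) ≠ 0) (ha : a ≠ 0) : ∃ c : κ, a = 3 * c ^ 2 ∧ 6 * c ≠ 0 := by
  have h3 : (3 : κ) ≠ 0 := fun h => h6 (by rw [show (6 : κ) = 2 * 3 by norm_num, h, mul_zero])
  obtain ⟨c, hc⟩ := IsAlgClosed.exists_pow_nat_eq (a / 3) two_pos
  refine ⟨c, by rw [hc]; field_simp, mul_ne_zero h6 fun h => ha ?_⟩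
  rw [h] at hc
  field_simp at hc
  simpa using hc.symm

/-- The division polynomials of the nodal curve in the parametrization, generically. -/
lemma divSeq_nodal_polynomial (h6 : (6 : κ) ≠ 0) {c : κ} (hc : 6 * c ≠ 0) (n : ℕ) :
    C (6 * c) * divSeq (short (C (-27 * c ^ 4)) (C (54 * c ^ 6))) (X ^ 2 - C (6 * c ^ 2))
        ((X + C (3 * c)) * (X - C (3 * c)) * X) n =
      ((X + C (3 * c)) * (X - C (3 * c))) ^ n.choose 2 *
        ((X + C (3 * c)) ^ n - (X - C (3 * c)) ^ n) := by
  have h2 : (2 : κ) ≠ 0 := fun h => h6 (by rw [show (6 : κ) = 2 * 3 by norm_num, h, zero_mul])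
  have := divSeq_nodal (c := C c) (t := X) (by simpa only [map_mul, map_ofNat] using C_ne_zero.mpr hc) ?_ n
  · simpa [map_ofNat] using this
  · rw [show (3 * C c : κ[X]) = C (3 * c) by simp [map_ofNat],
      show (2 : κ[X]) = C 2 by simp [map_ofNat]]
    exact mul_ne_zero (C_ne_zero.mpr h2)
      (mul_ne_zero (mul_ne_zero (X_add_C_ne_zero _) (X_sub_C_ne_zero _)) X_ne_zero)

lemma divSeq_nodal_field (h6 : (6 : κ) ≠ 0) {c : κ} (hc : 6 * c ≠ 0) (t : κ) (n : ℕ) :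
    6 * c * divSeq (short (-27 * c ^ 4) (54 * c ^ 6)) (t ^ 2 - 6 * c ^ 2)
        ((t + 3 * c) * (t - 3 * c) * t) n =
      ((t + 3 * c) * (t - 3 * c)) ^ n.choose 2 * ((t + 3 * c) ^ n - (t - 3 * c) ^ n) := by
  have h := congrArg (evalRingHom t) (divSeq_nodal_polynomial h6 hc n)
  rw [map_mul, ← map_divSeq_short] at h
  simpa using h

/-- On the nodal curve the formula for the `x`-coordinate of `k • P` degenerates. -/
theorem divSeq_nodal_identity (h6 : (6 : κ) ≠ 0) (ha : a ≠ 0) {x y : κ}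
    (h : y ^ 2 = x ^ 3 + -3 * a ^ 2 * x + 2 * a ^ 3) (k : ℕ) :
    (x - a) * divSeq (short (-3 * a ^ 2) (2 * a ^ 3)) x y (k + 1 : ℕ) ^ 2 -
      divSeq (short (-3 * a ^ 2) (2 * a ^ 3)) x y (k + 2 : ℕ) *
        divSeq (short (-3 * a ^ 2) (2 * a ^ 3)) x y k = (x - a) ^ ((k + 1) ^ 2) := by
  obtain ⟨c, rfl, hc⟩ := exists_sqrt_node h6 ha
  have hxy : y ^ 2 = (x - 3 * c ^ 2) ^ 2 * (x + 6 * c ^ 2) := by rw [h]; ring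
  obtain ⟨t, hx, hy⟩ : ∃ t, x = t ^ 2 - 6 * c ^ 2 ∧ y = (t + 3 * c) * (t - 3 * c) * t := by
    by_cases hD : x - 3 * c ^ 2 = 0
    · refine ⟨3 * c, by linear_combination hD, ?_⟩
      rw [hD] at hxy
      simpa using hxy
    · refine ⟨y / (x - 3 * c ^ 2), ?_, ?_⟩
      · field_simp
        linear_combination - hxy
      · have : (y / (x - 3 * c ^ 2)) ^ 2 = x + 6 * c ^ 2 := by
          field_simp
          linear_combination hxy
        rw [show (y / (x - 3 * c ^ 2) + 3 * c) * (y / (x - 3 * c ^ 2) - 3 * c) =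
          (y / (x - 3 * c ^ 2)) ^ 2 - 9 * c ^ 2 by ring, this]
        rw [show x + 6 * c ^ 2 - 9 * c ^ 2 = x - 3 * c ^ 2 by ring, mul_div_cancel₀ _ hD]
  have e1 : (-3 * (3 * c ^ 2) ^ 2 : κ) = -27 * c ^ 4 := by ring
  have e2 : (2 * (3 * c ^ 2) ^ 3 : κ) = 54 * c ^ 6 := by ring
  rw [e1, e2, hx, hy]
  have h2 : ∀ k : ℕ, (k + 1).choose 2 = k.choose 2 + k := fun k => by
    rw [Nat.choose_succ_succ' k 1, Nat.choose_one_right, add_comm]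
  have w0 := divSeq_nodal_field h6 hc t k
  have w1 := divSeq_nodal_field h6 hc t (k + 1)
  have w2 := divSeq_nodal_field h6 hc t (k + 2)
  rw [h2 (k + 1)] at w2
  rw [h2] at w1 w2
  have ek : (k + 1) ^ 2 = 2 * k.choose 2 + 3 * k + 1 := by
    have h0 : k.choose 2 * 2 = k * (k - 1) := by
      rw [Nat.choose_two_right, Nat.div_mul_cancel (Nat.even_mul_pred_self k).two_dvd]
    rcases k with _ | k
    · simp
    · simp only [Nat.add_sub_cancel] at h0; linarith
  rw [ek]
  generalize k.choose 2 = r at *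
  generalize divSeq (short (-27 * c ^ 4) (54 * c ^ 6)) (t ^ 2 - 6 * c ^ 2)
    ((t + 3 * c) * (t - 3 * c) * t) (k : ℤ) = v0 at *
  generalize divSeq (short (-27 * c ^ 4) (54 * c ^ 6)) (t ^ 2 - 6 * c ^ 2)
    ((t + 3 * c) * (t - 3 * c) * t) ((k + 1 : ℕ) : ℤ) = v1 at *
  generalize divSeq (short (-27 * c ^ 4) (54 * c ^ 6)) (t ^ 2 - 6 * c ^ 2)
    ((t + 3 * c) * (t - 3 * c) * t) ((k + 2 : ℕ) : ℤ) = v2 at *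
  apply mul_left_cancel₀ (pow_ne_zero 2 hc)
  have : (6 * c) ^ 2 * ((t ^ 2 - 6 * c ^ 2 - 3 * c ^ 2) * v1 ^ 2 - v2 * v0) =
    (t + 3 * c) * (t - 3 * c) * (6 * c * v1) ^ 2 - (6 * c * v2) * (6 * c * v0) := by ring
  rw [this, w0, w1, w2]
  have h6c : 6 * c = (t + 3 * c) - (t - 3 * c) := by ring
  rw [h6c, show t ^ 2 - 6 * c ^ 2 - 3 * c ^ 2 = (t + 3 * c) * (t - 3 * c) by ring]
  generalize t + 3 * c = α at *
  generalize t - 3 * c = β at *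
  ring

/-- The node is a root of multiplicity at least `p(p - 1)/2` of the `p`-th division polynomial. -/
theorem pow_dvd_preΨ'_nodal (h6 : (6 : κ) ≠ 0) (ha : a ≠ 0) {n : ℕ} (hn : Odd n) :
    (X - C a) ^ n.choose 2 ∣ (short (-3 * a ^ 2) (2 * a ^ 3)).preΨ' n := by
  obtain ⟨c, rfl, hc⟩ := exists_sqrt_node h6 ha
  have e1 : (-3 * (3 * c ^ 2) ^ 2 : κ) = -27 * c ^ 4 := by ring
  have e2 : (2 * (3 * c ^ 2) ^ 3 : κ) = 54 * c ^ 6 := by ring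
  rw [e1, e2]
  have key := divSeq_nodal_polynomial h6 hc n
  have hdiv : divSeq (short (C (-27 * c ^ 4)) (C (54 * c ^ 6))) (X ^ 2 - C (6 * c ^ 2))
        ((X + C (3 * c)) * (X - C (3 * c)) * X) n =
      ((short (-27 * c ^ 4) (54 * c ^ 6)).preΨ' n).comp (X ^ 2 - C (6 * c ^ 2)) := by
    have : short (C (-27 * c ^ 4)) (C (54 * c ^ 6)) = (short (-27 * c ^ 4) (54 * c ^ 6)).map C := by
      rw [map_short]
    rw [divSeq_odd hn, this, map_preΨ', eval_map, comp]
    rw [Affine.equation_iff]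
    simp only [short, map_neg, map_mul, map_pow, map_ofNat]
    ring
  rw [hdiv] at key
  set F := (short (-27 * c ^ 4) (54 * c ^ 6)).preΨ' n
  set N := n.choose 2
  set Q : κ[X] := X ^ 2 - C (6 * c ^ 2)
  have hQ : Q.natDegree = 2 := by
    rw [natDegree_sub_C, natDegree_X_pow]
  have hm : ((X - C (3 * c ^ 2)) ^ N).Monic := (monic_X_sub_C _).pow _
  have hdec := modByMonic_add_div F ((X - C (3 * c ^ 2)) ^ N)
  set r := F %ₘ (X - C (3 * c ^ 2)) ^ N with hr
  set q := F /ₘ (X - C (3 * c ^ 2)) ^ N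
  rw [← modByMonic_eq_zero_iff_dvd hm, ← hr]
  by_contra hr0
  have hdeg : r.natDegree < N := by
    have := natDegree_lt_natDegree hr0 (degree_modByMonic_lt F hm)
    rwa [(monic_X_sub_C _).natDegree_pow, natDegree_X_sub_C, mul_one] at this
  have hpow : ((X - C (3 * c ^ 2)) ^ N).comp Q = ((X + C (3 * c)) * (X - C (3 * c))) ^ N := by
    rw [pow_comp, sub_comp, X_comp, C_comp]
    congr 1
    simp only [Q, map_mul, map_pow, map_ofNat]
    ring
  have hdvd : ((X + C (3 * c)) * (X - C (3 * c))) ^ N ∣ C (6 * c) * r.comp Q := by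
    have : C (6 * c) * r.comp Q = C (6 * c) * F.comp Q - ((X + C (3 * c)) * (X - C (3 * c))) ^ N *
        (C (6 * c) * q.comp Q) := by
      rw [← hdec, add_comp, mul_comp, hpow]
      ring
    rw [this, key]
    exact dvd_sub (dvd_mul_right _ _) (dvd_mul_right _ _)
  have hne : r.comp Q ≠ 0 := by
    intro h
    rcases comp_eq_zero_iff.mp h with h | ⟨_, h⟩
    · exact hr0 h
    · rw [h, natDegree_C] at hQ
      omega
  have h1 := natDegree_le_of_dvd hdvd (mul_ne_zero (C_ne_zero.mpr hc) hne)
  rw [natDegree_pow, natDegree_mul (X_add_C_ne_zero _) (X_sub_C_ne_zero _), natDegree_X_add_C,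
    natDegree_X_sub_C, natDegree_C_mul hc, natDegree_comp, hQ] at h1
  omega

/-- The node is a root of `torsionPoly`. -/
lemma eval_torsionPoly_nodal (h6 : (6 : κ) ≠ 0) (ha : a ≠ 0) {p : ℕ} (hp : p.Prime) :
    (torsionPoly (short (-3 * a ^ 2) (2 * a ^ 3)) p).eval a = 0 := by
  rw [torsionPoly]
  split_ifs with h
  · simp [Ψ₂Sq, b₂, b₄, b₆, short]
    ring
  · have h3 : 3 ≤ p := by have := hp.two_le; omega
    have := pow_dvd_preΨ'_nodal h6 ha (hp.odd_of_ne_two h)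
    exact dvd_iff_isRoot.mp ((dvd_pow_self _ (Nat.choose_pos (by omega)).ne').trans this)

end NodalField

section Universal

lemma isWeightedHomogeneous_one_eq_zero {f : MvPolynomial (Fin 2) ℤ}
    (h : f.IsWeightedHomogeneous (![2, 3] : Fin 2 → ℕ) 1) : f = 0 := by
  ext d
  rw [MvPolynomial.coeff_zero]
  by_contra hd
  have := h hd
  simp [Finsupp.weight_apply, Finsupp.sum_fintype] at this
  omega

lemma torsionPoly_short_eq_map {R : Type*} [CommRing R] (A B : R) (p : ℕ) :
    torsionPoly (short A B) p =
      (torsionPoly universalCurve p).map (MvPolynomial.eval₂Hom (Int.castRingHom R) ![A, B]) := by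
  rw [← map_torsionPoly, map_short]
  simp

lemma coeff_torsionPoly_sub_one {R : Type*} [CommRing R] (A B : R) {p : ℕ} (hp : p.Prime) :
    (torsionPoly (short A B) p).coeff (torsionDegree p - 1) = 0 := by
  rw [torsionPoly_short_eq_map, coeff_map,
    isWeightedHomogeneous_one_eq_zero ((isWeighted_torsionPoly hp).2 (torsionDegree p - 1) 1
      (Nat.sub_add_cancel (torsionDegree_pos hp))), map_zero]

end Universal

section NodalSum

variable {κ : Type*} [Field κ] [IsAlgClosed κ] {a : κ}

lemma sum_roots_nodal (h6 : (6 : κ) ≠ 0) (ha : a ≠ 0) {p : ℕ} (hp : p.Prime) (hp2 : p ≠ 2)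
    (hpκ : (p : κ) ≠ 0) {m : Multiset κ} (hm : 2 * m.card = p - 1) (ham : a ∉ m)
    (hdvd : (m.map fun r => X - C r).prod ∣ (short (-3 * a ^ 2) (2 * a ^ 3)).preΨ' p) :
    m.sum + p.choose 2 • a = 0 := by
  have hodd := hp.odd_of_ne_two hp2
  have hF : torsionPoly (short (-3 * a ^ 2) (2 * a ^ 3)) p =
      (short (-3 * a ^ 2) (2 * a ^ 3)).preΨ' p := by rw [torsionPoly, if_neg hp2]
  have hdeg := natDegree_torsionPoly_le (short (-3 * a ^ 2) (2 * a ^ 3)) hp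
  have hlead := coeff_torsionPoly (short (-3 * a ^ 2) (2 * a ^ 3)) hp
  have hsub := coeff_torsionPoly_sub_one (-3 * a ^ 2) (2 * a ^ 3) hp
  rw [torsionLead, if_neg hp2] at hlead
  rw [hF] at hdeg hlead hsub
  set F := (short (-3 * a ^ 2) (2 * a ^ 3)).preΨ' p
  have hF0 : F ≠ 0 := by
    intro h
    rw [h, coeff_zero] at hlead
    exact hpκ hlead.symm
  have hcop : IsCoprime ((X - C a) ^ p.choose 2) (m.map fun r => X - C r).prod := by
    refine IsCoprime.pow_left ?_
    rw [(irreducible_X_sub_C a).coprime_iff_not_dvd, dvd_iff_isRoot, IsRoot, eval_multiset_prod,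
      Multiset.prod_eq_zero_iff]
    simp only [Multiset.map_map, Multiset.mem_map, Function.comp_apply, eval_sub, eval_X, eval_C]
    rintro ⟨r, hr, h⟩
    exact ham (by rwa [sub_eq_zero.mp h])
  obtain ⟨q, hq⟩ := hcop.mul_dvd (pow_dvd_preΨ'_nodal h6 ha hodd) hdvd
  have hprod : (X - C a) ^ p.choose 2 * (m.map fun r => X - C r).prod =
      ((m + Multiset.replicate (p.choose 2) a).map fun r => X - C r).prod := by
    simp [mul_comm]
  change F = _ at hq
  rw [hprod] at hq
  have hcard : (m + Multiset.replicate (p.choose 2) a).card = torsionDegree p := by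
    rw [Multiset.card_add, Multiset.card_replicate, torsionDegree, if_neg hp2,
      Nat.choose_two_right]
    obtain ⟨k, rfl⟩ := hodd
    have e1 : (2 * k + 1) * (2 * k + 1 - 1) = 2 * (2 * k ^ 2 + k) := by
      rw [Nat.add_sub_cancel]; ring
    have e2 : (2 * k + 1) ^ 2 = 2 * (2 * k ^ 2 + 2 * k) + 1 := by ring
    omega
  set m' := m + Multiset.replicate (p.choose 2) a
  have hq0 : q ≠ 0 := fun h => hF0 (by rw [hq, h, mul_zero])
  have hmonic : (m'.map fun r => X - C r).prod.Monic := monic_multisetProd_X_sub_C m'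
  have hqd : q.natDegree = 0 := by
    rw [hq, hmonic.natDegree_mul' hq0, natDegree_multiset_prod_X_sub_C_eq_card, hcard] at hdeg
    omega
  rw [eq_C_of_natDegree_eq_zero hqd] at hq hq0
  have hpos : 0 < Multiset.card m' := by rw [hcard]; exact torsionDegree_pos hp
  rw [hq, coeff_mul_C, ← hcard, multiset_prod_X_sub_C_coeff_card_pred _ hpos] at hsub
  have := (mul_eq_zero.mp hsub).resolve_right (fun h => hq0 (by rw [h, C_0]))
  rw [neg_eq_zero] at this
  simpa [m'] using this

end NodalSum

section XCoord

variable {F : Type*} [Field F] {W : WeierstrassCurve F}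

/-- The `x`-coordinate of a point, with value `0` at infinity. -/
def xCoord (P : W.toAffine.Point) : F :=
  match P with
  | .zero => 0
  | .some x _ _ => x

lemma HasCoords.xCoord_eq {P : W.toAffine.Point} {x y : F} (h : HasCoords P x y) :
    xCoord P = x := by
  obtain ⟨h, rfl⟩ := h
  rfl

variable [W.IsShortNF]

lemma xCoord_neg (P : W.toAffine.Point) : xCoord (-P) = xCoord P := by
  by_cases hP : P = 0
  · rw [hP]
    rfl
  · obtain ⟨x, y, h⟩ := exists_hasCoords hP
    rw [h.xCoord_eq, h.neg.xCoord_eq]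

variable [DecidableEq F]

lemma xCoord_eq_iff {P Q : W.toAffine.Point} (hP : P ≠ 0) (hQ : Q ≠ 0) :
    xCoord P = xCoord Q ↔ P = Q ∨ P = -Q := by
  refine ⟨fun h => ?_, ?_⟩
  · obtain ⟨x, y, h₁⟩ := exists_hasCoords hP
    obtain ⟨x', y', h₂⟩ := exists_hasCoords hQ
    rw [h₁.xCoord_eq, h₂.xCoord_eq] at h
    subst h
    exact h₁.eq_or_eq_neg h₂
  · rintro (rfl | rfl)
    · rfl
    · exact xCoord_neg Q

variable {G : AddSubgroup W.toAffine.Point} {s : Finset W.toAffine.Point} {p : ℕ}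

lemma nsmul_eq_zero_of_card (hG : Nat.card G = p) {P : W.toAffine.Point} (hP : P ∈ G) :
    p • P = 0 := by
  have := pow_card_eq_one' (G := Multiplicative G) (x := Multiplicative.ofAdd ⟨P, hP⟩)
  have h : Nat.card G • (⟨P, hP⟩ : G) = 0 := this
  rw [hG] at h
  exact congrArg Subtype.val h

lemma card_nonzero (hG : Nat.card G = p)
    (hs : ∀ P, P ∈ s ↔ P ∈ G ∧ P ≠ 0) : s.card = p - 1 := by
  classical
  have h1 : (insert 0 s : Finset W.toAffine.Point).card = p := by
    rw [← hG, ← Set.ncard_coe_finset]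
    change _ = Set.ncard (G : Set W.toAffine.Point)
    congr 1
    ext P
    simp only [Finset.coe_insert, Set.mem_insert_iff, hs, SetLike.mem_coe]
    refine ⟨?_, fun h => or_iff_not_imp_left.mpr fun h0 => ⟨h, h0⟩⟩
    rintro (rfl | h)
    · exact G.zero_mem
    · exact h.1
  rw [Finset.card_insert_of_notMem (fun h => ((hs 0).mp h).2 rfl)] at h1
  omega

lemma two_nsmul_ne_zero (hG : Nat.card G = p) (hp : p.Prime) (hp2 : p ≠ 2) {P : W.toAffine.Point}
    (hPG : P ∈ G) (hP0 : P ≠ 0) : 2 • P ≠ 0 := by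
  intro h2
  obtain ⟨k, hk⟩ := hp.odd_of_ne_two hp2
  have := nsmul_eq_zero_of_card hG hPG
  rw [hk, add_smul, mul_comm, mul_smul, h2, smul_zero, zero_add, one_smul] at this
  exact hP0 this

lemma exists_nsmul_eq_of_card (hG : Nat.card G = p) (hp : p.Prime) {P Q : W.toAffine.Point}
    (hPG : P ∈ G) (hP0 : P ≠ 0) (hQG : Q ∈ G) : ∃ k : ℕ, Q = k • P := by
  have : Fact p.Prime := ⟨hp⟩
  have := mem_multiples_of_prime_card (G := G) hG (g := ⟨P, hPG⟩) (g' := ⟨Q, hQG⟩)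
    (fun h => hP0 (congrArg Subtype.val h))
  obtain ⟨k, hk⟩ := this
  exact ⟨k, (congrArg Subtype.val hk).symm⟩

/-- Functions of the `x`-coordinate of the non-zero points of a subgroup of odd prime order take
every value twice. -/
lemma card_fiber_xCoord (hG : Nat.card G = p) (hp : p.Prime) (hp2 : p ≠ 2)
    (hs : ∀ P, P ∈ s ↔ P ∈ G ∧ P ≠ 0) {V : Type*} [DecidableEq V] {ξ : W.toAffine.Point → V}
    (hξ : ∀ P ∈ s, ∀ Q ∈ s, ξ P = ξ Q ↔ xCoord P = xCoord Q) {v : V} (hv : v ∈ s.image ξ) :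
    (s.filter fun P => ξ P = v).card = 2 := by
  classical
  obtain ⟨P, hP, rfl⟩ := Finset.mem_image.mp hv
  obtain ⟨hPG, hP0⟩ := (hs P).mp hP
  have hne : P ≠ -P := by
    intro h
    refine two_nsmul_ne_zero hG hp hp2 hPG hP0 ?_
    rw [two_nsmul]
    nth_rewrite 2 [h]
    exact add_neg_cancel P
  rw [Finset.card_eq_two]
  refine ⟨P, -P, hne, ?_⟩
  have hnP : -P ∈ s := (hs _).mpr ⟨neg_mem hPG, neg_ne_zero.mpr hP0⟩
  ext Q
  simp only [Finset.mem_filter, Finset.mem_insert, Finset.mem_singleton]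
  constructor
  · rintro ⟨hQ, h⟩
    exact (xCoord_eq_iff ((hs Q).mp hQ).2 hP0).mp ((hξ Q hQ P hP).mp h)
  · rintro (rfl | rfl)
    · exact ⟨hP, rfl⟩
    · exact ⟨hnP, (hξ _ hnP P hP).mpr (xCoord_neg P)⟩

end XCoord

section Reduction

variable {K : Type*} [Field K] [CharZero K] [DecidableEq K] {V : ValuationSubring K}
  {κ : Type*} [Field κ] [IsAlgClosed κ] (f : V →+* κ) [IsLocalHom f]

lemma mem_of_isRoot {P : V[X]} {n : ℕ} (hdeg : P.natDegree ≤ n) (hlead : f (P.coeff n) ≠ 0)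
    {x : K} (hx : (P.map V.subtype).eval x = 0) : x ∈ V := by
  have hu : IsUnit (P.coeff n) := isUnit_of_map_unit f _ (isUnit_iff_ne_zero.mpr hlead)
  obtain ⟨u, hu⟩ := hu
  have hn : P.natDegree = n := hdeg.antisymm (le_natDegree_of_ne_zero fun h => hlead (by simp [h]))
  have hmon : (C (↑u⁻¹ : V) * P).Monic := by
    rw [Monic, leadingCoeff, natDegree_C_mul_of_isUnit u⁻¹.isUnit, hn, coeff_C_mul, ← hu,
      Units.inv_mul]
  have hint : IsIntegral V x := ⟨_, hmon, by
    rw [eval₂_mul]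
    rw [eval_map] at hx
    change _ * eval₂ V.subtype x P = 0
    rw [hx, mul_zero]⟩
  obtain ⟨y, hy⟩ := IsIntegrallyClosed.isIntegral_iff.mp hint
  rw [← hy]
  exact y.2

/-- The sum of the `x`-coordinates of the non-zero points of a subgroup of prime order of an
elliptic curve with nodal reduction does not vanish, if the residue characteristic is large. -/
theorem sum_xCoord_ne_zero {A B : V} {W : WeierstrassCurve K} [W.IsShortNF] [W.IsElliptic]
    (hA : W.a₄ = A) (hB : W.a₆ = B) {a : κ} (ha : a ≠ 0) (hfA : f A = -3 * a ^ 2)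
    (hfB : f B = 2 * a ^ 3) (h6 : (6 : κ) ≠ 0) {p : ℕ} (hp : p.Prime)
    (hpκ : ((p * (p - 1) : ℕ) : κ) ≠ 0)
    {G : AddSubgroup W.toAffine.Point} (hG : Nat.card G = p) {s : Finset W.toAffine.Point}
    (hs : ∀ P, P ∈ s ↔ P ∈ G ∧ P ≠ 0) : ∑ P ∈ s, xCoord P ≠ 0 := by
  classical
  have h2 : (2 : κ) ≠ 0 := fun h => h6 (by rw [show (6 : κ) = 2 * 3 by norm_num, h, zero_mul])
  have h3 : (3 : κ) ≠ 0 := fun h => h6 (by rw [show (6 : κ) = 2 * 3 by norm_num, h, mul_zero])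
  rw [Nat.cast_mul] at hpκ
  have hp1κ := right_ne_zero_of_mul hpκ
  replace hpκ := left_ne_zero_of_mul hpκ
  have hcard := card_nonzero hG hs
  have hW : W = (short A B).map V.subtype := by
    rw [map_short]
    ext <;> simp [hA, hB, short]
  have htors : torsionPoly W p = (torsionPoly (short A B) p).map V.subtype := by
    rw [hW, map_torsionPoly]
  have hlead : f ((torsionPoly (short A B) p).coeff (torsionDegree p)) ≠ 0 := by
    rw [coeff_torsionPoly _ hp, map_natCast, torsionLead]
    split_ifs
    · rw [show ((4 : ℕ) : κ) = 2 * 2 by norm_num]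
      exact mul_ne_zero h2 h2
    · exact hpκ
  have hroot : ∀ P ∈ s, (torsionPoly W p).eval (xCoord P) = 0 := by
    intro P hP
    obtain ⟨hPG, hP0⟩ := (hs P).mp hP
    obtain ⟨x, y, h⟩ := exists_hasCoords hP0
    rw [h.xCoord_eq]
    exact (smul_prime_eq_zero_iff hp h).mp (nsmul_eq_zero_of_card hG hPG)
  have hmem : ∀ P ∈ s, xCoord P ∈ V := fun P hP =>
    mem_of_isRoot f (natDegree_torsionPoly_le _ hp) hlead (htors ▸ hroot P hP)
  choose! ξ hξ using fun P => (fun h : P ∈ s => (⟨⟨xCoord P, hmem P h⟩, rfl⟩ :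
    ∃ v : V, (v : K) = xCoord P))
  have hsum : ∑ P ∈ s, xCoord P = ((∑ P ∈ s, ξ P : V) : K) := by
    rw [← V.subtype_apply, map_sum]
    exact Finset.sum_congr rfl fun P hP => (hξ P hP).symm
  rw [hsum]
  intro h0
  replace h0 : ∑ P ∈ s, ξ P = 0 := by exact_mod_cast h0
  have h0' : ∑ P ∈ s, f (ξ P) = 0 := by rw [← map_sum, h0, map_zero]
  have hWκ : (short A B).map f = short (-3 * a ^ 2) (2 * a ^ 3) := by rw [map_short, hfA, hfB]
  have htorsκ : (torsionPoly (short A B) p).map f = torsionPoly (short (-3 * a ^ 2) (2 * a ^ 3)) p := by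
    rw [← hWκ, map_torsionPoly]
  have hrootV : ∀ P ∈ s, (torsionPoly (short A B) p).eval (ξ P) = 0 := by
    intro P hP
    have := hroot P hP
    rw [htors, ← hξ P hP, eval_map, ← V.subtype_apply, eval₂_hom] at this
    exact V.subtype_injective (this.trans (map_zero _).symm)
  by_cases hp2 : p = 2
  · subst hp2
    obtain ⟨P, rfl⟩ := Finset.card_eq_one.mp hcard
    rw [Finset.sum_singleton] at h0
    have := hrootV P (Finset.mem_singleton_self P)
    rw [h0] at this
    have h4 : (4 * B : V) = 0 := by simpa [torsionPoly, Ψ₂Sq, b₆, short] using this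
    have h5 : 4 * (2 * a ^ 3) = 0 := by rw [← hfB, ← map_ofNat f 4, ← map_mul, h4, map_zero]
    rw [show 4 * (2 * a ^ 3) = 2 ^ 3 * a ^ 3 by ring] at h5
    exact mul_ne_zero (pow_ne_zero _ h2) (pow_ne_zero _ ha) h5
  have hodd := hp.odd_of_ne_two hp2
  by_cases hall : ∀ P ∈ s, f (ξ P) = a
  · rw [Finset.sum_congr rfl hall, Finset.sum_const, hcard, nsmul_eq_mul] at h0'
    exact mul_ne_zero hp1κ ha h0'
  · push Not at hall
    obtain ⟨P, hP, hPa⟩ := hall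
    obtain ⟨hPG, hP0⟩ := (hs P).mp hP
    have hnone : ∀ Q ∈ s, f (ξ Q) ≠ a := by
      intro Q hQ hQa
      obtain ⟨hQG, hQ0⟩ := (hs Q).mp hQ
      obtain ⟨k, rfl⟩ := exists_nsmul_eq_of_card hG hp hPG hP0 hQG
      obtain ⟨j, rfl⟩ := Nat.exists_eq_succ_of_ne_zero
        (show k ≠ 0 by rintro rfl; exact hQ0 (zero_smul _ _))
      obtain ⟨x, y, h⟩ := exists_hasCoords hP0
      have hx : ((ξ P : V) : K) = x := by rw [hξ P hP, h.xCoord_eq]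
      have hy0 : 2 * y ≠ 0 := by
        intro hy
        rw [(mul_eq_zero.mp hy).resolve_left two_ne_zero] at h
        exact two_nsmul_ne_zero hG hp hp2 hPG hP0 h.two_smul_eq_zero
      have heq := h.equation
      rw [hA, hB, ← hx] at heq
      have hyint : IsIntegral V y := by
        refine IsIntegral.of_pow two_pos ?_
        rw [heq]
        exact isIntegral_algebraMap (R := V) (A := K) (x := ξ P ^ 3 + A * ξ P + B)
      obtain ⟨η, hη⟩ := IsIntegrallyClosed.isIntegral_iff.mp hyint
      replace hη : (η : K) = y := hη
      have hηeq : η ^ 2 = ξ P ^ 3 + A * ξ P + B := by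
        rw [← hη] at heq
        exact_mod_cast heq
      have hid := divSeq_nodal_identity h6 ha (x := f (ξ P)) (y := f η) (by
        rw [← map_pow, hηeq, map_add, map_add, map_mul, map_pow, hfA, hfB]) j
      have hdK : ∀ n : ℤ, divSeq W x y n = (divSeq (short A B) (ξ P) η n : V) := fun n => by
        rw [hW, ← V.subtype_apply, ← map_divSeq, V.subtype_apply, V.subtype_apply, hx, hη]
      have hdκ : ∀ n : ℤ, divSeq (short (-3 * a ^ 2) (2 * a ^ 3)) (f (ξ P)) (f η) n =
          f (divSeq (short A B) (ξ P) η n) := fun n => by rw [← hWκ, map_divSeq]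
      obtain ⟨h₁, h₂⟩ := smul_of_divSeq h hy0 (j + 1)
      obtain ⟨u, v, hu, huv⟩ := h₁ fun h => hQ0 (h₂ h)
      rw [← hu.xCoord_eq, ← hξ _ hQ, ← hx, hx, hdK, hdK, hdK, ← hx] at huv
      have e1 : ((j + 1 : ℕ) : ℤ) + 1 = (j + 2 : ℕ) := by push_cast; ring
      have e2 : ((j + 1 : ℕ) : ℤ) - 1 = (j : ℕ) := by push_cast; ring
      rw [e1, e2] at huv
      have huv' : (ξ P - ξ ((j + 1) • P)) * divSeq (short A B) (ξ P) η (j + 1 : ℕ) ^ 2 =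
          divSeq (short A B) (ξ P) η (j + 2 : ℕ) * divSeq (short A B) (ξ P) η (j : ℕ) := by
        exact_mod_cast huv
      replace huv' := congrArg f huv'
      simp only [map_mul, map_sub, map_pow, ← hdκ] at huv'
      rw [hQa] at huv'
      rw [huv', sub_self] at hid
      exact pow_ne_zero _ (sub_ne_zero.mpr hPa) hid.symm
    have hfib := fun v hv => card_fiber_xCoord hG hp hp2 hs (ξ := ξ) (fun P hP Q hQ => by
      rw [← hξ P hP, ← hξ Q hQ, Subtype.coe_inj]) (v := v) hv
    have hdvd : ∏ v ∈ s.image ξ, (X - C v) ∣ (short A B).preΨ' p := by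
      rw [← map_dvd_map V.subtype V.subtype_injective (monic_prod_X_sub_C _ _), Polynomial.map_prod]
      refine Finset.prod_dvd_of_coprime ?_ ?_
      · intro v _ w _ hvw
        simp only [Function.onFun, Polynomial.map_sub, map_X, map_C]
        exact isCoprime_X_sub_C_of_isUnit_sub (isUnit_iff_ne_zero.mpr (sub_ne_zero.mpr
          fun h => hvw (V.subtype_injective h)))
      · intro v hv
        obtain ⟨Q, hQ, rfl⟩ := Finset.mem_image.mp hv
        have := hrootV Q hQ
        rw [torsionPoly, if_neg hp2] at this
        exact Polynomial.map_dvd _ (dvd_iff_isRoot.mpr this)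
    set S := s.image ξ
    have hcardS : 2 * S.card = p - 1 := by
      rw [← hcard, Finset.card_eq_sum_card_image ξ s, Finset.sum_congr rfl hfib, Finset.sum_const,
        smul_eq_mul, mul_comm]
    have hsumS : 2 * ∑ v ∈ S, f v = 0 := by
      rw [← h0', Finset.sum_comp f ξ, Finset.mul_sum]
      refine Finset.sum_congr rfl fun v hv => ?_
      rw [hfib v hv, two_nsmul, two_mul]
    have key := sum_roots_nodal h6 ha hp hp2 hpκ (m := S.val.map f) (by simpa using hcardS) (by
        rw [Multiset.mem_map]
        rintro ⟨v, hv, h⟩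
        obtain ⟨Q, hQ, rfl⟩ := Finset.mem_image.mp hv
        exact hnone Q hQ h) (by
        have := Polynomial.map_dvd f hdvd
        rw [← map_preΨ', hWκ, Polynomial.map_prod] at this
        refine (Eq.dvd ?_).trans this
        rw [Multiset.map_map]
        exact Finset.prod_congr rfl fun v _ => by simp)
    have hz : (S.val.map f).sum = 0 := (mul_eq_zero.mp hsumS).resolve_left h2
    rw [hz, zero_add, nsmul_eq_mul] at key
    have hch : ((p.choose 2 : ℕ) : κ) * 2 = p * (p - 1 : ℕ) := by
      rw [Nat.choose_two_right, ← Nat.cast_two (R := κ), ← Nat.cast_mul, Nat.div_mul_cancel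
        (Nat.even_mul_pred_self p).two_dvd, Nat.cast_mul]
    rcases mul_eq_zero.mp key with h | h
    · rw [h, zero_mul] at hch
      exact mul_ne_zero hpκ hp1κ hch.symm
    · exact ha h

end Reduction

section

variable {ℓ : ℕ} {A B : ℤ}

/-- `4A³ + 27B²` is divisible by `ℓ` exactly once. -/
def ExactlyDivides (ℓ : ℕ) (A B : ℤ) : Prop :=
  (ℓ : ℤ) ∣ 4 * A ^ 3 + 27 * B ^ 2 ∧ ¬ (ℓ : ℤ) ^ 2 ∣ 4 * A ^ 3 + 27 * B ^ 2

lemma ExactlyDivides.not_dvd (h : ExactlyDivides ℓ A B) (hℓ : ℓ.Prime) (h5 : 5 ≤ ℓ) :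
    ¬ (ℓ : ℤ) ∣ A := by
  intro hA
  have hp := Nat.prime_iff_prime_int.mp hℓ
  have h27 : ¬ (ℓ : ℤ) ∣ 27 := by
    intro h27
    have : (ℓ : ℤ) ∣ 3 := hp.dvd_of_dvd_pow (n := 3) (by norm_num; exact h27)
    have := Int.le_of_dvd (by norm_num) this
    omega
  have h1 : (ℓ : ℤ) ∣ 27 * B ^ 2 := by
    rw [← dvd_add_right ((dvd_pow hA three_ne_zero).mul_left 4)]
    exact h.1
  have hB := hp.dvd_of_dvd_pow ((hp.dvd_or_dvd h1).resolve_left h27)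
  exact h.2 (dvd_add ((pow_dvd_pow_of_dvd hA 2).trans ((pow_dvd_pow A (by norm_num)).mul_left 4))
    ((pow_dvd_pow_of_dvd hB 2).mul_left 27))

lemma ExactlyDivides.ne_zero (h : ExactlyDivides ℓ A B) : 4 * A ^ 3 + 27 * B ^ 2 ≠ 0 := fun h0 =>
  h.2 (h0 ▸ dvd_zero _)

lemma six_ne_zero_of_charP (κ : Type*) [Field κ] (ℓ : ℕ) [CharP κ ℓ] (hℓ : ℓ.Prime) (h5 : 5 ≤ ℓ) :
    (6 : κ) ≠ 0 := by
  rw [← Nat.cast_ofNat, Ne, CharP.cast_eq_zero_iff κ ℓ]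
  intro h
  have h1 : ℓ ∣ 2 * 3 := h
  rcases hℓ.dvd_mul.mp h1 with h1 | h1
  · have := Nat.le_of_dvd (by norm_num) h1
    omega
  · have := Nat.le_of_dvd (by norm_num) h1
    omega

/-- The node of the reduction. -/
lemma exists_node (κ : Type*) [Field κ] [CharP κ ℓ] (hℓ : ℓ.Prime) (h5 : 5 ≤ ℓ)
    (h : (ℓ : ℤ) ∣ 4 * A ^ 3 + 27 * B ^ 2) (hA : ¬ (ℓ : ℤ) ∣ A) :
    ∃ a : κ, a ≠ 0 ∧ (A : κ) = -3 * a ^ 2 ∧ (B : κ) = 2 * a ^ 3 := by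
  have h6 := six_ne_zero_of_charP κ ℓ hℓ h5
  have h2 : (2 : κ) ≠ 0 := fun h => h6 (by rw [show (6 : κ) = 2 * 3 by norm_num, h, zero_mul])
  have hA0 : (A : κ) ≠ 0 := by rwa [Ne, CharP.intCast_eq_zero_iff κ ℓ]
  have h0 : 4 * (A : κ) ^ 3 + 27 * (B : κ) ^ 2 = 0 := by
    have := (CharP.intCast_eq_zero_iff κ ℓ _).mpr h
    exact_mod_cast this
  have e1 : (A : κ) = -3 * (-3 * B / (2 * A)) ^ 2 := by
    field_simp
    linear_combination h0
  refine ⟨-3 * B / (2 * A), ?_, e1, ?_⟩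
  · intro ha
    rw [ha] at e1
    exact hA0 (by rw [e1]; ring)
  · field_simp
    linear_combination (B : κ) * h0

lemma exists_valuationSubring (K : Type*) [Field K] [CharZero K] (hℓ : ℓ.Prime) :
    ∃ V : ValuationSubring K, CharP (IsLocalRing.ResidueField V) ℓ := by
  have hI : Ideal.span {(ℓ : (Int.castRingHom K).range)} ≠ ⊤ := by
    rw [Ne, Ideal.span_singleton_eq_top]
    intro hu
    obtain ⟨⟨_, z, rfl⟩, hv⟩ := hu.exists_right_inv
    have : ((ℓ * z : ℤ) : K) = ((1 : ℤ) : K) := by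
      have := congrArg Subtype.val hv
      simpa using this
    have := Int.isUnit_iff.mp (IsUnit.of_mul_eq_one z (Int.cast_injective this))
    have := hℓ.two_le
    omega
  obtain ⟨V, -, hV⟩ := Ideal.image_subset_nonunits_valuationSubring _ hI
  have hmem : ((ℓ : V) : K) ∈ V.nonunits := by
    have := hV ⟨_, Ideal.mem_span_singleton_self _, rfl⟩
    simpa using this
  rw [ValuationSubring.coe_mem_nonunits_iff] at hmem
  have h0 : (ℓ : IsLocalRing.ResidueField V) = 0 := by
    rw [← map_natCast (IsLocalRing.residue V)]
    exact (IsLocalRing.residue_eq_zero_iff _).mpr hmem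
  refine ⟨V, ringChar.of_eq ?_⟩
  exact (hℓ.eq_one_or_self_of_dvd _ (ringChar.dvd h0)).resolve_left CharP.ringChar_ne_one

/-- The sum of the `x`-coordinates of the non-zero points of a subgroup of prime order does not
vanish if some large prime divides `4A³ + 27B²` exactly once. -/
theorem sum_xCoord_ne_zero_of_exactlyDivides {K : Type*} [Field K] [CharZero K] [DecidableEq K]
    {W : WeierstrassCurve K} [W.IsShortNF] [W.IsElliptic] (hA : W.a₄ = A) (hB : W.a₆ = B)
    (hℓ : ℓ.Prime) (h5 : 5 ≤ ℓ) (h : ExactlyDivides ℓ A B) {p : ℕ} (hp : p.Prime) (hpℓ : p < ℓ)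
    {G : AddSubgroup W.toAffine.Point} (hG : Nat.card G = p) {s : Finset W.toAffine.Point}
    (hs : ∀ P, P ∈ s ↔ P ∈ G ∧ P ≠ 0) : ∑ P ∈ s, xCoord P ≠ 0 := by
  obtain ⟨V, hV⟩ := exists_valuationSubring K hℓ
  have : CharP (AlgebraicClosure (IsLocalRing.ResidueField V)) ℓ :=
    charP_of_injective_algebraMap (algebraMap (IsLocalRing.ResidueField V) _).injective ℓ
  obtain ⟨a, ha, h₁, h₂⟩ := exists_node (AlgebraicClosure (IsLocalRing.ResidueField V)) hℓ h5 h.1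
    (h.not_dvd hℓ h5)
  have : IsLocalHom ((algebraMap (IsLocalRing.ResidueField V)
      (AlgebraicClosure (IsLocalRing.ResidueField V))).comp (IsLocalRing.residue V)) :=
    ⟨fun x hx => (IsLocalRing.residue_ne_zero_iff_isUnit x).mp fun h => hx.ne_zero (by
      rw [RingHom.comp_apply, h, map_zero])⟩
  refine sum_xCoord_ne_zero (V := V) (κ := AlgebraicClosure (IsLocalRing.ResidueField V))
    ((algebraMap _ _).comp (IsLocalRing.residue V)) (A := (A : V)) (B := (B : V))
    (by simpa using hA) (by simpa using hB) ha (by simpa using h₁) (by simpa using h₂)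
    (six_ne_zero_of_charP _ ℓ hℓ h5) hp ?_ hG hs
  rw [Ne, CharP.cast_eq_zero_iff _ ℓ]
  intro hdvd
  have := hp.two_le
  rcases hℓ.dvd_mul.mp hdvd with h | h
  · have := Nat.le_of_dvd (by omega) h
    omega
  · have := Nat.le_of_dvd (by omega) h
    omega

end

/-- `t` is a sum of `p - 1` multiples of `x`-coordinates of `p`-torsion points of `y² = x³ + Ax + B`. -/
def HasRootSum (p : ℕ) (A B t : ℤ) : Prop :=
  ∃ r : Fin (p - 1) → AlgebraicClosure ℚ,
    (∀ i, (torsionPoly (short (A : AlgebraicClosure ℚ) (B : AlgebraicClosure ℚ)) p).eval (r i) = 0) ∧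
      (t : AlgebraicClosure ℚ) = ∑ i, torsionLead p * r i

section Card

variable {F : Type*} [Field F] [CharZero F] [DecidableEq F] {W : WeierstrassCurve F} [W.IsShortNF]
  [W.IsElliptic] {p : ℕ}

lemma torsionPoly_ne_zero (hp : p.Prime) : torsionPoly W p ≠ 0 := by
  intro h
  have := coeff_torsionPoly W hp
  rw [h, coeff_zero, torsionLead] at this
  have hp0 : (p : F) ≠ 0 := Nat.cast_ne_zero.mpr hp.ne_zero
  split_ifs at this
  · norm_num at this
  · exact hp0 this.symm

/-- The `p`-torsion of an elliptic curve has less than `p³` elements. -/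
lemma card_torsion (hp : p.Prime) : {P : W.toAffine.Point | p • P = 0}.Finite ∧
    {P : W.toAffine.Point | p • P = 0}.ncard < p ^ 3 := by
  set T := {P : W.toAffine.Point | p • P = 0}
  set R : Finset F := (torsionPoly W p).roots.toFinset
  have hR : R.card ≤ torsionDegree p :=
    (Multiset.toFinset_card_le _).trans ((card_roots' _).trans (natDegree_torsionPoly_le W hp))
  have hmaps : ∀ P ∈ T \ {0}, xCoord P ∈ (R : Set F) := by
    rintro P ⟨hP, hP0⟩
    obtain ⟨x, y, h⟩ := exists_hasCoords hP0
    rw [h.xCoord_eq]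
    simpa [R, torsionPoly_ne_zero hp] using (smul_prime_eq_zero_iff hp h).mp hP
  have hfib : ∀ P ∈ T \ {0}, {Q | Q ∈ T \ {0} ∧ xCoord Q = xCoord P} ⊆ {P, -P} := by
    rintro P ⟨hP, hP0⟩ Q ⟨⟨hQ, hQ0⟩, h⟩
    exact (xCoord_eq_iff hQ0 hP0).mp h
  have hfin : (T \ {0}).Finite := by
    refine Set.Finite.of_finite_fibers xCoord
      ((Finset.finite_toSet R).subset (Set.image_subset_iff.mpr hmaps)) ?_
    rintro x ⟨P, hP, rfl⟩
    refine (Set.toFinite {P, -P}).subset fun Q hQ => hfib P hP ⟨hQ.1, hQ.2⟩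
  have hT : T = insert 0 (T \ {0}) := by
    rw [Set.insert_sdiff_singleton, Set.insert_eq_of_mem (by simp [T])]
  have hTfin : T.Finite := hT ▸ hfin.insert 0
  refine ⟨hTfin, ?_⟩
  have hcard : hfin.toFinset.card ≤ 2 * R.card := by
    refine (Finset.card_le_mul_card_image_of_maps_to (f := xCoord) (t := R) (fun P hP => ?_) 2 ?_)
    · exact hmaps P (hfin.mem_toFinset.mp hP)
    · intro x _
      by_cases he : (hfin.toFinset.filter fun Q => xCoord Q = x) = ∅
      · simp [he]
      · obtain ⟨P, hP'⟩ := Finset.nonempty_iff_ne_empty.mpr he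
        obtain ⟨hP'', rfl⟩ := Finset.mem_filter.mp hP'
        have hP := hfin.mem_toFinset.mp hP''
        refine (Finset.card_le_card (t := {P, -P}) fun Q hQ => ?_).trans Finset.card_le_two
        obtain ⟨hQ, hx⟩ := Finset.mem_filter.mp hQ
        rw [hfin.mem_toFinset] at hQ
        simpa using hfib P hP ⟨hQ, hx⟩
  have h1 : T.ncard ≤ hfin.toFinset.card + 1 := by
    rw [← Set.ncard_eq_toFinset_card _ hfin]
    nth_rewrite 1 [hT]
    exact Set.ncard_insert_le _ _
  have h2 : 2 * torsionDegree p + 1 < p ^ 3 := by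
    rw [torsionDegree]
    split_ifs with h
    · subst h
      norm_num
    · have := hp.two_le
      have : p ^ 2 < p ^ 3 := Nat.pow_lt_pow_right (by omega) (by norm_num)
      have := Nat.one_le_pow 2 p (by omega)
      omega
  omega

end Card

section Galois

instance : Algebra.IsAlgebraic ℚ (AlgebraicClosure ℚ) := by
  convert! AlgebraicClosure.isAlgebraic ℚ

instance : IsAlgClosure ℚ (AlgebraicClosure ℚ) := ⟨inferInstance, inferInstance⟩

instance : IsGalois ℚ (AlgebraicClosure ℚ) := IsAlgClosure.isGalois _ _

instance (A B : ℤ) (K : Type) [Field K] [Algebra ℚ K] : ((shortCurve A B)⁄K).IsShortNF := by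
  constructor <;> simp [shortCurve]

instance (A B : ℤ) (K : Type) [Field K] [Algebra ℚ K] [(shortCurve A B).IsElliptic] :
    ((shortCurve A B)⁄K).IsElliptic :=
  inferInstanceAs ((shortCurve A B).map (algebraMap ℚ K)).IsElliptic

lemma baseChange_shortCurve (A B : ℤ) (K : Type) [Field K] [Algebra ℚ K] :
    (shortCurve A B)⁄K = short (A : K) (B : K) := by
  ext <;> simp [shortCurve, short]

variable {A B : ℤ} {p : ℕ} [Fact p.Prime]

lemma xCoord_map {K : Type} [Field K] [Algebra ℚ K] [DecidableEq K] (E : WeierstrassCurve ℚ) (σ : K →ₐ[ℚ] K)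
    (P : (E⁄K).toAffine.Point) :
    xCoord (Affine.Point.map (W' := E.toAffine) σ P) = σ (xCoord P) := by
  cases P with
  | zero => exact (map_zero σ).symm
  | some x y h => rfl

open scoped Classical in
/-- If `E[p]` is reducible, then `E` has a Galois stable subgroup of order `p`. -/
lemma exists_stable_subgroup [(shortCurve A B).IsElliptic]
    (hirr : ¬ IsTorsionIrreducible (shortCurve A B) p)
    (hne : Nontrivial (Torsion (shortCurve A B) (AlgebraicClosure ℚ) p)) :
    ∃ G : AddSubgroup ((shortCurve A B)⁄(AlgebraicClosure ℚ)).toAffine.Point, Nat.card G = p ∧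
      ∀ (σ : AlgebraicClosure ℚ ≃ₐ[ℚ] AlgebraicClosure ℚ), ∀ P ∈ G,
        Affine.Point.map (W' := (shortCurve A B).toAffine) σ.toAlgHom P ∈ G := by
  have hp : p.Prime := Fact.out
  set M := Torsion (shortCurve A B) (AlgebraicClosure ℚ) p
  set ρ := torsionRep (shortCurve A B) (AlgebraicClosure ℚ) p
  obtain ⟨hfin, hcard⟩ := card_torsion (W := (shortCurve A B)⁄(AlgebraicClosure ℚ)) hp
  have hM : (AddSubgroup.torsionBy ((shortCurve A B)⁄(AlgebraicClosure ℚ)).toAffine.Point (p : ℤ) :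
      Set ((shortCurve A B)⁄(AlgebraicClosure ℚ)).toAffine.Point) = {P | p • P = 0} := by
    ext P
    exact AddSubgroup.torsionBy.nsmul_iff.symm
  have hfinM : Finite M := by
    change Finite (AddSubgroup.torsionBy ((shortCurve A B)⁄(AlgebraicClosure ℚ)).toAffine.Point (p : ℤ) :
      Set ((shortCurve A B)⁄(AlgebraicClosure ℚ)).toAffine.Point)
    rw [hM]
    exact hfin
  have hcardM : Nat.card M < p ^ 3 := by
    have : Nat.card M = (AddSubgroup.torsionBy ((shortCurve A B)⁄(AlgebraicClosure ℚ)).toAffine.Point (p : ℤ) :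
      Set ((shortCurve A B)⁄(AlgebraicClosure ℚ)).toAffine.Point).ncard := rfl
    rw [this, hM]
    exact hcard
  rw [Module.natCard_eq_pow_finrank (K := ZMod p), Nat.card_zmod] at hcardM
  have hrank := (Nat.pow_lt_pow_iff_right hp.one_lt).mp hcardM
  have hnt : Nontrivial (Subrepresentation ρ) := by
    refine ⟨⊥, ⊤, fun h => ?_⟩
    have := congrArg Subrepresentation.toSubmodule h
    exact bot_ne_top (α := Submodule (ZMod p) M) this
  have : ∃ w : Subrepresentation ρ, w ≠ ⊥ ∧ w ≠ ⊤ := by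
    by_contra! hcon
    exact hirr ⟨fun w => or_iff_not_imp_left.mpr (hcon w)⟩
  obtain ⟨w, hw0, hw1⟩ := this
  have hw0' : w.toSubmodule ≠ ⊥ := fun h => hw0 (Subrepresentation.toSubmodule_injective h)
  have hw1' : w.toSubmodule ≠ ⊤ := fun h => hw1 (Subrepresentation.toSubmodule_injective h)
  have hlt : Module.finrank (ZMod p) w.toSubmodule < Module.finrank (ZMod p) M :=
    Submodule.finrank_lt hw1'
  have hpos : Module.finrank (ZMod p) w.toSubmodule ≠ 0 := fun h =>
    hw0' (Submodule.finrank_eq_zero.mp h)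
  have hone : Module.finrank (ZMod p) w.toSubmodule = 1 := by omega
  have hcw : Nat.card w.toSubmodule = p := by
    rw [Module.natCard_eq_pow_finrank (K := ZMod p), Nat.card_zmod, hone, pow_one]
  refine ⟨w.toSubmodule.toAddSubgroup.map (AddSubgroup.subtype _), ?_, ?_⟩
  · refine Eq.trans ?_ hcw
    exact Nat.card_congr (AddSubgroup.equivMapOfInjective _ _
      (AddSubgroup.subtype_injective _)).symm.toEquiv
  · rintro σ _ ⟨P, hP, rfl⟩
    exact ⟨ρ σ P, w.apply_mem_toSubmodule σ hP, rfl⟩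

open scoped Classical in
/-- If `E[p]` is reducible, then there is a non-zero integer which is a sum of multiples of
`x`-coordinates of `p`-torsion points. -/
theorem exists_hasRootSum [(shortCurve A B).IsElliptic]
    (hirr : ¬ IsTorsionIrreducible (shortCurve A B) p)
    (hne : Nontrivial (Torsion (shortCurve A B) (AlgebraicClosure ℚ) p))
    {ℓ : ℕ} (hℓ : ℓ.Prime) (h5 : 5 ≤ ℓ) (h : ExactlyDivides ℓ A B) (hpℓ : p < ℓ) :
    ∃ t : ℤ, t ≠ 0 ∧ HasRootSum p A B t := by
  have hp : p.Prime := Fact.out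
  obtain ⟨G, hG, hst⟩ := exists_stable_subgroup hirr hne
  have hWs := baseChange_shortCurve A B (AlgebraicClosure ℚ)
  have hGfin : Finite G := Nat.finite_of_card_ne_zero (hG ▸ hp.ne_zero)
  set s : Finset ((shortCurve A B)⁄(AlgebraicClosure ℚ)).toAffine.Point :=
    (Set.toFinite (G : Set ((shortCurve A B)⁄(AlgebraicClosure ℚ)).toAffine.Point)).toFinset.erase 0
  have hs : ∀ P, P ∈ s ↔ P ∈ G ∧ P ≠ 0 := fun P => by simp [s, and_comm]
  have hne0 := sum_xCoord_ne_zero_of_exactlyDivides (W := (shortCurve A B)⁄(AlgebraicClosure ℚ)) (A := A) (B := B)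
    (by rw [hWs]; rfl) (by rw [hWs]; rfl) hℓ h5 h hp hpℓ hG hs
  have hroot : ∀ P ∈ s, (torsionPoly ((shortCurve A B)⁄(AlgebraicClosure ℚ)) p).eval (xCoord P) = 0 := by
    intro P hP
    obtain ⟨hPG, hP0⟩ := (hs P).mp hP
    obtain ⟨x, y, h⟩ := exists_hasCoords hP0
    rw [h.xCoord_eq]
    exact (smul_prime_eq_zero_iff hp h).mp (nsmul_eq_zero_of_card hG hPG)
  set T : (AlgebraicClosure ℚ) := ∑ P ∈ s, torsionLead p * xCoord P with hT
  have hint : IsIntegral ℤ T := by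
    refine IsIntegral.sum _ fun P hP => ?_
    have h1 := hroot P hP
    have e : torsionPoly ((shortCurve A B)⁄(AlgebraicClosure ℚ)) p =
        (torsionPoly (short A B) p).map (Int.castRingHom (AlgebraicClosure ℚ)) := by
      rw [hWs, ← map_torsionPoly, map_short]
      rfl
    rw [e, eval_map] at h1
    have h2 := RingHom.isIntegralElem_leadingCoeff_mul (Int.castRingHom (AlgebraicClosure ℚ)) _ _ h1
    have h3 : (torsionPoly (short A B) p).leadingCoeff = torsionLead p := by
      rw [leadingCoeff, ← coeff_torsionPoly (short A B) hp]
      congr 1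
      refine (natDegree_torsionPoly_le _ hp).antisymm (le_natDegree_of_ne_zero ?_)
      rw [coeff_torsionPoly (short A B) hp, torsionLead]
      split_ifs
      · norm_num
      · exact_mod_cast hp.ne_zero
    rw [h3] at h2
    rw [map_natCast] at h2
    exact h2
  have hfix : ∀ σ : (AlgebraicClosure ℚ) ≃ₐ[ℚ] (AlgebraicClosure ℚ), σ T = T := by
    intro σ
    rw [hT, map_sum]
    set φ : ((shortCurve A B)⁄(AlgebraicClosure ℚ)).toAffine.Point →+ ((shortCurve A B)⁄(AlgebraicClosure ℚ)).toAffine.Point :=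
      Affine.Point.map (W' := (shortCurve A B).toAffine) σ.toAlgHom
    have hφ : Function.Injective φ := Affine.Point.map_injective _
    have hmaps : ∀ P ∈ s, φ P ∈ s := fun P hP => (hs _).mpr ⟨hst σ P ((hs P).mp hP).1, fun h0 =>
      ((hs P).mp hP).2 (hφ (h0.trans (map_zero φ).symm))⟩
    have himg : s.image φ = s := Finset.eq_of_subset_of_card_le (Finset.image_subset_iff.mpr hmaps)
      (Finset.card_image_of_injective s hφ).ge
    nth_rewrite 2 [← himg]
    rw [Finset.sum_image hφ.injOn]
    refine Finset.sum_congr rfl fun P _ => ?_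
    rw [map_mul, map_natCast]
    exact congrArg _ (xCoord_map _ σ.toAlgHom P).symm
  have hbot : T ∈ (⊥ : IntermediateField ℚ (AlgebraicClosure ℚ)) := by
    rw [InfiniteGalois.mem_bot_iff_fixed]
    exact hfix
  obtain ⟨q, hq⟩ := IntermediateField.mem_bot.mp hbot
  have hqi : IsIntegral ℤ q := by
    rw [← hq] at hint
    exact (isIntegral_algebraMap_iff (algebraMap ℚ (AlgebraicClosure ℚ)).injective).mp hint
  obtain ⟨t, ht⟩ := IsIntegrallyClosed.isIntegral_iff.mp hqi
  have htT : (t : (AlgebraicClosure ℚ)) = T := by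
    rw [← hq, ← ht]
    simp
  refine ⟨t, ?_, ?_⟩
  · rintro rfl
    rw [Int.cast_zero, hT, ← Finset.mul_sum] at htT
    rcases mul_eq_zero.mp htT.symm with h0 | h0
    · have : torsionLead p ≠ 0 := by
        rw [torsionLead]
        split_ifs
        · norm_num
        · exact hp.ne_zero
      exact this (by exact_mod_cast h0)
    · exact hne0 h0
  · have e := (s.equivFinOfCardEq (card_nonzero hG hs)).symm
    refine ⟨fun i => xCoord (e i : ((shortCurve A B)⁄(AlgebraicClosure ℚ)).toAffine.Point), fun i => ?_, ?_⟩
    · rw [← hWs]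
      exact hroot _ (e i).2
    · rw [htT, hT, ← Finset.sum_coe_sort s]
      exact (Equiv.sum_comp e fun P : s => (torsionLead p : (AlgebraicClosure ℚ)) *
        xCoord (P : ((shortCurve A B)⁄(AlgebraicClosure ℚ)).toAffine.Point)).symm

end Galois

section Relation

variable {p : ℕ}

lemma constantCoeff_eq_zero {f : MvPolynomial (Fin 2) ℤ} {j : ℕ}
    (h : f.IsWeightedHomogeneous (![2, 3] : Fin 2 → ℕ) j) (hj : j ≠ 0) :
    MvPolynomial.constantCoeff f = 0 := by
  rw [MvPolynomial.constantCoeff_eq]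
  by_contra h0
  have := h h0
  rw [map_zero] at this
  exact hj this.symm

/-- The specialization of polynomials over `ℤ[A, B]` at integers. -/
abbrev specialize {R : Type*} [CommRing R] (A B : R) : MvPolynomial (Fin 2) ℤ →+* R :=
  MvPolynomial.eval₂Hom (Int.castRingHom R) ![A, B]

lemma leadingCoeff_torsionPoly (hp : p.Prime) {R : Type*} [CommRing R] [CharZero R] (W : WeierstrassCurve R) :
    (torsionPoly W p).natDegree = torsionDegree p ∧
    (torsionPoly W p).leadingCoeff = torsionLead p := by
  have h : (torsionPoly W p).natDegree = torsionDegree p := by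
    refine (natDegree_torsionPoly_le _ hp).antisymm (le_natDegree_of_ne_zero ?_)
    rw [coeff_torsionPoly W hp, torsionLead]
    split_ifs
    · norm_num
    · exact_mod_cast hp.ne_zero
  exact ⟨h, by rw [leadingCoeff, h, coeff_torsionPoly W hp]⟩

/-- The sums of `p - 1` roots of the `torsionPoly` satisfy an equation which degenerates to
`Xⁿ = 0` at `A = B = 0`. -/
theorem exists_relation (hp : p.Prime) : ∃ (G : (MvPolynomial (Fin 2) ℤ)[X]) (n : ℕ),
    G.map MvPolynomial.constantCoeff = X ^ n ∧
      ∀ A B t : ℤ, HasRootSum p A B t → (G.map (specialize A B)).eval t = 0 := by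
  set F := torsionPoly universalCurve p
  obtain ⟨hdeg, hlead⟩ := leadingCoeff_torsionPoly hp universalCurve
  have hd := torsionDegree_pos hp
  change F.natDegree = _ at hdeg
  change F.leadingCoeff = _ at hlead
  have hF0 : F ≠ 0 := fun h => by
    rw [h, natDegree_zero] at hdeg
    omega
  set Φ := integralNormalization F
  have hΦ : Φ.Monic := monic_integralNormalization hF0
  set I : Ideal (MvPolynomial (Fin 2) ℤ) := RingHom.ker MvPolynomial.constantCoeff
  have hΦd : Φ.natDegree = torsionDegree p := by rw [natDegree_integralNormalization, hdeg]
  have hΦI : ∀ i < torsionDegree p, Φ.coeff i ∈ I := by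
    intro i hi
    rw [integralNormalization_coeff_ne_natDegree (by rw [hdeg]; exact hi.ne)]
    refine I.mul_mem_right _ ?_
    exact constantCoeff_eq_zero ((isWeighted_torsionPoly hp).2 i (torsionDegree p - i) (by omega)) (by omega)
  set ι := {v : ℤ × ℤ × (Fin (p - 1) → AlgebraicClosure ℚ) //
    ∀ i, (torsionPoly (short (v.1 : AlgebraicClosure ℚ) (v.2.1 : AlgebraicClosure ℚ)) p).eval (v.2.2 i) = 0}
  let alg : MvPolynomial (Fin 2) ℤ →+* (ι → AlgebraicClosure ℚ) :=
    RingHom.pi fun v => specialize (v.1.1 : AlgebraicClosure ℚ) (v.1.2.1 : AlgebraicClosure ℚ)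
  let : Algebra (MvPolynomial (Fin 2) ℤ) (ι → AlgebraicClosure ℚ) := alg.toAlgebra
  let x : Fin (p - 1) → (ι → AlgebraicClosure ℚ) := fun i v => torsionLead p * v.1.2.2 i
  have hx : ∀ i, aeval (x i) Φ = 0 := by
    intro i
    funext v
    have h1 := integralNormalization_eval₂_leadingCoeff_mul (p := F) (by rw [hdeg]; exact hd)
      (specialize (v.1.1 : AlgebraicClosure ℚ) (v.1.2.1 : AlgebraicClosure ℚ)) (v.1.2.2 i)
    have h2 := v.2 i
    rw [torsionPoly_short_eq_map, eval_map] at h2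
    rw [h2, mul_zero, hlead, map_natCast] at h1
    rw [aeval_def]
    change Pi.evalRingHom _ v _ = _
    rw [hom_eval₂]
    exact h1
  let S := integralClosure (MvPolynomial (Fin 2) ℤ) (ι → AlgebraicClosure ℚ)
  let y : Fin (p - 1) → S := fun i => ⟨x i, Φ, hΦ, hx i⟩
  set J : Ideal S := I.map (algebraMap (MvPolynomial (Fin 2) ℤ) S)
  have hy : ∀ i, y i ∈ J.radical := by
    intro i
    refine ⟨torsionDegree p, ?_⟩
    have h1 : aeval (y i) Φ = 0 := by
      apply Subtype.val_injective
      change S.val (aeval (y i) Φ) = 0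
      rw [← aeval_algHom_apply]
      exact hx i
    rw [hΦ.as_sum, map_add, map_pow, aeval_X, map_sum, hΦd] at h1
    rw [eq_neg_of_add_eq_zero_left h1]
    refine J.neg_mem (J.sum_mem fun j hj => ?_)
    rw [map_mul, aeval_C]
    exact J.mul_mem_right _ (Ideal.mem_map_of_mem _ (hΦI j (Finset.mem_range.mp hj)))
  obtain ⟨N, hN⟩ := J.radical.sum_mem fun i (_ : i ∈ Finset.univ) => hy i
  replace hN : (∑ i, y i) ^ (N + 1) ∈ J := by
    rw [pow_succ]
    exact J.mul_mem_right _ hN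
  obtain ⟨P, hP, hP0, hPI⟩ := exists_monic_aeval_eq_zero_forall_mem_of_mem_map hN
  have hPX : P.map MvPolynomial.constantCoeff = X ^ P.natDegree := by
    ext i
    rw [coeff_map, coeff_X_pow]
    split_ifs with h
    · rw [h, hP.coeff_natDegree, map_one]
    · exact hPI i h
  refine ⟨expand _ (N + 1) P, (N + 1) * P.natDegree, ?_, ?_⟩
  · rw [map_expand, hPX, map_pow, expand_X, pow_mul]
  · rintro A B t ⟨r, hr, ht⟩
    let v : ι := ⟨(A, B, r), hr⟩
    have h1 : Pi.evalRingHom (fun _ : ι => AlgebraicClosure ℚ) v (S.val (aeval ((∑ i, y i) ^ (N + 1)) P)) = 0 := by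
      rw [hP0, map_zero, map_zero]
    rw [← aeval_algHom_apply, aeval_def, hom_eval₂] at h1
    have h2 : Pi.evalRingHom (fun _ : ι => AlgebraicClosure ℚ) v (S.val ((∑ i, y i) ^ (N + 1))) =
        ((t ^ (N + 1) : ℤ) : AlgebraicClosure ℚ) := by
      rw [map_pow, map_pow, map_sum, map_sum, Int.cast_pow, ht]
      rfl
    have h3 : (Pi.evalRingHom (fun _ : ι => AlgebraicClosure ℚ) v).comp
        (algebraMap (MvPolynomial (Fin 2) ℤ) (ι → AlgebraicClosure ℚ)) =
        (Int.castRingHom _).comp (specialize A B) := by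
      apply MvPolynomial.ringHom_ext
      · intro z
        simp
      · intro i
        change specialize (A : AlgebraicClosure ℚ) (B : AlgebraicClosure ℚ) (MvPolynomial.X i) = _
        fin_cases i <;> simp
    rw [h2, h3, ← eval₂_map, ← eq_intCast (Int.castRingHom (AlgebraicClosure ℚ)), eval₂_hom] at h1
    rw [map_expand, expand_eval]
    exact Int.cast_injective (α := AlgebraicClosure ℚ) (h1.trans Int.cast_zero.symm)

end Relation

section Bound

lemma abs_specialize_le {f : MvPolynomial (Fin 2) ℤ} {j : ℕ}
    (hf : f.IsWeightedHomogeneous (![2, 3] : Fin 2 → ℕ) j) : ∃ K : ℝ, 0 ≤ K ∧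
      ∀ (R : ℕ) (A B : ℤ), |A| ≤ R ^ 2 → |B| ≤ R ^ 3 → ‖specialize (A : ℂ) (B : ℂ) f‖ ≤ K * R ^ j := by
  refine ⟨∑ d ∈ f.support, |((Int.cast (f.coeff d) : ℝ))|, Finset.sum_nonneg fun _ _ => abs_nonneg _,
    fun R A B hA hB => ?_⟩
  rw [MvPolynomial.coe_eval₂Hom, MvPolynomial.eval₂_eq', Finset.sum_mul]
  refine (norm_sum_le _ _).trans (Finset.sum_le_sum fun d hd => ?_)
  have hw := hf (MvPolynomial.mem_support_iff.mp hd)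
  rw [Finsupp.weight_apply, Finsupp.sum_fintype _ _ (by simp), Fin.sum_univ_two] at hw
  simp only [smul_eq_mul, Matrix.cons_val_zero, Matrix.cons_val_one] at hw
  have hA' : |(A : ℝ)| ≤ (R : ℝ) ^ 2 := by exact_mod_cast hA
  have hB' : |(B : ℝ)| ≤ (R : ℝ) ^ 3 := by exact_mod_cast hB
  rw [norm_mul, Fin.prod_univ_two, norm_mul, norm_pow, norm_pow]
  simp only [Matrix.cons_val_zero, Matrix.cons_val_one, eq_intCast, Complex.norm_intCast]
  gcongr
  calc |(A : ℝ)| ^ d 0 * |(B : ℝ)| ^ d 1 ≤ ((R : ℝ) ^ 2) ^ d 0 * ((R : ℝ) ^ 3) ^ d 1 := by gcongr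
    _ = (R : ℝ) ^ j := by rw [← pow_mul, ← pow_mul, ← pow_add, ← hw]; congr 1; ring

lemma norm_le_of_root {d : ℕ} {c : ℕ → ℂ} {K : ℕ → ℝ} (hK : ∀ i, 0 ≤ K i) {R : ℝ} (hR : 1 ≤ R)
    (hc : ∀ i < d, ‖c i‖ ≤ K i * R ^ (d - i)) (hd : 1 ≤ ‖c d‖) {z : ℂ}
    (hz : ∑ i ∈ Finset.range (d + 1), c i * z ^ i = 0) :
    ‖z‖ ≤ (1 + ∑ i ∈ Finset.range d, K i) * R := by
  have hS : 0 ≤ ∑ i ∈ Finset.range d, K i := Finset.sum_nonneg fun i _ => hK i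
  rcases le_or_gt ‖z‖ R with h | h
  · nlinarith
  have hz0 : 0 < ‖z‖ := by linarith
  rcases Nat.eq_zero_or_pos d with rfl | hd0
  · simp only [zero_add, Finset.sum_range_one, pow_zero, mul_one] at hz
    rw [hz, norm_zero] at hd
    linarith
  rw [Finset.sum_range_succ, add_comm] at hz
  have h1 : ‖c d * z ^ d‖ ≤ ∑ i ∈ Finset.range d, K i * R * ‖z‖ ^ (d - 1) := by
    rw [eq_neg_of_add_eq_zero_left hz, norm_neg]
    refine (norm_sum_le _ _).trans (Finset.sum_le_sum fun i hi => ?_)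
    have hi := Finset.mem_range.mp hi
    rw [norm_mul, norm_pow]
    calc ‖c i‖ * ‖z‖ ^ i ≤ K i * R ^ (d - i) * ‖z‖ ^ i := by gcongr; exact hc i hi
      _ = K i * R * (R ^ (d - 1 - i) * ‖z‖ ^ i) := by
        rw [show d - i = (d - 1 - i) + 1 by omega, pow_succ]
        ring
      _ ≤ K i * R * (‖z‖ ^ (d - 1 - i) * ‖z‖ ^ i) := by
        have := hK i
        gcongr
      _ = _ := by rw [← pow_add, Nat.sub_add_cancel (by omega)]
  rw [← Finset.sum_mul, ← Finset.sum_mul, norm_mul, norm_pow,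
    show ‖z‖ ^ d = ‖z‖ * ‖z‖ ^ (d - 1) by rw [← pow_succ', Nat.sub_add_cancel hd0], ← mul_assoc] at h1
  have h2 := le_of_mul_le_mul_right h1 (by positivity)
  nlinarith

variable {p : ℕ}

/-- The sums of roots of the `torsionPoly` are bounded in terms of the height. -/
theorem exists_abs_rootSum_le (hp : p.Prime) : ∃ C : ℕ, ∀ (R : ℕ) (A B t : ℤ), 1 ≤ R →
    |A| ≤ R ^ 2 → |B| ≤ R ^ 3 → HasRootSum p A B t → |t| ≤ C * R := by
  have hW := isWeighted_torsionPoly hp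
  choose! K hK0 hK using fun i (hi : i ≤ torsionDegree p) =>
    abs_specialize_le (hW.2 i (torsionDegree p - i) (by omega))
  obtain ⟨C, hC⟩ := exists_nat_ge ((p - 1 : ℕ) * (torsionLead p *
    (1 + ∑ i ∈ Finset.range (torsionDegree p), |K i|)))
  refine ⟨C, fun R A B t hR hA hB ⟨r, hr, ht⟩ => ?_⟩
  let φ : AlgebraicClosure ℚ →ₐ[ℚ] ℂ := IsAlgClosed.lift
  have hlead : 1 ≤ torsionLead p := by
    rw [torsionLead]
    split_ifs
    · norm_num
    · exact hp.one_le
  have hroot : ∀ i, ‖φ (r i)‖ ≤ (1 + ∑ i ∈ Finset.range (torsionDegree p), |K i|) * R := by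
    intro i
    have h1 : (torsionPoly (short (A : ℂ) (B : ℂ)) p).eval (φ (r i)) = 0 := by
      have e : short (A : ℂ) (B : ℂ) = (short (A : AlgebraicClosure ℚ)
          (B : AlgebraicClosure ℚ)).map (φ : AlgebraicClosure ℚ →+* ℂ) := by
        rw [map_short]
        simp
      rw [e, map_torsionPoly, eval_map]
      exact (eval₂_hom (φ : AlgebraicClosure ℚ →+* ℂ) (r i)).trans (by rw [hr i, map_zero])
    rw [eval_eq_sum_range' (Nat.lt_succ_of_le (natDegree_torsionPoly_le _ hp))] at h1
    refine norm_le_of_root (fun i => abs_nonneg (K i)) (by exact_mod_cast hR) (fun i hi => ?_) ?_ h1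
    · rw [torsionPoly_short_eq_map, coeff_map]
      exact (hK i hi.le R A B hA hB).trans (by gcongr; exact le_abs_self _)
    · rw [coeff_torsionPoly _ hp, Complex.norm_natCast]
      exact_mod_cast hlead
  have h2 : ((|t| : ℤ) : ℝ) ≤ C * R := by
    rw [Int.cast_abs, ← Complex.norm_intCast, ← map_intCast φ t, ht, map_sum]
    calc ‖∑ i, φ (torsionLead p * r i)‖ ≤ ∑ i : Fin (p - 1), (torsionLead p : ℝ) *
          ((1 + ∑ i ∈ Finset.range (torsionDegree p), |K i|) * R) := by
          refine (norm_sum_le _ _).trans (Finset.sum_le_sum fun i _ => ?_)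
          rw [map_mul, map_natCast, norm_mul, Complex.norm_natCast]
          gcongr
          exact hroot i
      _ = ((p - 1 : ℕ) * (torsionLead p * (1 + ∑ i ∈ Finset.range (torsionDegree p), |K i|))) * R := by
          rw [Finset.sum_const, Finset.card_univ, Fintype.card_fin, nsmul_eq_mul]
          ring
      _ ≤ C * R := by gcongr
  exact_mod_cast h2

end Bound

section Count

/-- The box of pairs `(A, B)` with `|A| ≤ R²` and `|B| ≤ R³`. -/
def box (R : ℕ) : Finset (ℤ × ℤ) :=
  Finset.Icc (-(R : ℤ) ^ 2) (R ^ 2) ×ˢ Finset.Icc (-(R : ℤ) ^ 3) (R ^ 3)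

lemma mem_box {R : ℕ} {c : ℤ × ℤ} : c ∈ box R ↔ |c.1| ≤ R ^ 2 ∧ |c.2| ≤ R ^ 3 := by
  rw [box, Finset.mem_product, Finset.mem_Icc, Finset.mem_Icc, abs_le, abs_le]

lemma card_zeros_le {g : MvPolynomial (Fin 2) ℤ} (hg : g ≠ 0) {S T : Finset ℤ} (hS : S.Nonempty)
    (hT : T.Nonempty) :
    ((S ×ˢ T).filter fun c => specialize c.1 c.2 g = 0).card ≤ g.totalDegree * (S.card + T.card) := by
  classical
  have h := MvPolynomial.schwartz_zippel_sum_degreeOf hg ![S, T]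
  set Z := (Fintype.piFinset ![S, T]).filter fun x => MvPolynomial.eval x g = 0
  have h1 : ((S ×ˢ T).filter fun c => specialize c.1 c.2 g = 0).card ≤ Z.card := by
    refine Finset.card_le_card_of_injOn (fun c => ![c.1, c.2]) ?_ ?_
    · rintro ⟨a, b⟩ hab
      simp only [Finset.coe_filter, Finset.mem_product, Set.mem_ofPred_eq] at hab
      simp only [Z, Finset.coe_filter, Fintype.mem_piFinset, Set.mem_ofPred_eq]
      refine ⟨fun i => by fin_cases i <;> simp [hab.1.1, hab.1.2], hab.2⟩
    · rintro ⟨a, b⟩ _ ⟨a', b'⟩ _ h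
      have h0 := congrFun h 0
      have h1 := congrFun h 1
      simp at h0 h1
      rw [h0, h1]
  refine h1.trans ?_
  have hs : (0 : ℚ≥0) < S.card := by exact_mod_cast hS.card_pos
  have ht : (0 : ℚ≥0) < T.card := by exact_mod_cast hT.card_pos
  simp only [Fin.prod_univ_two, Fin.sum_univ_two, Matrix.cons_val_zero, Matrix.cons_val_one] at h
  rw [div_le_iff₀ (by positivity)] at h
  have h2 : (Z.card : ℚ≥0) ≤ (g.degreeOf 0 * T.card + g.degreeOf 1 * S.card : ℕ) := by
    refine h.trans (le_of_eq ?_)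
    push_cast
    field_simp
  have h3 : Z.card ≤ g.degreeOf 0 * T.card + g.degreeOf 1 * S.card := by exact_mod_cast h2
  have d0 := MvPolynomial.degreeOf_le_totalDegree g 0
  have d1 := MvPolynomial.degreeOf_le_totalDegree g 1
  nlinarith

open scoped Classical in
/-- Few curves have a non-zero root sum. -/
theorem exists_card_rootSum_le {p : ℕ} (hp : p.Prime) : ∃ C : ℕ, ∀ R : ℕ, 1 ≤ R →
    ((box R).filter fun c => ∃ t, t ≠ 0 ∧ HasRootSum p c.1 c.2 t).card ≤ C * R ^ 4 := by
  obtain ⟨G, n, hG, hrel⟩ := exists_relation hp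
  obtain ⟨C, hC⟩ := exists_abs_rootSum_le hp
  set D := ∑ k ∈ Finset.range (G.natDegree + 1), (G.coeff k).totalDegree
  have hdeg : ∀ t : ℤ, (G.eval (MvPolynomial.C t)).totalDegree ≤ D := by
    intro t
    rw [eval_eq_sum_range]
    refine MvPolynomial.totalDegree_finsetSum_le fun k hk => ?_
    refine (MvPolynomial.totalDegree_mul _ _).trans ?_
    rw [← map_pow, MvPolynomial.totalDegree_C, add_zero]
    exact Finset.single_le_sum (f := fun k => (G.coeff k).totalDegree) (fun _ _ => Nat.zero_le _) hk
  have hne : ∀ t : ℤ, t ≠ 0 → G.eval (MvPolynomial.C t) ≠ 0 := by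
    intro t ht h
    have h1 := congrArg (eval t) hG
    rw [eval_map, eval_pow, eval_X] at h1
    have h2 := eval₂_hom (p := G) MvPolynomial.constantCoeff (MvPolynomial.C t)
    rw [MvPolynomial.constantCoeff_C, h1, h, map_zero] at h2
    exact pow_ne_zero _ ht h2
  refine ⟨(2 * C + 1) * (D * 6), fun R hR => ?_⟩
  have hsub : ((box R).filter fun c => ∃ t, t ≠ 0 ∧ HasRootSum p c.1 c.2 t) ⊆
      ((Finset.Icc (-(C * R : ℤ)) (C * R)).erase 0).biUnion fun t =>
        (box R).filter fun c => specialize c.1 c.2 (G.eval (MvPolynomial.C t)) = 0 := by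
    intro c hc
    obtain ⟨hcb, t, ht, hr⟩ := Finset.mem_filter.mp hc
    have hb := mem_box.mp hcb
    rw [Finset.mem_biUnion]
    refine ⟨t, ?_, Finset.mem_filter.mpr ⟨hcb, ?_⟩⟩
    · rw [Finset.mem_erase, Finset.mem_Icc, ← abs_le]
      exact ⟨ht, hC R c.1 c.2 t hR hb.1 hb.2 hr⟩
    · rw [← eval₂_hom, ← eval_map]
      simpa using hrel c.1 c.2 t hr
  refine (Finset.card_le_card hsub).trans ?_
  have hcount : ∀ t ∈ (Finset.Icc (-(C * R : ℤ)) (C * R)).erase 0,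
      ((box R).filter fun c => specialize c.1 c.2 (G.eval (MvPolynomial.C t)) = 0).card ≤
        D * (6 * R ^ 3) := by
    intro t ht
    refine (card_zeros_le (hne t (Finset.ne_of_mem_erase ht)) ?_ ?_).trans ?_
    · exact ⟨0, by simp⟩
    · exact ⟨0, by simp⟩
    · refine Nat.mul_le_mul (hdeg t) ?_
      rw [Int.card_Icc, Int.card_Icc]
      have h2 : R ^ 2 ≤ R ^ 3 := Nat.pow_le_pow_right hR (by norm_num)
      have h1 : 1 ≤ R ^ 3 := Nat.one_le_pow _ _ hR
      have e1 : ((R : ℤ) ^ 2 + 1 - -(R : ℤ) ^ 2).toNat = 2 * R ^ 2 + 1 := by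
        rw [show ((R : ℤ) ^ 2 + 1 - -(R : ℤ) ^ 2) = (2 * R ^ 2 + 1 : ℕ) by push_cast; ring,
          Int.toNat_natCast]
      have e2 : ((R : ℤ) ^ 3 + 1 - -(R : ℤ) ^ 3).toNat = 2 * R ^ 3 + 1 := by
        rw [show ((R : ℤ) ^ 3 + 1 - -(R : ℤ) ^ 3) = (2 * R ^ 3 + 1 : ℕ) by push_cast; ring,
          Int.toNat_natCast]
      rw [e1, e2]
      omega
  refine (Finset.card_biUnion_le_card_mul _ _ _ hcount).trans ?_
  have hcard : ((Finset.Icc (-(C * R : ℤ)) (C * R)).erase 0).card ≤ (2 * C + 1) * R := by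
    refine (Finset.card_erase_le).trans ?_
    rw [Int.card_Icc, show ((C * R : ℤ) + 1 - -(C * R : ℤ)) = (2 * (C * R) + 1 : ℕ) by
      push_cast; ring, Int.toNat_natCast]
    nlinarith
  calc _ ≤ (2 * C + 1) * R * (D * (6 * R ^ 3)) := Nat.mul_le_mul_right _ hcard
    _ = _ := by ring

end Count

open NumberField

open scoped Pointwise

section Inertia

/-- The ring of all algebraic integers. -/
abbrev AlgInt : Subalgebra ℤ (AlgebraicClosure ℚ) := integralClosure ℤ (AlgebraicClosure ℚ)

/-- The absolute Galois group of `ℚ`. -/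
abbrev AbsGal : Type := AlgebraicClosure ℚ ≃ₐ[ℚ] AlgebraicClosure ℚ

set_option synthInstance.maxHeartbeats 200000 in
/-- An automorphism which acts trivially modulo `𝔏` on the integers fixed by a closed normal subgroup
can be modified by an element of this subgroup so as to lie in the inertia group of `𝔏`. -/
theorem exists_mul_mem_inertia (N : Subgroup AbsGal) [N.Normal] (hN : IsClosed (N : Set AbsGal))
    (𝔏 : Ideal AlgInt) [𝔏.IsPrime] (τ : AbsGal)
    (hτ : ∀ x : AlgInt, (∀ n ∈ N, n • x = x) → τ • x - x ∈ 𝔏) :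
    ∃ n ∈ N, n * τ ∈ 𝔏.inertia AbsGal := by
  let A := FixedPoints.subalgebra ℤ AlgInt N
  have hA : ∀ x : AlgInt, x ∈ A ↔ ∀ n ∈ N, n • x = x := fun x =>
    ⟨fun h n hn => h ⟨n, hn⟩, fun h n => h n.1 n.2⟩
  have hinv : Algebra.IsInvariant A AlgInt N := ⟨fun b hb => ⟨⟨b, hb⟩, rfl⟩⟩
  have hcomm : SMulCommClass N A AlgInt := ⟨fun n a b => by
    rw [Algebra.smul_def, Algebra.smul_def, smul_mul']
    congr 1
    exact a.2 n⟩
  have hcpt : CompactSpace N := isCompact_iff_compactSpace.mp hN.isCompact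
  let : TopologicalSpace AlgInt := ⊥
  have hdisc : DiscreteTopology AlgInt := ⟨rfl⟩
  have hcont : ContinuousSMul N AlgInt := by
    rw [continuousSMul_iff_stabilizer_isOpen]
    intro x
    have := (stabilizer_isOpen_of_isIntegral (K := ℚ) (L := AlgebraicClosure ℚ)
      (x : AlgebraicClosure ℚ)).preimage (continuous_subtype_val (p := (· ∈ N)))
    convert this using 1
    ext n
    simp only [SetLike.mem_coe, MulAction.mem_stabilizer_iff, Set.mem_preimage]
    exact ⟨fun h => congrArg Subtype.val h, fun h => Subtype.ext h⟩
  have hstab : ∀ (σ : AbsGal) (x : AlgInt), x ∈ A → σ • x ∈ A := by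
    intro σ x hx
    rw [hA] at hx ⊢
    intro n hn
    have h1 := hx (σ⁻¹ * n * σ) (by
      have := ‹N.Normal›.conj_mem n hn σ⁻¹
      simpa using this)
    rw [mul_smul, mul_smul, inv_smul_eq_iff] at h1
    exact h1
  have hunder : (τ • 𝔏).under A = 𝔏.under A := by
    ext x
    rw [Ideal.under_def, Ideal.under_def, Ideal.mem_comap, Ideal.mem_comap,
      Ideal.mem_pointwise_smul_iff_inv_smul_mem]
    have hy := hstab τ⁻¹ _ x.2
    have h1 := hτ (τ⁻¹ • (x : AlgInt)) ((hA _).mp hy)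
    rw [smul_inv_smul] at h1
    change τ⁻¹ • (x : AlgInt) ∈ 𝔏 ↔ (x : AlgInt) ∈ 𝔏
    constructor
    · intro h
      have := 𝔏.add_mem h1 h
      rwa [sub_add_cancel] at this
    · intro h
      have := 𝔏.sub_mem h h1
      rwa [sub_sub_cancel] at this
  obtain ⟨n, hn⟩ := Algebra.IsInvariant.exists_smul_of_under_eq_of_profinite (A := A) (G := N)
    (τ • 𝔏) 𝔏 hunder
  set σ : AbsGal := n * τ with hσ
  have hσ𝔏 : σ • 𝔏 = 𝔏 := by
    rw [hσ, mul_smul]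
    exact hn.symm
  have hσA : ∀ x ∈ A, σ • x - x ∈ 𝔏 := by
    intro x hx
    have h1 : (n : AbsGal) • τ • x = τ • x := (hA _).mp (hstab τ x hx) n n.2
    rw [hσ, mul_smul, h1]
    exact hτ x ((hA x).mp hx)
  set p := 𝔏.under A
  have hlies : 𝔏.LiesOver p := ⟨rfl⟩
  let e : (AlgInt ⧸ 𝔏) ≃+* (AlgInt ⧸ 𝔏) :=
    Ideal.quotientEquiv 𝔏 𝔏 (MulSemiringAction.toRingEquiv AbsGal AlgInt σ) hσ𝔏.symm
  let e' : (AlgInt ⧸ 𝔏) ≃ₐ[A ⧸ p] (AlgInt ⧸ 𝔏) := AlgEquiv.ofRingEquiv (f := e) (by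
    intro r
    obtain ⟨r, rfl⟩ := Ideal.Quotient.mk_surjective r
    change Ideal.Quotient.mk 𝔏 (σ • (r : AlgInt)) = Ideal.Quotient.mk 𝔏 (r : AlgInt)
    rw [Ideal.Quotient.mk_eq_mk_iff_sub_mem]
    exact hσA r r.2)
  obtain ⟨m, hm⟩ := Ideal.Quotient.stabilizerHom_surjective_of_profinite (G := N) p 𝔏 e'
  refine ⟨(m.1 : AbsGal)⁻¹ * n, N.mul_mem (N.inv_mem m.1.2) n.2, ?_⟩
  rw [AddSubgroup.mem_inertia]
  intro x
  have h1 := DFunLike.congr_fun hm (Ideal.Quotient.mk 𝔏 x)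
  replace h1 : Ideal.Quotient.mk 𝔏 ((m.1 : AbsGal) • x) = Ideal.Quotient.mk 𝔏 (σ • x) := h1
  rw [Ideal.Quotient.mk_eq_mk_iff_sub_mem] at h1
  have hm𝔏 : (m.1 : AbsGal) • 𝔏 = 𝔏 := m.2
  change ((m.1 : AbsGal)⁻¹ * n * τ) • x - x ∈ 𝔏
  rw [mul_assoc, ← hσ, mul_smul]
  have h2 : (m.1 : AbsGal) • ((m.1 : AbsGal)⁻¹ • σ • x - x) ∈ (m.1 : AbsGal) • 𝔏 := by
    rw [smul_sub, smul_inv_smul, hm𝔏]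
    have := 𝔏.neg_mem h1
    rwa [neg_sub] at this
  exact (Ideal.smul_mem_pointwise_smul_iff).mp h2

variable {L : Type} [Field L] [NumberField L] [IsGalois ℚ L] [Algebra L (AlgebraicClosure ℚ)]

/-- The inclusion of the integers of a number field into all algebraic integers. -/
def intHom (L : Type) [Field L] [Algebra L (AlgebraicClosure ℚ)] : 𝓞 L →+* AlgInt :=
  RingHom.codRestrict ((algebraMap L (AlgebraicClosure ℚ)).comp (algebraMap (𝓞 L) L)) AlgInt.toSubring
    fun x => (x.isIntegral_coe).map ((algebraMap L (AlgebraicClosure ℚ)).toIntAlgHom)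

lemma natCast_notMem_sq_of_inertia_eq_bot {ℓ : ℕ} (hℓ : ℓ.Prime) (P : Ideal (𝓞 L)) [P.IsPrime]
    [P.LiesOver (Ideal.span {(ℓ : ℤ)})] (h : P.inertia (L ≃ₐ[ℚ] L) = ⊥) : (ℓ : 𝓞 L) ∉ P ^ 2 := by
  have hp : (Ideal.span {(ℓ : ℤ)}).IsPrime :=
    (Ideal.span_singleton_prime (Int.natCast_ne_zero.mpr hℓ.ne_zero)).mpr
      (Nat.prime_iff_prime_int.mp hℓ)
  have h1 := Ideal.card_inertia_eq_ramificationIdxIn (G := L ≃ₐ[ℚ] L) (Ideal.span {(ℓ : ℤ)}) P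
  have hne : Ideal.map (algebraMap ℤ (𝓞 L)) (Ideal.span {(ℓ : ℤ)}) ≠ ⊥ := by
    rw [Ideal.map_span, Set.image_singleton, Ne, Ideal.span_singleton_eq_bot]
    simpa using hℓ.ne_zero
  rw [h, Ideal.ramificationIdxIn_eq_ramificationIdx _ P (L ≃ₐ[ℚ] L), Subgroup.card_bot,
    Ideal.IsDedekindDomain.ramificationIdx_eq_multiplicity (Ideal.span {(ℓ : ℤ)}) P hne] at h1
  intro hmem
  have hdvd : P ^ 2 ∣ Ideal.map (algebraMap ℤ (𝓞 L)) (Ideal.span {(ℓ : ℤ)}) := by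
    rw [Ideal.dvd_iff_le, Ideal.map_span, Set.image_singleton, Ideal.span_singleton_le_iff_mem]
    simpa using hmem
  have hfin : FiniteMultiplicity P (Ideal.map (algebraMap ℤ (𝓞 L)) (Ideal.span {(ℓ : ℤ)})) :=
    FiniteMultiplicity.of_not_isUnit (fun hu => ‹P.IsPrime›.ne_top (Ideal.isUnit_iff.mp hu)) hne
  have := hfin.le_multiplicity_of_pow_dvd hdvd
  omega

/-- If the inertia group of `𝔏` acts trivially on `L`, then `ℓ` is unramified in `L`. -/
theorem natCast_notMem_sq {ℓ : ℕ} (hℓ : ℓ.Prime) (𝔏 : Ideal AlgInt) [𝔏.IsPrime]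
    [𝔏.LiesOver (Ideal.span {(ℓ : ℤ)})]
    (h : ∀ σ ∈ 𝔏.inertia AbsGal, ∀ z : L, σ (algebraMap L _ z) = algebraMap L _ z) :
    (ℓ : 𝓞 L) ∉ (𝔏.comap (intHom L)) ^ 2 := by
  set P := 𝔏.comap (intHom L)
  have hover : P.LiesOver (Ideal.span {(ℓ : ℤ)}) := by
    constructor
    rw [Ideal.over_def 𝔏 (Ideal.span {(ℓ : ℤ)}), Ideal.under_def, Ideal.under_def, Ideal.comap_comap]
    congr 1
    exact RingHom.ext_int _ _
  refine natCast_notMem_sq_of_inertia_eq_bot hℓ P (eq_bot_iff.mpr fun τ hτ => ?_)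
  rw [Subgroup.mem_bot]
  have hτ' : ∀ x : 𝓞 L, τ • x - x ∈ P := AddSubgroup.mem_inertia.mp hτ
  let N : Subgroup AbsGal := (AlgEquiv.restrictNormalHom (F := ℚ) (K₁ := AlgebraicClosure ℚ) L).ker
  have hN : ∀ σ : AbsGal, σ ∈ N ↔ ∀ z : L, σ (algebraMap L _ z) = algebraMap L _ z := by
    intro σ
    rw [MonoidHom.mem_ker]
    constructor
    · intro hσ z
      have := AlgEquiv.restrictNormal_commutes σ L z
      change algebraMap L _ (AlgEquiv.restrictNormalHom L σ z) = _ at this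
      rw [hσ] at this
      exact this.symm
    · intro hσ
      ext z
      apply (algebraMap L (AlgebraicClosure ℚ)).injective
      exact (AlgEquiv.restrictNormal_commutes σ L z).trans (hσ z)
  let j : L →ₐ[ℚ] AlgebraicClosure ℚ := IsScalarTower.toAlgHom ℚ L (AlgebraicClosure ℚ)
  have hNfix : N = j.fieldRange.fixingSubgroup := by
    ext σ
    rw [hN, IntermediateField.mem_fixingSubgroup_iff]
    constructor
    · rintro hσ _ ⟨z, rfl⟩
      exact hσ z
    · intro hσ z
      exact hσ _ ⟨z, rfl⟩
  have hfd : FiniteDimensional ℚ j.fieldRange :=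
    j.toLinearMap.finiteDimensional_range
  have hclosed : IsClosed (N : Set AbsGal) := by
    rw [hNfix]
    exact IntermediateField.fixingSubgroup_isClosed _
  obtain ⟨σ, rfl⟩ := AlgEquiv.restrictNormalHom_surjective (F := ℚ) (K₁ := L) (AlgebraicClosure ℚ) τ
  have hσ : ∀ z : L, algebraMap L _ (AlgEquiv.restrictNormalHom L σ z) = σ (algebraMap L _ z) :=
    AlgEquiv.restrictNormal_commutes σ L
  obtain ⟨n, hn, hnσ⟩ := exists_mul_mem_inertia N hclosed 𝔏 σ (by
    intro x hx
    have hx' : (x : AlgebraicClosure ℚ) ∈ IntermediateField.fixedField j.fieldRange.fixingSubgroup := by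
      rintro ⟨m, hm⟩
      rw [← hNfix] at hm
      exact congrArg Subtype.val (hx m hm)
    rw [InfiniteGalois.fixedField_fixingSubgroup] at hx'
    obtain ⟨z, hz⟩ := hx'
    replace hz : algebraMap L (AlgebraicClosure ℚ) z = x := hz
    have hzint : IsIntegral ℤ z := by
      have h1 : IsIntegral ℤ (algebraMap L (AlgebraicClosure ℚ) z) := hz ▸ x.2
      exact (isIntegral_algebraMap_iff (algebraMap L (AlgebraicClosure ℚ)).injective).mp h1
    let z' : 𝓞 L := ⟨z, hzint⟩
    have h2 := hτ' z'
    have h3 : intHom L (AlgEquiv.restrictNormalHom L σ • z' - z') =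
        σ • x - x := by
      apply Subtype.ext
      rw [map_sub]
      change algebraMap L _ (AlgEquiv.restrictNormalHom L σ z) - algebraMap L _ z = σ x - x
      rw [hσ, hz]
    rw [← h3]
    exact h2)
  have h4 := h _ hnσ
  ext z
  apply (algebraMap L (AlgebraicClosure ℚ)).injective
  rw [hσ]
  have h5 : n (σ (algebraMap L _ z)) = algebraMap L _ z := h4 z
  rw [← hσ, (hN n).mp hn, hσ] at h5
  exact h5

end Inertia

section Ramification

variable {ℓ : ℕ} {A B : ℤ} {p : ℕ}

/-- An integral approximation of the node of the reduction. -/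
lemma exists_int_node (hℓ : ℓ.Prime) (h5 : 5 ≤ ℓ) (h : ExactlyDivides ℓ A B) (hp : p.Prime) :
    ∃ a : ℤ, (ℓ : ℤ) ∣ a ^ 3 + A * a + B ∧ ¬ (ℓ : ℤ) ^ 2 ∣ a ^ 3 + A * a + B ∧
      (ℓ : ℤ) ∣ 3 * a ^ 2 + A ∧ (ℓ : ℤ) ∣ (torsionPoly (short A B) p).eval a := by
  have hA := h.not_dvd hℓ h5
  have hℓ' := Nat.prime_iff_prime_int.mp hℓ
  have h2 : ¬ (ℓ : ℤ) ∣ 2 := fun h2 => by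
    have := Int.le_of_dvd (by norm_num) h2
    omega
  have hc2 : IsCoprime (2 : ℤ) ℓ := ((Prime.coprime_iff_not_dvd hℓ').mpr h2).symm
  have hcA : IsCoprime A ℓ := ((Prime.coprime_iff_not_dvd hℓ').mpr hA).symm
  have hcop : IsCoprime (2 * A) ((ℓ : ℤ) ^ 2) := (hc2.mul_left hcA).pow_right
  have hB : IsCoprime ((ℓ : ℤ) ^ 2) B := by
    refine IsCoprime.pow_left ((Prime.coprime_iff_not_dvd hℓ').mpr fun hB => ?_)
    have h1 : (ℓ : ℤ) ∣ 4 * A ^ 3 := by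
      rw [← dvd_add_left ((dvd_pow hB two_ne_zero).mul_left 27)]
      exact h.1
    rcases hℓ'.dvd_or_dvd h1 with h1 | h1
    · exact h2 (hℓ'.dvd_of_dvd_pow (n := 2) (by norm_num; exact h1))
    · exact hA (hℓ'.dvd_of_dvd_pow h1)
  obtain ⟨u, v, huv⟩ := hcop
  obtain ⟨a, ha⟩ : ∃ a, a = -3 * B * u := ⟨_, rfl⟩
  obtain ⟨w, hw⟩ : ∃ w, w = 3 * B * v := ⟨_, rfl⟩
  have e : 2 * A * a = -3 * B + ℓ ^ 2 * w := by
    rw [ha, hw]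
    linear_combination (-3 * B) * huv
  have e1 : (2 * A) ^ 3 * (a ^ 3 + A * a + B) = -B * (4 * A ^ 3 + 27 * B ^ 2) +
      ℓ ^ 2 * (w * ((2 * A * a) ^ 2 + (2 * A * a) * (-3 * B) + 9 * B ^ 2 + 4 * A ^ 3)) := by
    linear_combination ((2 * A * a) ^ 2 + (2 * A * a) * (-3 * B) + 9 * B ^ 2 + 4 * A ^ 3) * e
  have e2 : (2 * A) ^ 2 * (3 * a ^ 2 + A) = 4 * A ^ 3 + 27 * B ^ 2 +
      ℓ ^ 2 * (3 * w * (2 * A * a - 3 * B)) := by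
    linear_combination 3 * (2 * A * a - 3 * B) * e
  have hc1 : IsCoprime (ℓ : ℤ) (2 * A) := (hc2.mul_left hcA).symm
  have hself : (ℓ : ℤ) ∣ (ℓ : ℤ) ^ 2 := dvd_pow_self _ two_ne_zero
  refine ⟨a, ?_, fun hdvd => h.2 ?_, ?_, ?_⟩
  · refine (hc1.pow_right (n := 3)).dvd_of_dvd_mul_left ?_
    rw [e1]
    exact dvd_add (h.1.mul_left _) (hself.mul_right _)
  · refine hB.dvd_of_dvd_mul_left ?_
    have h1 : (ℓ : ℤ) ^ 2 ∣ (2 * A) ^ 3 * (a ^ 3 + A * a + B) := hdvd.mul_left _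
    rw [e1, dvd_add_left (dvd_mul_right _ _), neg_mul, dvd_neg] at h1
    exact h1
  · refine (hc1.pow_right (n := 2)).dvd_of_dvd_mul_left ?_
    rw [e2]
    exact dvd_add h.1 (hself.mul_right _)
  · have : Fact ℓ.Prime := ⟨hℓ⟩
    suffices key : ∀ (κ : Type) [Field κ] [IsAlgClosed κ] [CharP κ ℓ],
        (ℓ : ℤ) ∣ (torsionPoly (short A B) p).eval a by
      have hchar : CharP (AlgebraicClosure (ZMod ℓ)) ℓ :=
        charP_of_injective_algebraMap (algebraMap (ZMod ℓ) (AlgebraicClosure (ZMod ℓ))).injective ℓ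
      exact key (AlgebraicClosure (ZMod ℓ))
    intro κ _ _ _
    obtain ⟨b, hb, h₁, h₂⟩ := exists_node κ hℓ h5 h.1 hA
    have h6 := six_ne_zero_of_charP κ ℓ hℓ h5
    have hab : (a : κ) = b := by
      have e' := congrArg (Int.cast : ℤ → κ) e
      push_cast at e'
      rw [CharP.cast_eq_zero κ ℓ, h₁, h₂] at e'
      refine mul_left_cancel₀ (mul_ne_zero h6 (pow_ne_zero 2 hb)) ?_
      linear_combination -e'
    have h0 := eval_torsionPoly_nodal h6 hb hp
    rw [← h₁, ← h₂, ← hab] at h0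
    have hm : torsionPoly (short (A : κ) (B : κ)) p =
        (torsionPoly (short A B) p).map (Int.castRingHom κ) := by
      rw [← map_torsionPoly, map_short]
      rfl
    rw [hm, eval_intCast_map] at h0
    exact (CharP.intCast_eq_zero_iff κ ℓ _).mp h0

lemma isIntegral_sq_mul_root (hp : p.Prime) {r : AlgebraicClosure ℚ}
    (hr : (torsionPoly (short (A : AlgebraicClosure ℚ) (B : AlgebraicClosure ℚ)) p).eval r = 0) :
    _root_.IsIntegral ℤ ((p : AlgebraicClosure ℚ) ^ 2 * r) := by
  have e : torsionPoly (short (A : AlgebraicClosure ℚ) (B : AlgebraicClosure ℚ)) p =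
      (torsionPoly (short A B) p).map (Int.castRingHom (AlgebraicClosure ℚ)) := by
    rw [← map_torsionPoly, map_short]
    rfl
  rw [e, eval_map] at hr
  have h2 := RingHom.isIntegralElem_leadingCoeff_mul (Int.castRingHom (AlgebraicClosure ℚ)) _ _ hr
  rw [(leadingCoeff_torsionPoly hp _).2, map_natCast] at h2
  obtain ⟨c, hc⟩ := torsionLead_dvd p
  have h3 : ((p : AlgebraicClosure ℚ) ^ 2 * r) = (c : ℤ) * ((torsionLead p : AlgebraicClosure ℚ) * r) := by
    rw [← Nat.cast_pow, hc]
    push_cast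
    ring
  rw [h3]
  exact isIntegral_algebraMap.mul h2

/-- If `ℓ` divides the value of the `p`-torsion polynomial at `a`, then `a` is congruent to some
`x`-coordinate of a `p`-torsion point. -/
lemma exists_root_mem (hp : p.Prime) (𝔏 : Ideal AlgInt) [𝔏.IsPrime] {a : ℤ}
    (hp𝔏 : (p : AlgInt) ∉ 𝔏) (ha : (((torsionPoly (short A B) p).eval a : ℤ) : AlgInt) ∈ 𝔏) :
    ∃ r : AlgebraicClosure ℚ,
      (torsionPoly (short (A : AlgebraicClosure ℚ) (B : AlgebraicClosure ℚ)) p).eval r = 0 ∧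
      ∃ X : AlgInt, (X : AlgebraicClosure ℚ) = (p : AlgebraicClosure ℚ) ^ 2 * r ∧
        X - (p : AlgInt) ^ 2 * a ∈ 𝔏 := by
  set f := torsionPoly (short (A : AlgebraicClosure ℚ) (B : AlgebraicClosure ℚ)) p with hf
  have e : f = (torsionPoly (short A B) p).map (Int.castRingHom (AlgebraicClosure ℚ)) := by
    rw [← map_torsionPoly, map_short]
    rfl
  obtain ⟨-, hlead⟩ := leadingCoeff_torsionPoly hp (short (A : AlgebraicClosure ℚ) (B : AlgebraicClosure ℚ))
  have hlead' : torsionLead p ≠ 0 := fun h => by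
    have := torsionLead_dvd p
    rw [h, zero_dvd_iff] at this
    exact hp.ne_zero (pow_eq_zero_iff two_ne_zero |>.mp this)
  have hf0 : f ≠ 0 := fun h => by
    rw [← hf, h, leadingCoeff_zero] at hlead
    exact hlead' (by exact_mod_cast hlead.symm)
  have hroot : ∀ r ∈ f.roots, f.eval r = 0 := fun r hr => (mem_roots hf0).mp hr
  have hints : ∀ z ∈ f.roots.map fun r => (p : AlgebraicClosure ℚ) ^ 2 * (a - r), z ∈ AlgInt := by
    intro z hz
    obtain ⟨r, hr, rfl⟩ := Multiset.mem_map.mp hz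
    have h1 := isIntegral_sq_mul_root hp (hroot r hr)
    have h2 : _root_.IsIntegral ℤ ((p : AlgebraicClosure ℚ) ^ 2 * a) := by
      have : ((p : AlgebraicClosure ℚ) ^ 2 * a) = algebraMap ℤ (AlgebraicClosure ℚ) (p ^ 2 * a) := by simp
      rw [this]
      exact isIntegral_algebraMap
    have := h2.sub h1
    rwa [← mul_sub] at this
  obtain ⟨s, hs⟩ := Multiset.canLift (β := AlgInt) (c := Subtype.val) (p := (· ∈ AlgInt)) |>.prf _ hints
  have heval : f.eval (a : AlgebraicClosure ℚ) =
      torsionLead p * (f.roots.map fun r => (a : AlgebraicClosure ℚ) - r).prod := by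
    have hsp := (IsAlgClosed.splits f).eval_eq_prod_roots (a : AlgebraicClosure ℚ)
    rw [hsp, ← hlead]
  have hprod : (torsionLead p : AlgInt) * s.prod =
      (p : AlgInt) ^ (2 * Multiset.card f.roots) * ((torsionPoly (short A B) p).eval a : ℤ) := by
    apply Subtype.ext
    push_cast
    rw [hs, Multiset.prod_map_mul, Multiset.map_const', Multiset.prod_replicate, ← pow_mul]
    have h2 : (((torsionPoly (short A B) p).eval a : ℤ) : AlgebraicClosure ℚ) = f.eval (a : AlgebraicClosure ℚ) := by
      rw [e, eval_intCast_map]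
      rfl
    rw [h2, heval]
    ring
  have hmem : (torsionLead p : AlgInt) * s.prod ∈ 𝔏 := hprod ▸ 𝔏.mul_mem_left _ ha
  rcases ‹𝔏.IsPrime›.mem_or_mem hmem with h | h
  · exfalso
    obtain ⟨c, hc⟩ := torsionLead_dvd p
    have h1 : ((p : AlgInt)) ^ 2 ∈ 𝔏 := by
      rw [← Nat.cast_pow, hc, Nat.cast_mul]
      exact 𝔏.mul_mem_right _ h
    exact hp𝔏 (‹𝔏.IsPrime›.mem_of_pow_mem _ h1)
  · obtain ⟨z, hz, hz𝔏⟩ := (‹𝔏.IsPrime›.multiset_prod_mem_iff_exists_mem s).mp h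
    have hz' : (z : AlgebraicClosure ℚ) ∈ f.roots.map fun r => (p : AlgebraicClosure ℚ) ^ 2 * (a - r) :=
      hs ▸ Multiset.mem_map_of_mem Subtype.val hz
    obtain ⟨r, hr, hrz⟩ := Multiset.mem_map.mp hz'
    refine ⟨r, hroot r hr, ⟨_, isIntegral_sq_mul_root hp (hroot r hr)⟩, rfl, ?_⟩
    have := 𝔏.neg_mem hz𝔏
    convert this using 1
    apply Subtype.ext
    push_cast
    rw [← hrz]
    change (p : AlgebraicClosure ℚ) ^ 2 * r - (p : AlgebraicClosure ℚ) ^ 2 * a = _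
    ring

section DivisionField

variable (E : WeierstrassCurve ℚ)

open scoped Classical in
lemma finiteDimensional_divisionField (hfin : {P : (E⁄(AlgebraicClosure ℚ)).toAffine.Point | p • P = 0}.Finite) :
    FiniteDimensional ℚ (divisionField E p) := by
  have hS : {z | ∃ (x y : AlgebraicClosure ℚ)
      (h : (E⁄(AlgebraicClosure ℚ)).toAffine.Nonsingular x y),
      p • (Affine.Point.some x y h : (E⁄(AlgebraicClosure ℚ)).toAffine.Point) = 0 ∧
        (z = x ∨ z = y)}.Finite := by
    refine (hfin.biUnion (t := fun P => {z | ∃ (x y : AlgebraicClosure ℚ)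
      (h : (E⁄(AlgebraicClosure ℚ)).toAffine.Nonsingular x y),
      P = Affine.Point.some x y h ∧ (z = x ∨ z = y)}) fun P _ => ?_).subset ?_
    · cases P with
      | zero =>
        refine Set.finite_empty.subset ?_
        rintro z ⟨x, y, h, h', -⟩
        exact (Affine.Point.some_ne_zero h h'.symm).elim
      | some x y h =>
        refine (Set.toFinite {x, y}).subset ?_
        rintro z ⟨x', y', h', e, hz⟩
        obtain ⟨rfl, rfl⟩ : x = x' ∧ y = y' := by simpa using e
        exact hz
    · rintro z ⟨x, y, h, h0, hz⟩
      exact Set.mem_biUnion (x := Affine.Point.some x y h) h0 ⟨x, y, h, rfl, hz⟩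
  have := hS.to_subtype
  exact IntermediateField.finiteDimensional_adjoin fun z _ => Algebra.IsIntegral.isIntegral z

open scoped Classical in
lemma normal_divisionField : Normal ℚ (divisionField E p) := by
  suffices h : @Normal ℚ (divisionField E p) _ _ (IntermediateField.algebra' _) by convert! h
  rw [IntermediateField.normal_iff_forall_map_le]
  intro σ
  rw [divisionField, IntermediateField.adjoin_map]
  refine IntermediateField.adjoin.mono _ _ _ ?_
  rintro _ ⟨z, ⟨x, y, h, h0, hz⟩, rfl⟩
  have h1 : p • Affine.Point.map (W' := E.toAffine) σ (Affine.Point.some x y h) = 0 := by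
    rw [← map_nsmul, h0, map_zero]
  exact ⟨σ x, σ y, _, h1, hz.imp (congrArg σ) (congrArg σ)⟩

open scoped Classical in
lemma fixes_divisionField {σ : AbsGal} (h : torsionRep E (AlgebraicClosure ℚ) p σ = 1)
    {z : AlgebraicClosure ℚ} (hz : z ∈ divisionField E p) : σ z = z := by
  induction hz using IntermediateField.adjoin_induction with
  | mem z hz =>
    obtain ⟨x, y, hxy, h0, hz⟩ := hz
    have h1 := DFunLike.congr_fun h ⟨Affine.Point.some x y hxy, AddSubgroup.torsionBy.nsmul_iff.mpr h0⟩
    have h2 : Affine.Point.map (W' := E.toAffine) σ.toAlgHom (Affine.Point.some x y hxy) =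
      Affine.Point.some x y hxy := congrArg Subtype.val h1
    have h3 : σ x = x ∧ σ y = y := by simpa [Affine.Point.map_some] using h2
    rcases hz with rfl | rfl
    exacts [h3.1, h3.2]
  | algebraMap q => exact σ.commutes q
  | add x y _ _ hx hy => rw [map_add, hx, hy]
  | mul x y _ _ hx hy => rw [map_mul, hx, hy]
  | inv x _ hx => rw [map_inv₀, hx]

end DivisionField

/-- A prime number which is unramified in an intermediate field, on the level of elements. -/
lemma not_mem_sq_of_fixes (K : IntermediateField ℚ (AlgebraicClosure ℚ)) [hK : FiniteDimensional ℚ K]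
    [hN : Normal ℚ K] (hℓ : ℓ.Prime) (𝔏 : Ideal AlgInt) [𝔏.IsPrime]
    [𝔏.LiesOver (Ideal.span {(ℓ : ℤ)})]
    (h : ∀ σ ∈ 𝔏.inertia AbsGal, ∀ z ∈ K, σ z = z) :
    (ℓ : 𝓞 K) ∉ (𝔏.comap (intHom K)) ^ 2 := by
  have hnf : NumberField K := @NumberField.mk K _ inferInstance (by convert! hK)
  have hgal : IsGalois ℚ K := by
    have : IsGalois ℚ K := ⟨⟩
    convert! this
  exact natCast_notMem_sq hℓ 𝔏 fun σ hσ z => h σ hσ z z.2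

open scoped Classical in
/-- The `p`-torsion is ramified at the primes `ℓ ≠ p` which divide `4A³ + 27B²` exactly once. -/
theorem isTorsionRamifiedAt [(shortCurve A B).IsElliptic] (hℓ : ℓ.Prime) (h5 : 5 ≤ ℓ)
    (h : ExactlyDivides ℓ A B) (hp : p.Prime) (hℓp : ℓ ≠ p) :
    IsTorsionRamifiedAt (shortCurve A B) p ℓ := by
  have hpr : (Ideal.span {(ℓ : ℤ)}).IsPrime :=
    (Ideal.span_singleton_prime (Int.natCast_ne_zero.mpr hℓ.ne_zero)).mpr
      (Nat.prime_iff_prime_int.mp hℓ)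
  obtain ⟨𝔏, h𝔏, hover⟩ := (inferInstance : Nonempty (Ideal.primesOver (Ideal.span {(ℓ : ℤ)}) AlgInt))
  refine ⟨𝔏, h𝔏, hover, ?_⟩
  by_contra! hcon
  set E := shortCurve A B with hE
  have hEs : E⁄(AlgebraicClosure ℚ) = short (A : AlgebraicClosure ℚ) (B : AlgebraicClosure ℚ) :=
    baseChange_shortCurve A B _
  set K := divisionField E p
  have hfd := finiteDimensional_divisionField E (card_torsion hp).1
  have hn : Normal ℚ K := normal_divisionField E
  refine not_mem_sq_of_fixes K hℓ 𝔏 (fun σ hσ z hz => fixes_divisionField E (hcon σ hσ) hz) ?_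
  have hint : ∀ m : ℤ, (m : AlgInt) ∈ 𝔏 ↔ (ℓ : ℤ) ∣ m := by
    intro m
    rw [← Ideal.mem_span_singleton, hover.over, Ideal.under_def, Ideal.mem_comap]
    rfl
  have hpℓ : ¬ (ℓ : ℤ) ∣ p := by
    rw [Int.natCast_dvd_natCast, Nat.prime_dvd_prime_iff_eq hℓ hp]
    exact hℓp
  obtain ⟨a, ha1, ha2, ha3, ha4⟩ := exists_int_node hℓ h5 h hp
  obtain ⟨x, hx, X, hX, hXa⟩ := exists_root_mem hp 𝔏 (a := a) (by
    have := (hint p).not.mpr hpℓ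
    simpa using this) ((hint _).mpr ha4)
  obtain ⟨y, hy⟩ := IsAlgClosed.exists_pow_nat_eq (x ^ 3 + A * x + B) (n := 2) (by norm_num)
  have heq : (E⁄(AlgebraicClosure ℚ)).toAffine.Equation x y := by
    rw [hEs, Affine.equation_iff]
    simp only [short]
    linear_combination hy
  have hns : (E⁄(AlgebraicClosure ℚ)).toAffine.Nonsingular x y :=
    Affine.equation_iff_nonsingular.mp heq
  have htors : p • (Affine.Point.some x y hns : (E⁄(AlgebraicClosure ℚ)).toAffine.Point) = 0 :=
    (smul_prime_eq_zero_iff hp ⟨hns, rfl⟩).mpr (by rw [hEs]; exact hx)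
  have hxK : x ∈ K := IntermediateField.subset_adjoin _ _ ⟨x, y, hns, htors, Or.inl rfl⟩
  have hyK : y ∈ K := IntermediateField.subset_adjoin _ _ ⟨x, y, hns, htors, Or.inr rfl⟩
  have hXi : _root_.IsIntegral ℤ ((p : K) ^ 2 * ⟨x, hxK⟩) := by
    refine (isIntegral_algebraMap_iff (algebraMap K (AlgebraicClosure ℚ)).injective).mp ?_
    exact isIntegral_sq_mul_root hp hx
  have hYi : _root_.IsIntegral ℤ ((p : K) ^ 3 * ⟨y, hyK⟩) := by
    refine _root_.IsIntegral.of_pow (n := 2) (by norm_num) ?_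
    have e : ((p : K) ^ 3 * ⟨y, hyK⟩) ^ 2 = ((p : K) ^ 2 * ⟨x, hxK⟩) ^ 3 +
        algebraMap ℤ K (p ^ 4 * A) * ((p : K) ^ 2 * ⟨x, hxK⟩) + algebraMap ℤ K (p ^ 6 * B) := by
      apply Subtype.ext
      push_cast
      simp
      linear_combination (p : AlgebraicClosure ℚ) ^ 6 * hy
    rw [e]
    exact ((hXi.pow 3).add (isIntegral_algebraMap.mul hXi)).add isIntegral_algebraMap
  let X' : 𝓞 K := ⟨_, hXi⟩
  let Y' : 𝓞 K := ⟨_, hYi⟩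
  set P := 𝔏.comap (intHom K) with hP
  have hPp : P.IsPrime := Ideal.IsPrime.comap _
  have hPint : ∀ m : ℤ, (m : 𝓞 K) ∈ P ↔ (ℓ : ℤ) ∣ m := by
    intro m
    rw [← hint, hP, Ideal.mem_comap, map_intCast]
  obtain ⟨t, ht⟩ : ∃ t, t = X' - (p : 𝓞 K) ^ 2 * (a : 𝓞 K) := ⟨_, rfl⟩
  have htP : t ∈ P := by
    rw [ht, hP, Ideal.mem_comap]
    convert hXa using 1
    rw [map_sub, map_mul, map_pow, map_natCast, map_intCast]
    congr 1
    exact Subtype.ext hX.symm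
  have heqY : Y' ^ 2 = t ^ 3 + ((3 * a * p ^ 2 : ℤ) : 𝓞 K) * t ^ 2 +
      ((p ^ 4 * (3 * a ^ 2 + A) : ℤ) : 𝓞 K) * t + ((p ^ 6 * (a ^ 3 + A * a + B) : ℤ) : 𝓞 K) := by
    have h1 : Y' ^ 2 = X' ^ 3 + (p : 𝓞 K) ^ 4 * A * X' + (p : 𝓞 K) ^ 6 * B := by
      let ι : 𝓞 K →+* AlgebraicClosure ℚ := (algebraMap K _).comp (algebraMap (𝓞 K) K)
      have hι : Function.Injective ι :=
        (algebraMap K (AlgebraicClosure ℚ)).injective.comp RingOfIntegers.coe_injective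
      have hιX : ι X' = (p : AlgebraicClosure ℚ) ^ 2 * x := rfl
      have hιY : ι Y' = (p : AlgebraicClosure ℚ) ^ 3 * y := rfl
      apply hι
      simp only [map_add, map_mul, map_pow, map_natCast, map_intCast, hιX, hιY]
      linear_combination (p : AlgebraicClosure ℚ) ^ 6 * hy
    rw [h1, show X' = t + (p : 𝓞 K) ^ 2 * (a : 𝓞 K) by rw [ht]; ring]
    push_cast
    ring
  have h3 : ((p ^ 4 * (3 * a ^ 2 + A) : ℤ) : 𝓞 K) ∈ P := (hPint _).mpr (ha3.mul_left _)
  have h4 : ((p ^ 6 * (a ^ 3 + A * a + B) : ℤ) : 𝓞 K) ∈ P := (hPint _).mpr (ha1.mul_left _)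
  have ht2 : t ^ 2 ∈ P ^ 2 := Ideal.pow_mem_pow htP 2
  have hYP : Y' ∈ P := by
    refine hPp.mem_of_pow_mem 2 ?_
    rw [heqY]
    exact P.add_mem (P.add_mem (P.add_mem (P.pow_mem_of_mem htP 3 (by norm_num))
      (P.mul_mem_left _ (P.pow_mem_of_mem htP 2 (by norm_num)))) (P.mul_mem_left _ htP)) h4
  have h6 : ((p ^ 6 * (a ^ 3 + A * a + B) : ℤ) : 𝓞 K) ∈ P ^ 2 := by
    rw [← sub_eq_iff_eq_add'] at heqY
    rw [← heqY]
    refine (P ^ 2).sub_mem (Ideal.pow_mem_pow hYP 2) ((P ^ 2).add_mem ((P ^ 2).add_mem ?_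
      ((P ^ 2).mul_mem_left _ ht2)) ?_)
    · exact Ideal.pow_le_pow_right (by norm_num) (Ideal.pow_mem_pow htP 3)
    · rw [pow_two P]
      exact Ideal.mul_mem_mul h3 htP
  obtain ⟨c, hc⟩ := ha1
  have hcop : IsCoprime (p ^ 6 * c : ℤ) ℓ := by
    refine ((Prime.coprime_iff_not_dvd (Nat.prime_iff_prime_int.mp hℓ)).mpr fun hd => ?_).symm
    rcases (Nat.prime_iff_prime_int.mp hℓ).dvd_or_dvd hd with hd | hd
    · exact hpℓ ((Nat.prime_iff_prime_int.mp hℓ).dvd_of_dvd_pow hd)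
    · apply ha2
      rw [hc, pow_two]
      exact mul_dvd_mul_left _ hd
  obtain ⟨u, v, huv⟩ := hcop
  have hℓP : (ℓ : 𝓞 K) ∈ P := by
    have := (hPint ℓ).mpr dvd_rfl
    simpa using this
  have hfin : (ℓ : 𝓞 K) = (u : 𝓞 K) * ((p ^ 6 * (a ^ 3 + A * a + B) : ℤ) : 𝓞 K) + (v : 𝓞 K) * ((ℓ : 𝓞 K) ^ 2) := by
    have h1 : (ℓ : ℤ) = u * (p ^ 6 * (a ^ 3 + A * a + B)) + v * ℓ ^ 2 := by
      rw [hc]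
      linear_combination -(ℓ : ℤ) * huv
    have h2 := congrArg (Int.cast : ℤ → 𝓞 K) h1
    push_cast at h2 ⊢
    exact h2
  rw [hfin]
  exact (P ^ 2).add_mem ((P ^ 2).mul_mem_left _ h6) ((P ^ 2).mul_mem_left _ (Ideal.pow_mem_pow hℓP 2))

end Ramification

section Reduction

open IsDedekindDomain.HeightOneSpectrum WithZero

variable {ℓ : ℕ} [Fact ℓ.Prime] {A B : ℤ}

/-- The normalized valuation of `ℚ_ℓ`. -/
abbrev padicVal (ℓ : ℕ) [Fact ℓ.Prime] : Valuation ℚ_[ℓ] ℤᵐ⁰ :=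
  (IsDiscreteValuationRing.maximalIdeal ℤ_[ℓ]).valuation ℚ_[ℓ]

lemma padicVal_intCast_eq_one {m : ℤ} (hm : ¬ (ℓ : ℤ) ∣ m) : padicVal ℓ m = 1 := by
  rw [show (m : ℚ_[ℓ]) = algebraMap ℤ_[ℓ] ℚ_[ℓ] (m : ℤ_[ℓ]) by simp]
  refine le_antisymm (valuation_le_one _ _) (not_lt.mp fun h => hm ?_)
  rw [valuation_lt_one_iff_mem] at h
  have h' : (m : ℤ_[ℓ]) ∈ IsLocalRing.maximalIdeal ℤ_[ℓ] := h
  rw [PadicInt.maximalIdeal_eq_span_p, Ideal.mem_span_singleton, ← PadicInt.norm_lt_one_iff_dvd,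
    PadicInt.norm_intCast_lt_one_iff] at h'
  exact h'

lemma padicVal_self : padicVal ℓ (ℓ : ℚ_[ℓ]) = exp (-1) := by
  rw [show (ℓ : ℚ_[ℓ]) = algebraMap ℤ_[ℓ] ℚ_[ℓ] (ℓ : ℤ_[ℓ]) by simp, valuation_of_algebraMap]
  exact intValuation_singleton _ (by simpa using (Fact.out : ℓ.Prime).ne_zero)
    PadicInt.maximalIdeal_eq_span_p

lemma Δ_shortCurve_padic (A B : ℤ) : ((shortCurve A B)⁄ℚ_[ℓ]).Δ =
    ((-16 * (4 * A ^ 3 + 27 * B ^ 2) : ℤ) : ℚ_[ℓ]) := by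
  rw [baseChange_shortCurve, short_Δ]
  push_cast
  ring

lemma isIntegral_shortCurve (A B : ℤ) : WeierstrassCurve.IsIntegral ℤ_[ℓ] ((shortCurve A B)⁄ℚ_[ℓ]) := by
  rw [baseChange_shortCurve]
  refine ⟨short (A : ℤ_[ℓ]) (B : ℤ_[ℓ]), ?_⟩
  change _ = (short (A : ℤ_[ℓ]) (B : ℤ_[ℓ])).map (algebraMap ℤ_[ℓ] ℚ_[ℓ])
  rw [map_short]
  simp

lemma padicVal_Δ_smul (W : WeierstrassCurve ℚ_[ℓ]) (C : VariableChange ℚ_[ℓ]) :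
    ∃ k : ℤ, padicVal ℓ (C • W).Δ = exp (12 * k) * padicVal ℓ W.Δ := by
  rw [variableChange_Δ, map_mul, map_pow]
  have h0 : padicVal ℓ (C.u⁻¹ : ℚ_[ℓ]ˣ) ≠ 0 := (Valuation.ne_zero_iff _).mpr (Units.ne_zero _)
  refine ⟨log (padicVal ℓ (C.u⁻¹ : ℚ_[ℓ]ˣ)), ?_⟩
  nth_rewrite 1 [← exp_log h0]
  rw [← exp_nsmul]
  simp

lemma isMinimal_of_padicVal {W : WeierstrassCurve ℚ_[ℓ]} (hW : WeierstrassCurve.IsIntegral ℤ_[ℓ] W)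
    {j : ℤ} (hj : j < 12) (hΔ : padicVal ℓ W.Δ = exp (-j)) : IsMinimal ℤ_[ℓ] W := by
  refine ⟨by simpa using hW, fun C hC _ => ?_⟩
  have hC' : WeierstrassCurve.IsIntegral ℤ_[ℓ] (C • W) := hC
  have h1 := valuation_Δ_aux_eq_of_isIntegral ℤ_[ℓ] (C • W)
  have h2 := valuation_Δ_aux_eq_of_isIntegral ℤ_[ℓ] W
  obtain ⟨k, hk⟩ := padicVal_Δ_smul W C
  rw [← Subtype.coe_le_coe]
  change (valuation_Δ_aux ℤ_[ℓ] (C • W) : ℤᵐ⁰) ≤ valuation_Δ_aux ℤ_[ℓ] ((1 : VariableChange ℚ_[ℓ]) • W)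
  have h3 := (valuation_Δ_aux ℤ_[ℓ] (C • W)).2
  rw [one_smul, h1, h2]
  rw [h1] at h3
  change padicVal ℓ _ ≤ padicVal ℓ _
  change padicVal ℓ _ ≤ 1 at h3
  rw [hk, hΔ, ← exp_add, ← exp_zero, exp_le_exp] at h3
  rw [hk, hΔ, ← exp_add, exp_le_exp]
  omega

lemma hasGoodReductionAt (hℓ : ¬ (ℓ : ℤ) ∣ 2 * (4 * A ^ 3 + 27 * B ^ 2)) :
    HasGoodReductionAt (shortCurve A B) ℓ := by
  have hΔ : padicVal ℓ ((shortCurve A B)⁄ℚ_[ℓ]).Δ = 1 := by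
    rw [Δ_shortCurve_padic]
    refine padicVal_intCast_eq_one fun h => hℓ ?_
    have h' : (ℓ : ℤ) ∣ (2 * (4 * A ^ 3 + 27 * B ^ 2)) ^ 4 := h.trans ⟨-(4 * A ^ 3 + 27 * B ^ 2) ^ 3, by ring⟩
    exact (Nat.prime_iff_prime_int.mp Fact.out).dvd_of_dvd_pow h'
  refine ⟨1, ?_⟩
  rw [one_smul, hasGoodReduction_iff]
  exact ⟨isMinimal_of_padicVal (isIntegral_shortCurve A B) (j := 0) (by norm_num) (by simpa using hΔ), hΔ⟩

lemma conductorExponent_eq_one (h5 : 5 ≤ ℓ) (h : ExactlyDivides ℓ A B) :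
    conductorExponent (shortCurve A B) ℓ = 1 := by
  have hℓ : ℓ.Prime := Fact.out
  have h2 : ¬ (ℓ : ℤ) ∣ 2 * 3 := fun hd => by
    rcases (Nat.prime_iff_prime_int.mp hℓ).dvd_or_dvd hd with hd | hd <;>
    · have := Int.le_of_dvd (by norm_num) hd
      omega
  have hΔ : padicVal ℓ ((shortCurve A B)⁄ℚ_[ℓ]).Δ = exp (-1) := by
    obtain ⟨m, hm⟩ := h.1
    rw [Δ_shortCurve_padic, hm, show -16 * ((ℓ : ℤ) * m) = ℓ * (-16 * m) by ring, Int.cast_mul, map_mul,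
      Int.cast_natCast, padicVal_self, padicVal_intCast_eq_one, mul_one]
    intro hd
    rcases (Nat.prime_iff_prime_int.mp hℓ).dvd_or_dvd hd with hd | hd
    · refine h2 (dvd_mul_of_dvd_left ((Nat.prime_iff_prime_int.mp hℓ).dvd_of_dvd_pow (n := 4) ?_) _)
      rw [← dvd_neg]
      exact hd
    · apply h.2
      rw [hm, pow_two]
      exact mul_dvd_mul_left _ hd
  have hc₄ : padicVal ℓ ((shortCurve A B)⁄ℚ_[ℓ]).c₄ = 1 := by
    rw [baseChange_shortCurve, short_c₄, show -48 * (A : ℚ_[ℓ]) = ((-48 * A : ℤ) : ℚ_[ℓ]) by push_cast; ring]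
    refine padicVal_intCast_eq_one fun hd => ?_
    rcases (Nat.prime_iff_prime_int.mp hℓ).dvd_or_dvd hd with hd | hd
    · refine h2 ((Nat.prime_iff_prime_int.mp hℓ).dvd_of_dvd_pow (n := 4) (hd.trans ⟨-27, by norm_num⟩))
    · exact h.not_dvd hℓ h5 hd
  rw [conductorExponent, if_neg, if_pos]
  · refine ⟨1, ?_⟩
    rw [one_smul, hasMultiplicativeReduction_iff]
    refine ⟨isMinimal_of_padicVal (isIntegral_shortCurve A B) (j := 1) (by norm_num) hΔ, ?_, hc₄⟩
    change padicVal ℓ _ < 1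
    rw [hΔ, ← exp_zero, exp_lt_exp]
    norm_num
  · rintro ⟨C, hC⟩
    obtain ⟨k, hk⟩ := padicVal_Δ_smul ((shortCurve A B)⁄ℚ_[ℓ]) C
    have h1 : padicVal ℓ _ = 1 := hC.goodReduction
    rw [hk, hΔ, ← exp_add, ← exp_zero, exp_inj] at h1
    omega

/-- A prime `ℓ ≥ 5` which divides `4A³ + 27B²` exactly once divides the conductor exactly once. -/
theorem dvd_conductor (h5 : 5 ≤ ℓ) (h : ExactlyDivides ℓ A B) :
    ℓ ∣ conductor (shortCurve A B) ∧ ¬ ℓ ^ 2 ∣ conductor (shortCurve A B) := by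
  have hℓ : ℓ.Prime := Fact.out
  have hD : 2 * (4 * A ^ 3 + 27 * B ^ 2) ≠ 0 := mul_ne_zero two_ne_zero h.ne_zero
  set f : Nat.Primes → ℕ := fun q => haveI : Fact (q : ℕ).Prime := ⟨q.2⟩
    (q : ℕ) ^ conductorExponent (shortCurve A B) q with hf
  have hfin : (Function.mulSupport f).Finite := by
    refine Set.Finite.subset (s := (fun q : Nat.Primes => (q : ℕ)) ⁻¹'
      ((2 * (4 * A ^ 3 + 27 * B ^ 2)).natAbs.divisors : Set ℕ))
      ((Finset.finite_toSet _).preimage Subtype.val_injective.injOn) ?_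
    intro q hq
    have : Fact (q : ℕ).Prime := ⟨q.2⟩
    rw [Set.mem_preimage, Finset.mem_coe, Nat.mem_divisors]
    refine ⟨?_, Int.natAbs_ne_zero.mpr hD⟩
    by_contra hcon
    rw [← Int.natCast_dvd] at hcon
    refine hq ?_
    have : conductorExponent (shortCurve A B) q = 0 := by
      rw [conductorExponent, if_pos (hasGoodReductionAt hcon)]
    simp [hf, this]
  let q₀ : Nat.Primes := ⟨ℓ, hℓ⟩
  have hq₀ : f q₀ = ℓ := by
    change ℓ ^ conductorExponent (shortCurve A B) ℓ = ℓ
    rw [conductorExponent_eq_one h5 h, pow_one]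
  have hmem : q₀ ∈ hfin.toFinset := by
    rw [Set.Finite.mem_toFinset, Function.mem_mulSupport, hq₀]
    exact hℓ.ne_one
  have hcond : conductor (shortCurve A B) = ℓ * ∏ q ∈ hfin.toFinset.erase q₀, f q := by
    rw [conductor, finprod_eq_prod _ hfin, ← Finset.mul_prod_erase _ _ hmem, hq₀]
  have hcop : ¬ ℓ ∣ ∏ q ∈ hfin.toFinset.erase q₀, f q := by
    rw [← hℓ.coprime_iff_not_dvd]
    refine Nat.Coprime.prod_right fun q hq => Nat.Coprime.pow_right _ ?_
    rw [Nat.coprime_primes hℓ q.2]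
    intro he
    exact (Finset.mem_erase.mp hq).1 (Subtype.ext he.symm)
  rw [hcond]
  refine ⟨dvd_mul_right _ _, fun hd => hcop ?_⟩
  rw [pow_two] at hd
  exact Nat.dvd_of_mul_dvd_mul_left hℓ.pos hd

end Reduction

section Sieve

lemma ExactlyDivides.congr {ℓ : ℕ} {A B A' B' : ℤ} (hA : A ≡ A' [ZMOD (ℓ : ℤ) ^ 2])
    (hB : B ≡ B' [ZMOD (ℓ : ℤ) ^ 2]) (h : ExactlyDivides ℓ A B) : ExactlyDivides ℓ A' B' := by
  have h2 : 4 * A ^ 3 + 27 * B ^ 2 ≡ 4 * A' ^ 3 + 27 * B' ^ 2 [ZMOD (ℓ : ℤ) ^ 2] :=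
    ((hA.pow 3).mul_left 4).add ((hB.pow 2).mul_left 27)
  have h1 := h2.of_dvd (dvd_pow_self _ two_ne_zero)
  exact ⟨(h1.dvd_iff).mp h.1, fun h' => h.2 ((h2.dvd_iff).mpr h')⟩

open scoped Classical in
/-- The pairs of residues modulo `ℓ²` for which `ℓ` does not divide `4A³ + 27B²` exactly once. -/
def badResidues (ℓ : ℕ) : Finset (ℤ × ℤ) :=
  (Finset.Ico 0 ((ℓ : ℤ) ^ 2) ×ˢ Finset.Ico 0 ((ℓ : ℤ) ^ 2)).filter fun c => ¬ ExactlyDivides ℓ c.1 c.2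

lemma exactlyDivides_param {ℓ : ℕ} (hℓ : ℓ.Prime) (h5 : 5 ≤ ℓ) {a j m : ℤ} (ha : ¬ (ℓ : ℤ) ∣ a)
    (hm : ¬ (ℓ : ℤ) ∣ m) :
    ExactlyDivides ℓ (-3 * a ^ 2 + ℓ * j) (2 * a ^ 3 + ℓ * (m - a * j)) := by
  have hℓ' := Nat.prime_iff_prime_int.mp hℓ
  have e : 4 * (-3 * a ^ 2 + ℓ * j) ^ 3 + 27 * (2 * a ^ 3 + ℓ * (m - a * j)) ^ 2 =
      ℓ * (108 * a ^ 3 * m + ℓ * (-36 * a ^ 2 * j ^ 2 + 4 * ℓ * j ^ 3 + 27 * (m - a * j) ^ 2)) := by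
    ring
  rw [ExactlyDivides, e]
  refine ⟨dvd_mul_right _ _, fun h => ?_⟩
  rw [pow_two] at h
  have h1 := Int.dvd_of_mul_dvd_mul_left (by exact_mod_cast hℓ.ne_zero) h
  rw [dvd_add_left (dvd_mul_right _ _)] at h1
  rcases hℓ'.dvd_or_dvd h1 with h1 | h1
  · rcases hℓ'.dvd_or_dvd h1 with h1 | h1
    · have h6 : (ℓ : ℤ) ∣ 6 := hℓ'.dvd_of_dvd_pow (n := 3) (h1.trans ⟨2, by norm_num⟩)
      have : ℓ ∣ 2 * 3 := by exact_mod_cast h6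
      rcases hℓ.dvd_mul.mp this with h | h <;>
      · have := Nat.le_of_dvd (by norm_num) h
        omega
    · exact ha (hℓ'.dvd_of_dvd_pow h1)
  · exact hm h1

lemma eq_of_modEq_of_mem {n a b : ℤ} (h : n ∣ a - b) (ha : a ∈ Set.Ico 0 n) (hb : b ∈ Set.Ico 0 n) :
    a = b := by
  have := Int.eq_zero_of_abs_lt_dvd h (by rw [abs_lt]; constructor <;> linarith [ha.1, ha.2, hb.1, hb.2])
  linarith

lemma card_badResidues {ℓ : ℕ} (hℓ : ℓ.Prime) (h5 : 5 ≤ ℓ) :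
    (badResidues ℓ).card + (ℓ - 1) ^ 2 * ℓ ≤ ℓ ^ 4 := by
  classical
  have hℓ' := Nat.prime_iff_prime_int.mp hℓ
  have hpos : (0 : ℤ) < (ℓ : ℤ) ^ 2 := by have := hℓ.pos; positivity
  set box := Finset.Ico 0 ((ℓ : ℤ) ^ 2) ×ˢ Finset.Ico 0 ((ℓ : ℤ) ^ 2) with hbox
  have hcard : box.card = ℓ ^ 4 := by
    rw [hbox, Finset.card_product, Int.card_Ico, sub_zero]
    have : ((ℓ : ℤ) ^ 2).toNat = ℓ ^ 2 := by
      rw [← Nat.cast_pow, Int.toNat_natCast]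
    rw [this]
    ring
  rw [← hcard, ← Finset.card_filter_add_card_filter_not (s := box) (fun c => ¬ ExactlyDivides ℓ c.1 c.2)]
  refine Nat.add_le_add_left ?_ _
  set T : Finset (ℤ × ℤ × ℤ) := Finset.Ico 1 (ℓ : ℤ) ×ˢ Finset.Ico 0 (ℓ : ℤ) ×ˢ Finset.Ico 1 (ℓ : ℤ) with hT
  have hTcard : T.card = (ℓ - 1) ^ 2 * ℓ := by
    have : ((ℓ : ℤ) - 1).toNat = ℓ - 1 := by omega
    rw [hT, Finset.card_product, Finset.card_product, Int.card_Ico, Int.card_Ico, this, sub_zero,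
      Int.toNat_natCast]
    ring
  have hnd : ∀ a ∈ Finset.Ico 1 (ℓ : ℤ), ¬ (ℓ : ℤ) ∣ a := fun a ha h => by
    rw [Finset.mem_Ico] at ha
    have := Int.le_of_dvd (by omega) h
    omega
  rw [← hTcard]
  refine Finset.card_le_card_of_injOn (fun t => ((-3 * t.1 ^ 2 + ℓ * t.2.1) % (ℓ : ℤ) ^ 2,
    (2 * t.1 ^ 3 + ℓ * (t.2.2 - t.1 * t.2.1)) % (ℓ : ℤ) ^ 2)) ?_ ?_
  · rintro ⟨a, j, m⟩ ht
    rw [Finset.mem_coe, hT, Finset.mem_product, Finset.mem_product] at ht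
    obtain ⟨ha, hj, hm⟩ := ht
    rw [Finset.mem_coe, Finset.mem_filter, hbox, Finset.mem_product, Finset.mem_Ico, Finset.mem_Ico]
    refine ⟨⟨⟨Int.emod_nonneg _ hpos.ne', Int.emod_lt_of_pos _ hpos⟩,
      Int.emod_nonneg _ hpos.ne', Int.emod_lt_of_pos _ hpos⟩, not_not.mpr ?_⟩
    exact (exactlyDivides_param hℓ h5 (hnd a ha) (hnd m hm)).congr (Int.mod_modEq _ _).symm
      (Int.mod_modEq _ _).symm
  · rintro ⟨a, j, m⟩ ht ⟨a', j', m'⟩ ht' heq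
    rw [Finset.mem_coe, hT, Finset.mem_product, Finset.mem_product] at ht ht'
    obtain ⟨ha, hj, hm⟩ := ht
    obtain ⟨ha', hj', hm'⟩ := ht'
    obtain ⟨h1, h2⟩ := Prod.mk.inj heq
    dsimp only at ha hj hm ha' hj' hm' h1 h2
    have hnda := hnd a ha
    have d1 := Int.ModEq.dvd h1.symm
    have d2 := Int.ModEq.dvd h2.symm
    have hself : (ℓ : ℤ) ∣ (ℓ : ℤ) ^ 2 := dvd_pow_self _ two_ne_zero
    have e1 : (ℓ : ℤ) ∣ 6 * a ^ 2 * (a - a') := by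
      have : 6 * a ^ 2 * (a - a') = 3 * (2 * a ^ 3 + ℓ * (m - a * j) - (2 * a' ^ 3 + ℓ * (m' - a' * j')))
          + 2 * a' * (-3 * a ^ 2 + ℓ * j - (-3 * a' ^ 2 + ℓ * j'))
          + ℓ * (-3 * ((m - a * j) - (m' - a' * j')) - 2 * a' * (j - j')) := by ring
      rw [this]
      exact dvd_add (dvd_add ((hself.trans d2).mul_left _) ((hself.trans d1).mul_left _)) (dvd_mul_right _ _)
    have haa : a = a' := by
      rw [Finset.mem_Ico] at ha ha'
      refine eq_of_modEq_of_mem (n := ℓ) ?_ ⟨by omega, ha.2⟩ ⟨by omega, ha'.2⟩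
      refine (hℓ'.dvd_or_dvd e1).resolve_left fun h => ?_
      rcases hℓ'.dvd_or_dvd h with h | h
      · have : ℓ ∣ 2 * 3 := by exact_mod_cast h
        rcases hℓ.dvd_mul.mp this with h | h <;>
        · have := Nat.le_of_dvd (by norm_num) h
          omega
      · exact hnda (hℓ'.dvd_of_dvd_pow h)
    subst haa
    have hcancel : ∀ z : ℤ, (ℓ : ℤ) ^ 2 ∣ ℓ * z → (ℓ : ℤ) ∣ z := fun z hz => by
      rw [pow_two] at hz
      exact Int.dvd_of_mul_dvd_mul_left (by exact_mod_cast hℓ.ne_zero) hz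
    have hjj : j = j' := by
      rw [Finset.mem_Ico] at hj hj'
      refine eq_of_modEq_of_mem (n := ℓ) (hcancel _ ?_) ⟨hj.1, hj.2⟩ ⟨hj'.1, hj'.2⟩
      convert d1 using 1
      ring
    subst hjj
    have hmm : m = m' := by
      rw [Finset.mem_Ico] at hm hm'
      refine eq_of_modEq_of_mem (n := ℓ) (hcancel _ ?_) ⟨by omega, hm.2⟩ ⟨by omega, hm'.2⟩
      convert d2 using 1
      ring
    rw [hmm]

lemma card_badResidues_le {ℓ : ℕ} (hℓ : ℓ.Prime) (h5 : 5 ≤ ℓ) :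
    ((badResidues ℓ).card : ℝ) ≤ (ℓ : ℝ) ^ 4 * Real.exp (-(1 / 2 * (1 / (ℓ : ℝ)))) := by
  have h := card_badResidues hℓ h5
  have h' : ((badResidues ℓ).card : ℝ) + ((ℓ : ℝ) - 1) ^ 2 * ℓ ≤ (ℓ : ℝ) ^ 4 := by
    have : ((ℓ - 1 : ℕ) : ℝ) = (ℓ : ℝ) - 1 := by
      rw [Nat.cast_sub hℓ.one_le, Nat.cast_one]
    rw [← this]
    exact_mod_cast h
  have h5' : (5 : ℝ) ≤ ℓ := by exact_mod_cast h5
  have h1 : (ℓ : ℝ) ^ 4 * (1 - 1 / 2 * (1 / (ℓ : ℝ))) ≤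
      (ℓ : ℝ) ^ 4 * Real.exp (-(1 / 2 * (1 / (ℓ : ℝ)))) := by
    refine mul_le_mul_of_nonneg_left ?_ (by positivity)
    have := Real.add_one_le_exp (-(1 / 2 * (1 / (ℓ : ℝ))))
    linarith
  have h2 : (ℓ : ℝ) ^ 4 * (1 - 1 / 2 * (1 / (ℓ : ℝ))) = (ℓ : ℝ) ^ 4 - (ℓ : ℝ) ^ 3 / 2 := by
    field_simp
  have h3 : (ℓ : ℝ) ^ 3 / 2 ≤ ((ℓ : ℝ) - 1) ^ 2 * ℓ := by
    nlinarith [mul_nonneg (by linarith : (0 : ℝ) ≤ ℓ) (mul_nonneg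
      (by linarith : (0 : ℝ) ≤ ℓ) (by linarith : (0 : ℝ) ≤ (ℓ : ℝ) - 4))]
  linarith

/-- An interval of length `2N` meets a residue class modulo `Q ≤ N` in at most `3N / Q` integers. -/
lemma card_modEq_le {Q N : ℕ} (hQ : 0 < Q) (hN : Q ≤ N) (s : Finset ℤ) (hs : ∀ a ∈ s, |a| ≤ N)
    (hc : ∀ a ∈ s, ∀ b ∈ s, (Q : ℤ) ∣ a - b) : (s.card : ℝ) * Q ≤ 3 * N := by
  have hQ' : (0 : ℤ) < Q := by exact_mod_cast hQ
  have h1 : s.card ≤ (Finset.range (2 * N / Q + 1)).card := by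
    refine Finset.card_le_card_of_injOn (fun a => ((a + N) / Q).toNat) ?_ ?_
    · intro a ha
      have := abs_le.mp (hs a ha)
      rw [Finset.mem_coe, Finset.mem_range, Nat.lt_succ_iff, Int.toNat_le, Int.natCast_div]
      exact Int.ediv_le_ediv hQ' (by push_cast; linarith [this.2])
    · intro a ha b hb hab
      have h1 := abs_le.mp (hs a ha)
      have h2 := abs_le.mp (hs b hb)
      have h3 : (a + N) / (Q : ℤ) = (b + N) / (Q : ℤ) := by
        have e1 := Int.ediv_nonneg (a := a + N) (b := Q) (by linarith) hQ'.le
        have e2 := Int.ediv_nonneg (a := b + N) (b := Q) (by linarith) hQ'.le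
        dsimp only at hab
        omega
      have h4 : (a + N) % (Q : ℤ) = (b + N) % (Q : ℤ) :=
        ((Int.modEq_iff_dvd.mpr (hc a ha b hb)).add_right (N : ℤ)).symm
      have h5 := Int.emod_add_mul_ediv (a + N) Q
      have h6 := Int.emod_add_mul_ediv (b + N) Q
      rw [h3, h4] at h5
      linarith
  rw [Finset.card_range] at h1
  have h2 : s.card * Q ≤ 3 * N := by
    calc s.card * Q ≤ (2 * N / Q + 1) * Q := Nat.mul_le_mul_right _ h1
      _ = 2 * N / Q * Q + Q := by ring
      _ ≤ 2 * N + N := Nat.add_le_add (Nat.div_mul_le_self _ _) hN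
      _ = 3 * N := by ring
  exact_mod_cast h2

open scoped Classical in
lemma card_sieve_le (S : Finset ℕ) (hS : ∀ ℓ ∈ S, ℓ.Prime ∧ 5 ≤ ℓ) {R : ℕ}
    (hR : ∏ ℓ ∈ S, ℓ ^ 2 ≤ R) :
    (((box R).filter fun c => ∀ ℓ ∈ S, ¬ ExactlyDivides ℓ c.1 c.2).card : ℝ) ≤
      9 * Real.exp (-(1 / 2 * ∑ ℓ ∈ S, 1 / (ℓ : ℝ))) * (R : ℝ) ^ 5 := by
  set Q := ∏ ℓ ∈ S, ℓ ^ 2 with hQ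
  have hQ0 : 0 < Q := Finset.prod_pos fun ℓ hℓ => pow_pos (hS ℓ hℓ).1.pos 2
  set F := (box R).filter fun c => ∀ ℓ ∈ S, ¬ ExactlyDivides ℓ c.1 c.2 with hF
  let T : Finset ((ℓ : S) → ℤ × ℤ) := Fintype.piFinset fun ℓ : S => badResidues ℓ
  let φ : ℤ × ℤ → (ℓ : S) → ℤ × ℤ := fun c ℓ => (c.1 % ((ℓ : ℕ) : ℤ) ^ 2, c.2 % ((ℓ : ℕ) : ℤ) ^ 2)
  have hφ : ∀ c ∈ F, φ c ∈ T := by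
    intro c hc
    rw [Fintype.mem_piFinset]
    intro ℓ
    have hpos : (0 : ℤ) < ((ℓ : ℕ) : ℤ) ^ 2 := by have := (hS ℓ ℓ.2).1.pos; positivity
    rw [badResidues, Finset.mem_filter, Finset.mem_product, Finset.mem_Ico, Finset.mem_Ico]
    refine ⟨⟨⟨Int.emod_nonneg _ hpos.ne', Int.emod_lt_of_pos _ hpos⟩,
      Int.emod_nonneg _ hpos.ne', Int.emod_lt_of_pos _ hpos⟩, fun h => ?_⟩
    exact (Finset.mem_filter.mp hc).2 ℓ ℓ.2 (h.congr (Int.mod_modEq _ _) (Int.mod_modEq _ _))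
  have hdvd : ∀ c c', φ c = φ c' → (Q : ℤ) ∣ c.1 - c'.1 ∧ (Q : ℤ) ∣ c.2 - c'.2 := by
    intro c c' h
    have hcop : (S : Set ℕ).Pairwise (Function.onFun IsCoprime fun ℓ : ℕ => ((ℓ : ℤ) ^ 2)) := by
      intro ℓ hℓ ℓ' hℓ' hne
      refine IsCoprime.pow ?_
      rw [Nat.isCoprime_iff_coprime]
      exact (Nat.coprime_primes (hS ℓ hℓ).1 (hS ℓ' hℓ').1).mpr hne
    rw [hQ, Nat.cast_prod]
    simp only [Nat.cast_pow]
    constructor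
    · refine Finset.prod_dvd_of_coprime hcop fun ℓ hℓ => ?_
      have := congrArg Prod.fst (congrFun h ⟨ℓ, hℓ⟩)
      exact (Int.ModEq.dvd (show c'.1 ≡ c.1 [ZMOD (ℓ : ℤ) ^ 2] from this.symm))
    · refine Finset.prod_dvd_of_coprime hcop fun ℓ hℓ => ?_
      have := congrArg Prod.snd (congrFun h ⟨ℓ, hℓ⟩)
      exact (Int.ModEq.dvd (show c'.2 ≡ c.2 [ZMOD (ℓ : ℤ) ^ 2] from this.symm))
  have hQr : (0 : ℝ) < Q := by exact_mod_cast hQ0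
  have hfib : ∀ y ∈ T, ((F.filter fun c => φ c = y).card : ℝ) ≤ 9 * (R : ℝ) ^ 5 / (Q : ℝ) ^ 2 := by
    intro y _
    set G := F.filter fun c => φ c = y
    have hG : ∀ c ∈ G, |c.1| ≤ R ^ 2 ∧ |c.2| ≤ R ^ 3 := fun c hc =>
      mem_box.mp (Finset.mem_filter.mp (Finset.mem_filter.mp hc).1).1
    have hG' : ∀ c ∈ G, ∀ c' ∈ G, (Q : ℤ) ∣ c.1 - c'.1 ∧ (Q : ℤ) ∣ c.2 - c'.2 := fun c hc c' hc' =>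
      hdvd c c' ((Finset.mem_filter.mp hc).2.trans (Finset.mem_filter.mp hc').2.symm)
    have h1 := card_modEq_le hQ0 (N := R ^ 2) (hR.trans (Nat.le_self_pow two_ne_zero _)) (G.image Prod.fst) (by
      intro a ha
      obtain ⟨c, hc, rfl⟩ := Finset.mem_image.mp ha
      exact_mod_cast (hG c hc).1) (by
      intro a ha b hb
      obtain ⟨c, hc, rfl⟩ := Finset.mem_image.mp ha
      obtain ⟨c', hc', rfl⟩ := Finset.mem_image.mp hb
      exact (hG' c hc c' hc').1)
    have h2 := card_modEq_le hQ0 (N := R ^ 3) (hR.trans (Nat.le_self_pow three_ne_zero _)) (G.image Prod.snd) (by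
      intro a ha
      obtain ⟨c, hc, rfl⟩ := Finset.mem_image.mp ha
      exact_mod_cast (hG c hc).2) (by
      intro a ha b hb
      obtain ⟨c, hc, rfl⟩ := Finset.mem_image.mp ha
      obtain ⟨c', hc', rfl⟩ := Finset.mem_image.mp hb
      exact (hG' c hc c' hc').2)
    have h3 : G.card ≤ (G.image Prod.fst).card * (G.image Prod.snd).card := by
      rw [← Finset.card_product]
      exact Finset.card_le_card Finset.subset_product
    have h3' : (G.card : ℝ) ≤ (G.image Prod.fst).card * (G.image Prod.snd).card := by exact_mod_cast h3
    rw [le_div_iff₀ (by positivity)]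
    push_cast at h1 h2
    calc (G.card : ℝ) * (Q : ℝ) ^ 2 ≤
          (((G.image Prod.fst).card : ℝ) * (G.image Prod.snd).card) * (Q : ℝ) ^ 2 := by gcongr
      _ = (((G.image Prod.fst).card : ℝ) * Q) * (((G.image Prod.snd).card : ℝ) * Q) := by ring
      _ ≤ (3 * (R : ℝ) ^ 2) * (3 * (R : ℝ) ^ 3) := by gcongr
      _ = 9 * (R : ℝ) ^ 5 := by ring
  have hT : (T.card : ℝ) ≤ (Q : ℝ) ^ 2 * Real.exp (-(1 / 2 * ∑ ℓ ∈ S, 1 / (ℓ : ℝ))) := by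
    rw [Fintype.card_piFinset, Nat.cast_prod, Finset.prod_coe_sort S fun ℓ => ((badResidues ℓ).card : ℝ)]
    rw [hQ, Nat.cast_prod, ← Finset.prod_pow, Finset.mul_sum, ← Finset.sum_neg_distrib, Real.exp_sum,
      ← Finset.prod_mul_distrib]
    refine Finset.prod_le_prod (fun _ _ => by positivity) fun ℓ hℓ => ?_
    have := card_badResidues_le (hS ℓ hℓ).1 (hS ℓ hℓ).2
    calc _ ≤ _ := this
      _ = _ := by push_cast; ring
  calc (F.card : ℝ) = ∑ y ∈ T, ((F.filter fun c => φ c = y).card : ℝ) := by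
        rw [Finset.card_eq_sum_card_fiberwise hφ, Nat.cast_sum]
    _ ≤ ∑ y ∈ T, 9 * (R : ℝ) ^ 5 / (Q : ℝ) ^ 2 := Finset.sum_le_sum hfib
    _ = T.card * (9 * (R : ℝ) ^ 5 / (Q : ℝ) ^ 2) := by rw [Finset.sum_const, nsmul_eq_mul]
    _ ≤ (Q : ℝ) ^ 2 * Real.exp (-(1 / 2 * ∑ ℓ ∈ S, 1 / (ℓ : ℝ))) * (9 * (R : ℝ) ^ 5 / (Q : ℝ) ^ 2) := by gcongr
    _ = _ := by field_simp

lemma exists_primes_sum_ge (M : ℕ) (T : ℝ) : ∃ S : Finset ℕ, (∀ ℓ ∈ S, ℓ.Prime ∧ M < ℓ) ∧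
    T ≤ ∑ ℓ ∈ S, 1 / (ℓ : ℝ) := by
  classical
  set f : ℕ → ℝ := Set.indicator {p | p.Prime} fun n : ℕ => 1 / (n : ℝ) with hf
  have hf0 : ∀ n, 0 ≤ f n := fun n => Set.indicator_nonneg (fun _ _ => by positivity) n
  have h1 : ¬ Summable fun n => f (n + (M + 1)) := fun h =>
    not_summable_one_div_on_primes ((summable_nat_add_iff (M + 1)).mp h)
  rw [not_summable_iff_tendsto_nat_atTop_of_nonneg fun n => hf0 _] at h1
  obtain ⟨n, hn⟩ := (h1.eventually_ge_atTop T).exists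
  refine ⟨((Finset.range n).image (· + (M + 1))).filter Nat.Prime, fun ℓ hℓ => ?_, hn.trans_eq ?_⟩
  · obtain ⟨h, hp⟩ := Finset.mem_filter.mp hℓ
    obtain ⟨i, -, rfl⟩ := Finset.mem_image.mp h
    exact ⟨hp, by omega⟩
  · rw [Finset.sum_filter, Finset.sum_image (add_left_injective _).injOn]
    refine Finset.sum_congr rfl fun i _ => ?_
    rw [hf, Set.indicator_apply]
    rfl

open scoped Classical in
lemma exists_sieve (M : ℕ) {ε : ℝ} (hε : 0 < ε) : ∃ S : Finset ℕ, (∀ ℓ ∈ S, ℓ.Prime ∧ M < ℓ) ∧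
    ∃ R₀ : ℕ, ∀ R : ℕ, R₀ ≤ R →
      (((box R).filter fun c => ∀ ℓ ∈ S, ¬ ExactlyDivides ℓ c.1 c.2).card : ℝ) ≤ ε * (R : ℝ) ^ 5 := by
  obtain ⟨S, hS, hsum⟩ := exists_primes_sum_ge (max M 5) (-2 * Real.log (ε / 9))
  refine ⟨S, fun ℓ hℓ => ⟨(hS ℓ hℓ).1, (le_max_left _ _).trans_lt (hS ℓ hℓ).2⟩, ∏ ℓ ∈ S, ℓ ^ 2, fun R hR => ?_⟩
  refine (card_sieve_le S (fun ℓ hℓ => ⟨(hS ℓ hℓ).1, ((le_max_right _ _).trans_lt (hS ℓ hℓ).2).le⟩) hR).trans ?_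
  refine mul_le_mul_of_nonneg_right ?_ (by positivity)
  have h1 : Real.exp (-(1 / 2 * ∑ ℓ ∈ S, 1 / (ℓ : ℝ))) ≤ ε / 9 := by
    rw [← Real.le_log_iff_exp_le (by positivity)]
    linarith
  linarith

open scoped Classical in
/-- For almost all pairs there are two large primes which divide `4A³ + 27B²` exactly once. -/
theorem exists_card_not_two_primes_le (M : ℕ) {ε : ℝ} (hε : 0 < ε) : ∃ R₀ : ℕ, ∀ R : ℕ, R₀ ≤ R →
    (((box R).filter fun c => ¬ ∃ ℓ₁ ℓ₂ : ℕ, ℓ₁ ≠ ℓ₂ ∧ ∀ ℓ ∈ ({ℓ₁, ℓ₂} : Set ℕ),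
      ℓ.Prime ∧ M < ℓ ∧ ExactlyDivides ℓ c.1 c.2).card : ℝ) ≤ ε * (R : ℝ) ^ 5 := by
  obtain ⟨S₁, h₁, R₁, hR₁⟩ := exists_sieve M (half_pos hε)
  obtain ⟨S₂, h₂, R₂, hR₂⟩ := exists_sieve (max M (S₁.sup id)) (half_pos hε)
  refine ⟨max R₁ R₂, fun R hR => ?_⟩
  have e₁ := hR₁ R ((le_max_left _ _).trans hR)
  have e₂ := hR₂ R ((le_max_right _ _).trans hR)
  have hsub : ((box R).filter fun c => ¬ ∃ ℓ₁ ℓ₂ : ℕ, ℓ₁ ≠ ℓ₂ ∧ ∀ ℓ ∈ ({ℓ₁, ℓ₂} : Set ℕ),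
      ℓ.Prime ∧ M < ℓ ∧ ExactlyDivides ℓ c.1 c.2) ⊆
      ((box R).filter fun c => ∀ ℓ ∈ S₁, ¬ ExactlyDivides ℓ c.1 c.2) ∪
      ((box R).filter fun c => ∀ ℓ ∈ S₂, ¬ ExactlyDivides ℓ c.1 c.2) := by
    intro c hc
    rw [Finset.mem_filter] at hc
    rw [Finset.mem_union, Finset.mem_filter, Finset.mem_filter]
    by_contra! hcon
    obtain ⟨ℓ₁, hm₁, hd₁⟩ := hcon.1 hc.1
    obtain ⟨ℓ₂, hm₂, hd₂⟩ := hcon.2 hc.1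
    have hlt : ℓ₁ < ℓ₂ := (Finset.le_sup (f := id) hm₁).trans_lt
      ((le_max_right _ _).trans_lt (h₂ ℓ₂ hm₂).2)
    refine hc.2 ⟨ℓ₁, ℓ₂, hlt.ne, ?_⟩
    rintro ℓ (rfl | rfl)
    · exact ⟨(h₁ _ hm₁).1, (h₁ _ hm₁).2, hd₁⟩
    · exact ⟨(h₂ _ hm₂).1, (le_max_left _ _).trans_lt (h₂ _ hm₂).2, hd₂⟩
  have h3 := (Finset.card_le_card hsub).trans (Finset.card_union_le _ _)
  rw [← Nat.cast_le (α := ℝ), Nat.cast_add] at h3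
  linarith

end Sieve

section Density

lemma isElliptic_shortCurve {A B : ℤ} (h : 4 * A ^ 3 + 27 * B ^ 2 ≠ 0) : (shortCurve A B).IsElliptic := by
  rw [isElliptic_iff, isUnit_iff_ne_zero]
  change (short (A : ℚ) (B : ℚ)).Δ ≠ 0
  rw [short_Δ]
  exact mul_ne_zero (by norm_num) (by exact_mod_cast h)

lemma sum_one_div_sq_le (n : ℕ) : ∑ q ∈ Finset.range n, 1 / ((q : ℝ) + 2) ^ 2 ≤ 1 - 1 / ((n : ℝ) + 1) := by
  induction n with
  | zero => simp
  | succ n ih =>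
    rw [Finset.sum_range_succ]
    have h : 1 / ((n : ℝ) + 2) ^ 2 ≤ 1 / ((n : ℝ) + 1) - 1 / ((n : ℝ) + 2) := by
      rw [div_sub_div _ _ (by positivity) (by positivity)]
      refine div_le_div₀ (by linarith) (by linarith) (by positivity) (by nlinarith)
    push_cast
    have e : (n : ℝ) + 1 + 1 = n + 2 := by ring
    rw [e]
    linarith

/-- At least half of the positive integers up to `N` are free of fourth powers. -/
lemma card_fourthPowerFree_ge (N : ℕ) : ∃ s : Finset ℕ, (∀ a ∈ s, 1 ≤ a ∧ a ≤ N) ∧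
    (∀ a ∈ s, ∀ q : ℕ, q.Prime → ¬ q ^ 4 ∣ a) ∧ (N : ℝ) / 2 ≤ s.card := by
  refine ⟨(Finset.Ioc 0 N).filter fun a => ∀ q ∈ Finset.range N, ¬ (q + 2) ^ 4 ∣ a, fun a ha => ?_,
    fun a ha q hq hdvd => ?_, ?_⟩
  · have := Finset.mem_Ioc.mp (Finset.mem_filter.mp ha).1
    exact ⟨this.1, this.2⟩
  · obtain ⟨h1, h2⟩ := Finset.mem_filter.mp ha
    have h1 := Finset.mem_Ioc.mp h1
    have h3 := Nat.le_of_dvd h1.1 hdvd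
    have h4 := Nat.le_self_pow (n := 4) (by norm_num) q
    have h5 := hq.two_le
    refine h2 (q - 2) (Finset.mem_range.mpr (by omega)) ?_
    rwa [Nat.sub_add_cancel h5]
  · set F := (Finset.Ioc 0 N).filter fun a => ∀ q ∈ Finset.range N, ¬ (q + 2) ^ 4 ∣ a
    have hsub : Finset.Ioc 0 N ⊆ F ∪ (Finset.range N).biUnion fun q =>
        (Finset.Ioc 0 N).filter fun a => (q + 2) ^ 4 ∣ a := by
      intro a ha
      rw [Finset.mem_union, Finset.mem_biUnion, or_iff_not_imp_left, Finset.mem_filter]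
      intro h
      push Not at h
      obtain ⟨q, hq, hd⟩ := h ha
      exact ⟨q, hq, Finset.mem_filter.mpr ⟨ha, hd⟩⟩
    have h1 := (Finset.card_le_card hsub).trans ((Finset.card_union_le _ _).trans
      (Nat.add_le_add_left Finset.card_biUnion_le _))
    rw [Nat.card_Ioc, Nat.sub_zero, ← Nat.cast_le (α := ℝ), Nat.cast_add, Nat.cast_sum] at h1
    have h2 : ∑ q ∈ Finset.range N, (((Finset.Ioc 0 N).filter fun a => (q + 2) ^ 4 ∣ a).card : ℝ) ≤
        ∑ q ∈ Finset.range N, (N : ℝ) / 4 * (1 / ((q : ℝ) + 2) ^ 2) := by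
      refine Finset.sum_le_sum fun q _ => ?_
      rw [Nat.Ioc_filter_dvd_card_eq_div]
      refine Nat.cast_div_le.trans ?_
      push_cast
      rw [div_mul_div_comm, mul_one]
      refine div_le_div_of_nonneg_left (by positivity) (by positivity) ?_
      have : (0 : ℝ) ≤ q := by positivity
      nlinarith [sq_nonneg (q : ℝ), mul_nonneg this (sq_nonneg ((q : ℝ) + 2))]
    rw [← Finset.mul_sum] at h2
    have h3 := sum_one_div_sq_le N
    have h4 : (0 : ℝ) ≤ 1 / ((N : ℝ) + 1) := by positivity
    have h5 : (N : ℝ) / 4 * ∑ q ∈ Finset.range N, 1 / ((q : ℝ) + 2) ^ 2 ≤ (N : ℝ) / 4 * 1 := by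
      gcongr
      linarith
    linarith

lemma mem_box_of_height {c : ℤ × ℤ} {R : ℕ} {X : ℝ} (h : (height c : ℝ) < X) (hX : X ≤ (R : ℝ) ^ 6) :
    c ∈ box R := by
  have h1 : height c < (R : ℤ) ^ 6 := by exact_mod_cast h.trans_le hX
  have h2 := (le_max_left _ _).trans_lt h1
  have h3 := (le_max_right _ _).trans_lt h1
  rw [abs_pow] at h2
  rw [mem_box]
  constructor
  · refine le_of_not_gt fun h => ?_
    have h4 : ((R : ℤ) ^ 2) ^ 3 ≤ |c.1| ^ 3 := pow_le_pow_left₀ (by positivity) h.le 3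
    have h5 : (0 : ℤ) ≤ |c.1| ^ 3 := by positivity
    rw [show ((R : ℤ) ^ 2) ^ 3 = R ^ 6 by ring] at h4
    linarith
  · refine le_of_not_gt fun h => ?_
    have h4 : ((R : ℤ) ^ 3) ^ 2 ≤ |c.2| ^ 2 := pow_le_pow_left₀ (by positivity) h.le 2
    rw [show ((R : ℤ) ^ 3) ^ 2 = R ^ 6 by ring, sq_abs] at h4
    linarith [sq_nonneg c.2]

lemma finite_height_lt (X : ℝ) : {c ∈ curves | (height c : ℝ) < X}.Finite := by
  obtain ⟨R, hR⟩ := exists_nat_ge (max X 1)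
  refine (Finset.finite_toSet (box R)).subset fun c hc => mem_box_of_height hc.2 ?_
  exact ((le_max_left _ _).trans hR).trans (le_self_pow₀ ((le_max_right _ _).trans hR) (by norm_num))

/-- There are many curves of bounded height. -/
lemma card_curves_ge {r : ℕ} {X : ℝ} (hX : 64 * (r : ℝ) ^ 6 ≤ X) :
    (r : ℝ) ^ 5 / 2 ≤ ({c ∈ curves | (height c : ℝ) < X}.ncard : ℝ) := by
  classical
  obtain ⟨s, hs1, hs2, hs⟩ := card_fourthPowerFree_ge (r ^ 2)
  let f : ℕ × ℕ → ℤ × ℤ := fun c => (c.1, c.2)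
  have hf : Function.Injective f := fun c c' h => by
    simp only [f, Prod.mk.injEq, Nat.cast_inj] at h
    exact Prod.ext h.1 h.2
  set T : Finset (ℤ × ℤ) := (s ×ˢ Finset.Icc 1 (r ^ 3)).image f
  have hT : (r : ℝ) ^ 5 / 2 ≤ T.card := by
    rw [Finset.card_image_of_injective _ hf, Finset.card_product, Nat.card_Icc, Nat.add_sub_cancel]
    push_cast at hs ⊢
    calc (r : ℝ) ^ 5 / 2 = (r : ℝ) ^ 2 / 2 * (r : ℝ) ^ 3 := by ring
      _ ≤ _ := by gcongr
  refine hT.trans ?_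
  rw [← Set.ncard_coe_finset T, Nat.cast_le]
  refine Set.ncard_le_ncard ?_ (finite_height_lt X)
  intro c hc
  obtain ⟨⟨a, b⟩, hab, rfl⟩ := Finset.mem_image.mp hc
  obtain ⟨ha, hb⟩ := Finset.mem_product.mp hab
  rw [Finset.mem_Icc] at hb
  dsimp only at ha hb
  obtain ⟨ha1, ha2⟩ := hs1 a ha
  refine ⟨⟨isElliptic_shortCurve ?_, fun q hq hd _ => hs2 a ha q hq
    (Int.natCast_dvd_natCast.mp (by push_cast; exact hd))⟩, ?_⟩
  · have : (0 : ℤ) < 4 * (a : ℤ) ^ 3 + 27 * (b : ℤ) ^ 2 := by positivity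
    exact this.ne'
  · have h1 : (a : ℝ) ^ 3 ≤ (r : ℝ) ^ 6 := by
      have : (a : ℝ) ≤ (r : ℝ) ^ 2 := by exact_mod_cast ha2
      calc (a : ℝ) ^ 3 ≤ ((r : ℝ) ^ 2) ^ 3 := by gcongr
        _ = _ := by ring
    have h2 : (b : ℝ) ^ 2 ≤ (r : ℝ) ^ 6 := by
      have : (b : ℝ) ≤ (r : ℝ) ^ 3 := by exact_mod_cast hb.2
      calc (b : ℝ) ^ 2 ≤ ((r : ℝ) ^ 3) ^ 2 := by gcongr
        _ = _ := by ring
    have hr : 0 < (a : ℝ) ^ 3 := by positivity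
    simp only [height, f]
    push_cast
    rw [abs_of_pos hr]
    refine max_lt ?_ ?_ <;> linarith

open scoped Classical in
/-- A property holds for almost all curves if its exceptions in boxes are negligible. -/
theorem holdsForDensityOne_of_card_le {P : WeierstrassCurve ℚ → Prop}
    (h : ∀ ε : ℝ, 0 < ε → ∃ R₀ : ℕ, ∀ R : ℕ, R₀ ≤ R →
      (((box R).filter fun c => c ∈ curves ∧ ¬ P (shortCurve c.1 c.2)).card : ℝ) ≤ ε * (R : ℝ) ^ 5) :
    HoldsForDensityOne P := by
  rw [HoldsForDensityOne, Metric.tendsto_atTop]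
  intro ε hε
  obtain ⟨R₀, hR₀⟩ := h (ε / 4096) (by positivity)
  refine ⟨(2 * ((R₀ : ℝ) + 1)) ^ 6, fun X hX => ?_⟩
  have hX0 : 0 < X := lt_of_lt_of_le (by positivity) hX
  set s := X ^ ((1 : ℝ) / 6) with hs
  have hs0 : 0 ≤ s := Real.rpow_nonneg hX0.le _
  have hs6 : s ^ 6 = X := by
    rw [hs, ← Real.rpow_natCast, ← Real.rpow_mul hX0.le]
    norm_num
  have hsR : 2 * ((R₀ : ℝ) + 1) ≤ s := by
    refine le_of_pow_le_pow_left₀ (n := 6) (by norm_num) hs0 ?_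
    rwa [hs6]
  set r := ⌊s / 2⌋₊ with hr
  have hr1 : (r : ℝ) ≤ s / 2 := Nat.floor_le (by positivity)
  have hr2 : s / 2 < r + 1 := Nat.lt_floor_add_one _
  have hrR : R₀ + 1 ≤ r := Nat.le_floor (by push_cast; linarith)
  set T := {c ∈ curves | (height c : ℝ) < X}
  set G := {c ∈ curves | (height c : ℝ) < X ∧ P (shortCurve c.1 c.2)}
  have hTfin : T.Finite := finite_height_lt X
  have hGT : G ⊆ T := fun c hc => ⟨hc.1, hc.2.1⟩
  have hTcard : (r : ℝ) ^ 5 / 2 ≤ T.ncard := by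
    refine card_curves_ge ?_
    calc 64 * (r : ℝ) ^ 6 ≤ 64 * (s / 2) ^ 6 := by gcongr
      _ = s ^ 6 := by ring
      _ = X := hs6
      _ ≤ X := le_rfl
  have hr0 : (1 : ℝ) ≤ r := by exact_mod_cast (by omega : 1 ≤ r)
  have hbad : ((T \ G).ncard : ℝ) ≤ ε / 4096 * ((2 * (r + 1) : ℕ) : ℝ) ^ 5 := by
    refine le_trans ?_ (hR₀ (2 * (r + 1)) (by omega))
    rw [Nat.cast_le, ← Set.ncard_coe_finset]
    refine Set.ncard_le_ncard ?_ (Finset.finite_toSet _)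
    intro c hc
    rw [Finset.mem_coe, Finset.mem_filter]
    refine ⟨mem_box_of_height hc.1.2 ?_, hc.1.1, fun hP => hc.2 ⟨hc.1.1, hc.1.2, hP⟩⟩
    rw [← hs6]
    push_cast
    exact pow_le_pow_left₀ hs0 (by linarith) 6
  have hsum : ((T \ G).ncard : ℝ) + G.ncard = T.ncard := by
    exact_mod_cast Set.ncard_sdiff_add_ncard_of_subset hGT hTfin
  have hTpos : (0 : ℝ) < T.ncard := lt_of_lt_of_le (by positivity) hTcard
  have hbad' : ((T \ G).ncard : ℝ) ≤ ε / 2 * T.ncard := by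
    calc ((T \ G).ncard : ℝ) ≤ _ := hbad
      _ ≤ ε / 4096 * (4 * (r : ℝ)) ^ 5 := by
        push_cast
        exact mul_le_mul_of_nonneg_left (pow_le_pow_left₀ (by positivity) (by linarith) 5) (by positivity)
      _ = ε / 2 * ((r : ℝ) ^ 5 / 2) := by ring
      _ ≤ _ := by gcongr
  have hdist : (G.ncard : ℝ) / T.ncard - 1 = -((T \ G).ncard / T.ncard) := by
    rw [← hsum] at hTpos ⊢
    field_simp
    ring
  rw [Real.dist_eq, hdist, abs_neg, abs_of_nonneg (by positivity)]
  calc ((T \ G).ncard : ℝ) / T.ncard ≤ ε / 2 := (div_le_iff₀ hTpos).mpr hbad'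
    _ < ε := half_lt_self hε

variable {p : ℕ} [Fact p.Prime]

/-- The second property, in terms of primes dividing `4A³ + 27B²` exactly once. -/
lemma conductor_and_ramified {A B : ℤ} [(shortCurve A B).IsElliptic] {ℓ : ℕ} (hℓ : ℓ.Prime)
    (h5 : 5 ≤ ℓ) (hℓp : ℓ ≠ p) (h : ExactlyDivides ℓ A B) :
    ℓ ∣ conductor (shortCurve A B) ∧ ¬ ℓ ^ 2 ∣ conductor (shortCurve A B) ∧
      IsTorsionRamifiedAt (shortCurve A B) p ℓ := by
  have : Fact ℓ.Prime := ⟨hℓ⟩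
  obtain ⟨h1, h2⟩ := dvd_conductor h5 h
  exact ⟨h1, h2, isTorsionRamifiedAt hℓ h5 h Fact.out hℓp⟩

lemma nontrivial_torsion_of_ramified {E : WeierstrassCurve ℚ} {ℓ : ℕ} (h : IsTorsionRamifiedAt E p ℓ) :
    Nontrivial (Torsion E (AlgebraicClosure ℚ) p) := by
  obtain ⟨-, -, -, σ, -, hσ⟩ := h
  by_contra hcon
  rw [not_nontrivial_iff_subsingleton] at hcon
  exact hσ (LinearMap.ext fun x => Subsingleton.elim _ _)

/-- For almost all elliptic curves, `E[p]` is irreducible and ramified at two primes which divide the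
conductor exactly once. -/
theorem holdsForDensityOne_irreducible_and_ramified (p : ℕ) [Fact p.Prime] :
    HoldsForDensityOne fun E : WeierstrassCurve ℚ =>
      IsTorsionIrreducible E p ∧
      ∃ ℓ₁ ℓ₂ : ℕ, ℓ₁ ≠ ℓ₂ ∧ ∀ ℓ ∈ ({ℓ₁, ℓ₂} : Set ℕ),
        ℓ.Prime ∧ ℓ ≠ p ∧
        ℓ ∣ conductor E ∧ ¬ ℓ ^ 2 ∣ conductor E ∧
        IsTorsionRamifiedAt E p ℓ := by
  classical
  refine holdsForDensityOne_of_card_le fun ε hε => ?_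
  obtain ⟨R₁, hR₁⟩ := exists_card_not_two_primes_le (max 5 p) (half_pos hε)
  obtain ⟨C, hC⟩ := exists_card_rootSum_le (Fact.out : p.Prime)
  refine ⟨max R₁ (max 1 ⌈2 * C / ε⌉₊), fun R hR => ?_⟩
  obtain ⟨hRR₁, hR'⟩ := max_le_iff.mp hR
  obtain ⟨hR1, hRC⟩ := max_le_iff.mp hR'
  have e₁ := hR₁ R hRR₁
  have e₂ : ((Finset.card _ : ℕ) : ℝ) ≤ _ := Nat.cast_le.mpr (hC R hR1)
  have hRC' : 2 * C / ε ≤ R := (Nat.le_ceil _).trans (by exact_mod_cast hRC)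
  rw [div_le_iff₀ hε] at hRC'
  have e₃ : (C : ℝ) * (R : ℝ) ^ 4 ≤ ε / 2 * (R : ℝ) ^ 5 := by
    have : (0 : ℝ) ≤ (R : ℝ) ^ 4 := by positivity
    nlinarith
  have hsub : ((box R).filter fun c => c ∈ curves ∧ ¬ (IsTorsionIrreducible (shortCurve c.1 c.2) p ∧
      ∃ ℓ₁ ℓ₂ : ℕ, ℓ₁ ≠ ℓ₂ ∧ ∀ ℓ ∈ ({ℓ₁, ℓ₂} : Set ℕ), ℓ.Prime ∧ ℓ ≠ p ∧
        ℓ ∣ conductor (shortCurve c.1 c.2) ∧ ¬ ℓ ^ 2 ∣ conductor (shortCurve c.1 c.2) ∧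
        IsTorsionRamifiedAt (shortCurve c.1 c.2) p ℓ)) ⊆
      ((box R).filter fun c => ¬ ∃ ℓ₁ ℓ₂ : ℕ, ℓ₁ ≠ ℓ₂ ∧ ∀ ℓ ∈ ({ℓ₁, ℓ₂} : Set ℕ),
        ℓ.Prime ∧ max 5 p < ℓ ∧ ExactlyDivides ℓ c.1 c.2) ∪
      ((box R).filter fun c => ∃ t, t ≠ 0 ∧ HasRootSum p c.1 c.2 t) := by
    intro c hc
    obtain ⟨hbox, hcur, hbad⟩ := Finset.mem_filter.mp hc
    rw [Finset.mem_union, Finset.mem_filter, Finset.mem_filter, or_iff_not_imp_left]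
    intro h
    have h := not_not.mp fun h' => h ⟨hbox, h'⟩
    obtain ⟨ℓ₁, ℓ₂, hne, hℓ⟩ := h
    have hell := hcur.1
    have hprop : ∀ ℓ ∈ ({ℓ₁, ℓ₂} : Set ℕ), ℓ ∣ conductor (shortCurve c.1 c.2) ∧
        ¬ ℓ ^ 2 ∣ conductor (shortCurve c.1 c.2) ∧ IsTorsionRamifiedAt (shortCurve c.1 c.2) p ℓ :=
      fun ℓ hm => by
        obtain ⟨h1, h2, h3⟩ := hℓ ℓ hm
        obtain ⟨h4, h5⟩ := max_lt_iff.mp h2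
        exact conductor_and_ramified h1 h4.le h5.ne' h3
    obtain ⟨h1, h2, h3⟩ := hℓ ℓ₁ (Or.inl rfl)
    obtain ⟨h4, h5⟩ := max_lt_iff.mp h2
    refine ⟨hbox, exists_hasRootSum (fun hirr => hbad ⟨hirr, ℓ₁, ℓ₂, hne, fun ℓ hm => ?_⟩)
      (nontrivial_torsion_of_ramified (hprop ℓ₁ (Or.inl rfl)).2.2) h1 h4.le h3 h5⟩
    exact ⟨(hℓ ℓ hm).1, (max_lt_iff.mp (hℓ ℓ hm).2.1).2.ne', hprop ℓ hm⟩
  have h3 := (Finset.card_le_card hsub).trans (Finset.card_union_le _ _)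
  rw [← Nat.cast_le (α := ℝ), Nat.cast_add] at h3
  push_cast at e₂
  refine le_trans (le_of_eq (by congr!)) (h3.trans ?_)
  linarith

end Density

end EllipticCurveDensity

end

theorem lemma3p4 (p : ℕ) [Fact p.Prime] :
    EllipticCurveDensity.HoldsForDensityOne fun E : WeierstrassCurve ℚ =>
      EllipticCurveDensity.IsTorsionIrreducible E p ∧
      ∃ ℓ₁ ℓ₂ : ℕ, ℓ₁ ≠ ℓ₂ ∧ ∀ ℓ ∈ ({ℓ₁, ℓ₂} : Set ℕ),
        ℓ.Prime ∧ ℓ ≠ p ∧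
        ℓ ∣ EllipticCurveDensity.conductor E ∧ ¬ ℓ ^ 2 ∣ EllipticCurveDensity.conductor E ∧
        EllipticCurveDensity.IsTorsionRamifiedAt E p ℓ :=
  EllipticCurveDensity.holdsForDensityOne_irreducible_and_ramified p
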